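/- Let $m\ge 1$ and let $p$, $q=p+2^m$ be odd primes. Let $D=D_1\cdots D_n$ be a product of distinct odd primes different from $p$ and $q$ ($n\ge 0$, the empty product being $1$), numbered so that $\left(\frac{pq}{D_i}\right)=1$ for $i\le s$ and $\left(\frac{pq}{D_k}\right)=-1$ for $s<k\le n$. Let $$E=E_+:\ y^2=x(x+pD)(x+qD),\qquad E':\ y^2=x^3-2(p+q)Dx^2+4^mD^2x,$$ let $\varphi:E\to E'$, $(x,y)\mapsto (y^2/x^2,\ y(pqD^2-x^2)/x^2)$, be the 2-isogeny with kernel $E[\varphi]=\{O,(0,0)\}$, and let $$S^{(\varphi)}(E/\mathbb Q)=\ker\Big(H^1(\mathbb Q,E[\varphi])\to\prod_v H^1(\mathbb Q_v,E)\Big),$$ $v$ running over all places of $\mathbb Q$, be its Selmer group. **The graph.** Let $\mathcal E$ be the set consisting of the following directed edges: $D_i\to D_j$ if $\left(\frac{D_j}{D_i}\right)=-1$ ($i\le s$, $1\le j\le n$); $D_k\to D_i$ if $\left(\frac{D_i}{D_k}\right)=-1$ ($i\le s<k\le n$); $l\to D_i$ if $\left(\frac{D_i}{l}\right)=-1$ ($l\in\{p,q\}$,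 $i\le s$); $D_i\to p$ if $\left(\frac{p}{D_i}\right)=-1$ ($i\le s$). The directed graph $G(+D)$ is defined as follows. * If $m=1$, or $m=2$ and $(p+2)D\not\equiv5\pmod 8$, or $m\ge3$ and $pD\equiv1\pmod 4$, its vertices are $-1,p,q,D_1,\dots,D_n$ and its edges are those of $\mathcal E$ together with $-1\to D_i$ whenever $i\le s$ and $\left(\frac{-1}{D_i}\right)=-1$. * Otherwise (that is, if $m=2$ and $(p+2)D\equiv5\pmod 8$, or $m\ge3$ and $pD\equiv3\pmod 4$) its vertices are $p,q,D_1,\dots,D_n$ and its edges are those of $\mathcal E$. **Partitions.** A partition of $G(+D)$ is an ordered pair $(V_1,V_2)$ of disjoint, possibly empty, sets whose union is the vertex set. For a vertex $P$ let $e(P)$ be the number of edges from $P$ to vertices in the part that does not contain $P$. The partition is *even* if $e(P)$ is even for every vertex $P$. It is *quasi-even* if, for every vertex $P$, $e(P)$ is even when $\left(\frac2P\right)=1$ and odd when $\left(\frac2P\right)=-1$. Here $\left(\frac2P\right)$ is the Legendre symbol for $P\ne-1$, and * $\left(\frac{2}{-1}\right)=1$ if $m=1$, $pD\equiv7\ (8)$,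 $D\equiv1\ (4)$; or $m=1$, $pD\equiv1\ (8)$, $D\equiv3\ (4)$; or $m\ge4$, $pD\equiv1\ (8)$; * $\left(\frac{2}{-1}\right)=-1$ if $m=1$, $pD\equiv5\ (8)$, $D\equiv1\ (4)$; or $m=1$, $pD\equiv7\ (8)$, $D\equiv3\ (4)$; or $m\ge4$, $pD\equiv5\ (8)$. (In case (b) below, whenever $-1$ is a vertex, exactly one of these conditions holds.) Call a partition *admissible* if none of $-1,p,q$ and $D_k$ ($s<k\le n$) lies in $V_1$. **Theorem 1.1.** (a) Suppose that one of the following holds: (1) $m=1$, $pD\equiv5\pmod 8$ and $D\equiv3\pmod 4$; (2) $m=1$, $pD\equiv1\pmod 8$ and $D\equiv1\pmod 4$; (3) $m=2$; (4) $pD\equiv3\pmod 8$; (5) $m=3$ and $pD\equiv1\pmod 4$; (6) $m=4$ and $pD\equiv7\pmod 8$. Then $\#S^{(\varphi)}(E/\mathbb Q)$ equals the number of admissible even partitions of $G(+D)$. (b) In all other cases, $\#S^{(\varphi)}(E/\mathbb Q)$ equals the number of admissible even partitions of $G(+D)$ plus the number of admissible quasi-even partitions of $G(+D)$. -/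

import Mathlib

open WeierstrassCurve
open scoped Classical WeierstrassCurve.Affine

/-! ### The Selmer group attached to a finite subgroup of an elliptic curve over `ℚ` -/

/-- The group `W(K̄)` of points of `W` over an algebraic closure of an extension `K` of `ℚ`. -/
abbrev GeomPoint (W : WeierstrassCurve ℚ) (K : Type) [Field K] [Algebra ℚ K] : Type :=
  (W⁄(AlgebraicClosure K)).toAffine.Point

/-- The absolute Galois group of `K`; it carries the Krull topology. -/
abbrev AbsGal (K : Type) [Field K] : Type :=
  AlgebraicClosure K ≃ₐ[K] AlgebraicClosure K

/-- The action of the absolute Galois group of `K` on `W(K̄)` through the coordinates. -/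
noncomputable def galAct (W : WeierstrassCurve ℚ) (K : Type) [Field K] [Algebra ℚ K]
    (σ : AbsGal K) : GeomPoint W K →+ GeomPoint W K :=
  Affine.Point.map (W' := W) (σ : AlgebraicClosure K →ₐ[K] AlgebraicClosure K)

/-- The embeddings `F̄ → K̄` of algebraic closures of extensions `F`, `K` of `ℚ` (below: `F = ℚ`). -/
abbrev ClosureEmb (F K : Type) [Field F] [Algebra ℚ F] [Field K] [Algebra ℚ K] : Type :=
  AlgebraicClosure F →ₐ[ℚ] AlgebraicClosure K

/-- The map `W(F̄) → W(K̄)` induced by an embedding `ι : F̄ → K̄`. -/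
noncomputable def embPoint (W : WeierstrassCurve ℚ) {F K : Type} [Field F] [Algebra ℚ F]
    [Field K] [Algebra ℚ K] (ι : ClosureEmb F K) : GeomPoint W F →+ GeomPoint W K :=
  Affine.Point.map (W' := W) ι

/-- The continuous 1-cocycles `Z¹(Gal(ℚ̄/ℚ), Φ)` of a (Galois stable) subgroup `Φ` of `W(ℚ̄)`,
the latter with its discrete topology. -/
noncomputable def cocycles (W : WeierstrassCurve ℚ) (Φ : AddSubgroup (GeomPoint W ℚ)) :
    AddSubgroup (AbsGal ℚ → GeomPoint W ℚ) where
  carrier := {c | IsLocallyConstant c ∧ (∀ σ, c σ ∈ Φ) ∧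
    ∀ σ τ, c (σ * τ) = c σ + galAct W ℚ σ (c τ)}
  zero_mem' := ⟨IsLocallyConstant.const 0, fun _ => Φ.zero_mem, fun _ _ => by simp⟩
  add_mem' := by
    rintro c d ⟨hc, hc', hc''⟩ ⟨hd, hd', hd''⟩
    refine ⟨hc.add hd, fun σ => Φ.add_mem (hc' σ) (hd' σ), fun σ τ => ?_⟩
    simp only [Pi.add_apply, hc'', hd'', map_add]
    abel
  neg_mem' := by
    rintro c ⟨hc, hc', hc''⟩
    refine ⟨hc.neg, fun σ => Φ.neg_mem (hc' σ), fun σ τ => ?_⟩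
    simp only [Pi.neg_apply, hc'', map_neg]
    abel

/-- The 1-coboundaries `B¹(Gal(ℚ̄/ℚ), Φ)`: the functions `σ ↦ σ P - P` with `P ∈ Φ`. -/
noncomputable def coboundaries (W : WeierstrassCurve ℚ) (Φ : AddSubgroup (GeomPoint W ℚ)) :
    AddSubgroup (AbsGal ℚ → GeomPoint W ℚ) where
  carrier := {c | ∃ P ∈ Φ, ∀ σ, c σ = galAct W ℚ σ P - P}
  zero_mem' := ⟨0, Φ.zero_mem, fun _ => by simp⟩
  add_mem' := by
    rintro c d ⟨P, hP, hc⟩ ⟨Q, hQ, hd⟩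
    refine ⟨P + Q, Φ.add_mem hP hQ, fun σ => ?_⟩
    simp only [Pi.add_apply, hc, hd, map_add]
    abel
  neg_mem' := by
    rintro c ⟨P, hP, hc⟩
    refine ⟨-P, Φ.neg_mem hP, fun σ => ?_⟩
    simp only [Pi.neg_apply, hc, map_neg]
    abel

/-- The functions on `Gal(ℚ̄/ℚ)` whose restriction to `Gal(K̄/K)` is a coboundary with values in
`W(K̄)`. For a cocycle `c` with values in `Φ` this says that the class of `c` is killed by
`H¹(ℚ, Φ) → H¹(K, W)`. The restriction map belongs to an embedding `ι : ℚ̄ → K̄`: it sends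
`σ ∈ Gal(K̄/K)` to the unique `τ ∈ Gal(ℚ̄/ℚ)` with `ι ∘ τ = σ ∘ ι`. The condition is the same for
every `ι`. -/
noncomputable def locallyTrivial (W : WeierstrassCurve ℚ) (K : Type) [Field K] [Algebra ℚ K] :
    AddSubgroup (AbsGal ℚ → GeomPoint W ℚ) where
  carrier := {c | ∀ ι : ClosureEmb ℚ K, ∃ P : GeomPoint W K,
    ∀ (σ : AbsGal K) (τ : AbsGal ℚ), (∀ x, ι (τ x) = σ (ι x)) →
      embPoint W ι (c τ) = galAct W K σ P - P}
  zero_mem' := fun ι => ⟨0, fun _ _ _ => by simp⟩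
  add_mem' := by
    intro c d hc hd ι
    obtain ⟨P, hP⟩ := hc ι
    obtain ⟨Q, hQ⟩ := hd ι
    refine ⟨P + Q, fun σ τ h => ?_⟩
    simp only [Pi.add_apply, map_add, hP σ τ h, hQ σ τ h]
    abel
  neg_mem' := by
    intro c hc ι
    obtain ⟨P, hP⟩ := hc ι
    refine ⟨-P, fun σ τ h => ?_⟩
    simp only [Pi.neg_apply, map_neg, hP σ τ h]
    abel

/-- The cocycles that become trivial in `H¹(ℚ_v, W)` for every place `v` of `ℚ`. -/
noncomputable def selmerCocycles (W : WeierstrassCurve ℚ) (Φ : AddSubgroup (GeomPoint W ℚ)) :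
    AddSubgroup (AbsGal ℚ → GeomPoint W ℚ) :=
  cocycles W Φ ⊓ locallyTrivial W ℝ ⊓
    ⨅ (l : ℕ) (_ : Fact l.Prime), locallyTrivial W ℚ_[l]

/-- `H¹(ℚ, Φ) = Z¹ / B¹`. -/
abbrev H1 (W : WeierstrassCurve ℚ) (Φ : AddSubgroup (GeomPoint W ℚ)) : Type :=
  cocycles W Φ ⧸ (coboundaries W Φ).addSubgroupOf (cocycles W Φ)

/-- The Selmer group `ker (H¹(ℚ, Φ) → ∏_v H¹(ℚ_v, W))`, `v` running over all places of `ℚ`. For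
the kernel `Φ = W[φ]` of an isogeny `φ` it is the `φ`-Selmer group `S^(φ)(W/ℚ)`. -/
noncomputable def selmerGroup (W : WeierstrassCurve ℚ) (Φ : AddSubgroup (GeomPoint W ℚ)) :
    AddSubgroup (H1 W Φ) :=
  ((selmerCocycles W Φ).addSubgroupOf (cocycles W Φ)).map (QuotientAddGroup.mk' _)

/-! ### The curve and the kernel of its 2-isogeny -/

/-- The curve `E : y² = x (x + pD) (x + qD)`, that is `y² = x³ + (p + q) D x² + p q D² x`. -/
def curveE (p q D : ℕ) : WeierstrassCurve ℚ where
  a₁ := 0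
  a₂ := (p + q) * D
  a₃ := 0
  a₄ := p * q * D ^ 2
  a₆ := 0

theorem curveE_equation (p q D : ℕ) (x y : ℚ) :
    (curveE p q D).toAffine.Equation x y ↔ y ^ 2 = x * (x + p * D) * (x + q * D) := by
  rw [Affine.equation_iff]
  simp only [curveE]
  constructor <;> intro h <;> linear_combination h

/-- `E[φ] = {O, (0, 0)}`, the kernel of the 2-isogeny
`φ : E → E', (x, y) ↦ (y² / x², y (pqD² - x²) / x²)`. -/
noncomputable def kerPhi (p q D : ℕ) : AddSubgroup (GeomPoint (curveE p q D) ℚ) where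
  carrier := {P | P = 0 ∨ ∃ h, P = Affine.Point.some 0 0 h}
  zero_mem' := Or.inl rfl
  add_mem' := by
    rintro P Q (rfl | ⟨h, rfl⟩) (rfl | ⟨h', rfl⟩)
    · exact Or.inl (add_zero 0)
    · exact Or.inr ⟨h', zero_add _⟩
    · exact Or.inr ⟨h, add_zero _⟩
    · exact Or.inl (Affine.Point.add_of_Y_eq rfl (by simp [Affine.negY, curveE]))
  neg_mem' := by
    rintro P (rfl | ⟨h, rfl⟩)
    · exact Or.inl neg_zero
    · refine Or.inr ⟨h, ?_⟩
      rw [Affine.Point.neg_some]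
      simp [Affine.negY, curveE]

/-! ### Directed graphs, even and quasi-even partitions -/

/-- A finite directed graph whose vertices are integers. -/
structure IntDigraph where
  verts : Finset ℤ
  Adj : ℤ → ℤ → Prop

namespace IntDigraph

/-- `#{P → A}`, the number of edges from `P` to vertices in `A`. -/
noncomputable def edgesTo (G : IntDigraph) (P : ℤ) (A : Finset ℤ) : ℕ :=
  (A.filter fun R => G.Adj P R).card

/-- `(V₁, V₂)` is an ordered partition of the vertex set (empty parts are allowed). -/
def IsPartition (G : IntDigraph) (V₁ V₂ : Finset ℤ) : Prop :=
  V₁ ∪ V₂ = G.verts ∧ Disjoint V₁ V₂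

/-- Even partitions. -/
def IsEven (G : IntDigraph) (V₁ V₂ : Finset ℤ) : Prop :=
  G.IsPartition V₁ V₂ ∧
    (∀ P ∈ V₁, G.edgesTo P V₂ ≡ 0 [MOD 2]) ∧ (∀ P ∈ V₂, G.edgesTo P V₁ ≡ 0 [MOD 2])

/-- Quasi-even partitions; `χ P` plays the role of the symbol `(2/P)`. -/
def IsQuasiEven (G : IntDigraph) (χ : ℤ → ℤ) (V₁ V₂ : Finset ℤ) : Prop :=
  G.IsPartition V₁ V₂ ∧
    (∀ P ∈ V₁, (χ P = 1 → G.edgesTo P V₂ ≡ 0 [MOD 2]) ∧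
      (χ P = -1 → G.edgesTo P V₂ ≡ 1 [MOD 2])) ∧
    (∀ P ∈ V₂, (χ P = 1 → G.edgesTo P V₁ ≡ 0 [MOD 2]) ∧
      (χ P = -1 → G.edgesTo P V₁ ≡ 1 [MOD 2]))

end IntDigraph

/-! ### The directed graph `G(+D)`

All symbols `jacobiSym a l` below have an odd prime `l` as lower entry, so they are Legendre
symbols. The primes `D₁, …, Dₙ` are the prime factors of `D`. -/

/-- The primes `D_i`, `i ≤ s`: the prime factors `l` of `D` with `(pq/l) = 1`. -/
noncomputable def primesPlus (p q D : ℕ) : Finset ℕ :=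
  D.primeFactors.filter fun l => jacobiSym ((p : ℤ) * q) l = 1

/-- The primes `D_j`, `s < j ≤ n`: the prime factors `l` of `D` with `(pq/l) = -1`. -/
noncomputable def primesMinus (p q D : ℕ) : Finset ℕ :=
  D.primeFactors.filter fun l => jacobiSym ((p : ℤ) * q) l = -1

/-- The edges not issuing from `-1`. -/
inductive CommonEdge (p q D : ℕ) : ℤ → ℤ → Prop
  | plus_to_any {P R : ℕ} (hP : P ∈ primesPlus p q D) (hR : R ∈ D.primeFactors)
      (h : jacobiSym R P = -1) : CommonEdge p q D P R
  | minus_to_plus {P R : ℕ} (hP : P ∈ primesMinus p q D) (hR : R ∈ primesPlus p q D)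
      (h : jacobiSym R P = -1) : CommonEdge p q D P R
  | pq_to_plus {l R : ℕ} (hl : l = p ∨ l = q) (hR : R ∈ primesPlus p q D)
      (h : jacobiSym R l = -1) : CommonEdge p q D l R
  | plus_to_p {P : ℕ} (hP : P ∈ primesPlus p q D)
      (h : jacobiSym p P = -1) : CommonEdge p q D P p

/-- The graph `G₁(+D)`, with vertices `-1, p, q, D₁, …, Dₙ`. -/
noncomputable def graphOne (p q D : ℕ) : IntDigraph where
  verts := {(-1 : ℤ), (p : ℤ), (q : ℤ)} ∪ D.primeFactors.image (fun l : ℕ => (l : ℤ))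
  Adj P R := CommonEdge p q D P R ∨
    (P = -1 ∧ ∃ l ∈ primesPlus p q D, R = (l : ℤ) ∧ jacobiSym (-1) l = -1)

/-- The graph `G₂(+D)`, with vertices `p, q, D₁, …, Dₙ`. -/
noncomputable def graphTwo (p q D : ℕ) : IntDigraph where
  verts := {(p : ℤ), (q : ℤ)} ∪ D.primeFactors.image (fun l : ℕ => (l : ℤ))
  Adj P R := CommonEdge p q D P R

/-- The condition under which `G(+D)` is `G₁(+D)`. For odd `p`, `D` and `m ≥ 1` its negation is:
`m = 2` and `(p + 2) D ≡ 5 (mod 8)`, or `m ≥ 3` and `p D ≡ 3 (mod 4)`. -/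
def UsesGraphOne (m p D : ℕ) : Prop :=
  m = 1 ∨ (m = 2 ∧ ¬ (p + 2) * D ≡ 5 [MOD 8]) ∨ (3 ≤ m ∧ p * D ≡ 1 [MOD 4])

/-- The graph `G(+D)`. -/
noncomputable def graphPlus (m p q D : ℕ) : IntDigraph :=
  if UsesGraphOne m p D then graphOne p q D else graphTwo p q D

/-- The conditions that make `(2 / (-1)) = 1`. -/
def TwoNegOnePos (m p D : ℕ) : Prop :=
  (m = 1 ∧ p * D ≡ 7 [MOD 8] ∧ D ≡ 1 [MOD 4]) ∨
  (m = 1 ∧ p * D ≡ 1 [MOD 8] ∧ D ≡ 3 [MOD 4]) ∨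
  (4 ≤ m ∧ p * D ≡ 1 [MOD 8])

/-- The conditions that make `(2 / (-1)) = -1`. -/
def TwoNegOneNeg (m p D : ℕ) : Prop :=
  (m = 1 ∧ p * D ≡ 5 [MOD 8] ∧ D ≡ 1 [MOD 4]) ∨
  (m = 1 ∧ p * D ≡ 7 [MOD 8] ∧ D ≡ 3 [MOD 4]) ∨
  (4 ≤ m ∧ p * D ≡ 5 [MOD 8])

/-- The symbol `(2/P)` for a vertex `P`: the Legendre symbol if `P` is an odd prime, the convention
above if `P = -1` (with the dummy value `0` where `(2 / (-1))` is left undefined). -/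
noncomputable def twoSymbol (m p D : ℕ) (P : ℤ) : ℤ :=
  if P = -1 then
    (if TwoNegOnePos m p D then 1 else if TwoNegOneNeg m p D then -1 else 0)
  else jacobiSym 2 P.natAbs

/-- None of `-1`, `p`, `q` and the primes `D_k`, `k > s`, lies in `V₁`. -/
def Admissible (p q D : ℕ) (V₁ : Finset ℤ) : Prop :=
  (-1 : ℤ) ∉ V₁ ∧ (p : ℤ) ∉ V₁ ∧ (q : ℤ) ∉ V₁ ∧ ∀ l ∈ primesMinus p q D, (l : ℤ) ∉ V₁

/-- The number of even partitions `(V₁, V₂)` of `G(+D)` with admissible `V₁`. -/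
noncomputable def numEven (m p q D : ℕ) : ℕ :=
  Set.ncard {V : Finset ℤ × Finset ℤ |
    (graphPlus m p q D).IsEven V.1 V.2 ∧ Admissible p q D V.1}

/-- The number of quasi-even partitions `(V₁, V₂)` of `G(+D)` with admissible `V₁`. -/
noncomputable def numQuasiEven (m p q D : ℕ) : ℕ :=
  Set.ncard {V : Finset ℤ × Finset ℤ |
    (graphPlus m p q D).IsQuasiEven (twoSymbol m p D) V.1 V.2 ∧ Admissible p q D V.1}

/-- The six listed conditions on `m`, `p`, `D`. -/
def OnlyEven (m p D : ℕ) : Prop :=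
  (m = 1 ∧ p * D ≡ 5 [MOD 8] ∧ D ≡ 3 [MOD 4]) ∨
  (m = 1 ∧ p * D ≡ 1 [MOD 8] ∧ D ≡ 1 [MOD 4]) ∨
  m = 2 ∨
  p * D ≡ 3 [MOD 8] ∨
  (m = 3 ∧ p * D ≡ 1 [MOD 4]) ∨
  (m = 4 ∧ p * D ≡ 7 [MOD 8])

/-- The condition that the torsor of class `d` of the 2-isogeny of `y² = x³ + a x² + b x` with
kernel generated by `(0, 0)` has a point over `K`. -/
def TorsorSoluble {K : Type*} [Field K] (a b d : K) : Prop :=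
  IsSquare d ∨ ∃ r s : K, d * s ^ 2 = (d * r ^ 2 - a) ^ 2 - 4 * b

/-! ### Equations of E over an extension, and translation by (0, 0) -/

section CurvePoints

variable {p q D : ℕ} {L : Type} [Field L] [Algebra ℚ L]

theorem curveE_baseChange_a₁ : ((curveE p q D)⁄L).toAffine.a₁ = 0 :=
  map_zero (algebraMap ℚ L)

theorem curveE_baseChange_a₂ : ((curveE p q D)⁄L).toAffine.a₂ = (p + q) * D := by
  change algebraMap ℚ L ((p + q) * D) = _
  simp only [map_add, map_mul, map_natCast]

theorem curveE_baseChange_a₃ : ((curveE p q D)⁄L).toAffine.a₃ = 0 :=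
  map_zero (algebraMap ℚ L)

theorem curveE_baseChange_a₄ : ((curveE p q D)⁄L).toAffine.a₄ = p * q * D ^ 2 := by
  change algebraMap ℚ L (p * q * D ^ 2) = _
  simp only [map_mul, map_pow, map_natCast]

theorem curveE_baseChange_a₆ : ((curveE p q D)⁄L).toAffine.a₆ = 0 :=
  map_zero (algebraMap ℚ L)

theorem curveE_baseChange_equation (x y : L) :
    ((curveE p q D)⁄L).toAffine.Equation x y ↔
      y ^ 2 = x ^ 3 + (p + q) * D * x ^ 2 + p * q * D ^ 2 * x := by
  rw [Affine.equation_iff]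
  simp only [curveE_baseChange_a₁, curveE_baseChange_a₂, curveE_baseChange_a₃,
    curveE_baseChange_a₄, curveE_baseChange_a₆, zero_mul, add_zero]

theorem curveE_Δ : (curveE p q D).Δ = 16 * (p * q * D ^ 2) ^ 2 * ((p - q) * D) ^ 2 := by
  simp only [curveE, WeierstrassCurve.Δ, WeierstrassCurve.b₂, WeierstrassCurve.b₄,
    WeierstrassCurve.b₆, WeierstrassCurve.b₈]
  ring

/-- The conditions for `curveE p q D` to be an elliptic curve. -/
structure CurveNonsingular (p q D : ℕ) : Prop where
  p_ne : p ≠ 0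
  q_ne : q ≠ 0
  D_ne : D ≠ 0
  p_ne_q : p ≠ q

theorem CurveNonsingular.Δ_ne (h : CurveNonsingular p q D) : (curveE p q D).Δ ≠ 0 := by
  have h1 : (p : ℚ) ≠ 0 := by exact_mod_cast h.p_ne
  have h2 : (q : ℚ) ≠ 0 := by exact_mod_cast h.q_ne
  have h3 : (D : ℚ) ≠ 0 := by exact_mod_cast h.D_ne
  have h4 : (p - q : ℚ) ≠ 0 := sub_ne_zero.2 (by exact_mod_cast h.p_ne_q)
  rw [curveE_Δ]
  positivity

theorem curveE_nonsingular (h : CurveNonsingular p q D) (x y : L) :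
    ((curveE p q D)⁄L).toAffine.Nonsingular x y ↔
      y ^ 2 = x ^ 3 + (p + q) * D * x ^ 2 + p * q * D ^ 2 * x := by
  rw [← curveE_baseChange_equation]
  refine (Affine.equation_iff_nonsingular_of_Δ_ne_zero ?_).symm
  change ((curveE p q D).map (algebraMap ℚ L)).Δ ≠ 0
  rw [WeierstrassCurve.map_Δ]
  exact (map_ne_zero_iff _ (algebraMap ℚ L).injective).2 h.Δ_ne

/-- The point `(0, 0)`. -/
noncomputable def zeroPoint (h : CurveNonsingular p q D) (L : Type) [Field L] [Algebra ℚ L] :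
    ((curveE p q D)⁄L).toAffine.Point :=
  Affine.Point.some 0 0 ((curveE_nonsingular h 0 0).2 (by ring))

theorem zeroPoint_ne_zero (h : CurveNonsingular p q D) : zeroPoint h L ≠ 0 :=
  Affine.Point.some_ne_zero _

theorem zeroPoint_add_self (h : CurveNonsingular p q D) :
    zeroPoint h L + zeroPoint h L = 0 :=
  Affine.Point.add_of_Y_eq rfl (by
    rw [Affine.negY, curveE_baseChange_a₁, curveE_baseChange_a₃]; simp)

/-- The line joining (x, y) to the origin meets the cubic at abscissae 0, x and a third one whose
product with x is b = pqD². Translation thus swaps x with b/x and negates y/x, which is what makes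
the torsor coordinates below Galois invariant. -/
theorem some_add_zeroPoint (h : CurveNonsingular p q D) {x y : L}
    (hxy : ((curveE p q D)⁄L).toAffine.Nonsingular x y) (hx : x ≠ 0) :
    ∃ h', Affine.Point.some x y hxy + zeroPoint h L =
      Affine.Point.some (p * q * D ^ 2 / x) (-(p * q * D ^ 2) * y / x ^ 2) h' := by
  have e := (curveE_nonsingular h x y).1 hxy
  have e1 : ((curveE p q D)⁄L).toAffine.addX x 0 (((curveE p q D)⁄L).toAffine.slope x 0 y 0)
      = p * q * D ^ 2 / x := by
    rw [Affine.slope_of_X_ne hx]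
    simp only [Affine.addX, curveE_baseChange_a₁, curveE_baseChange_a₂]
    field_simp
    linear_combination x * e
  have e2 : ((curveE p q D)⁄L).toAffine.addY x 0 y (((curveE p q D)⁄L).toAffine.slope x 0 y 0)
      = -(p * q * D ^ 2) * y / x ^ 2 := by
    rw [Affine.addY, Affine.negAddY, Affine.negY, e1, Affine.slope_of_X_ne hx]
    simp only [curveE_baseChange_a₁, curveE_baseChange_a₃]
    field_simp
    ring
  have key := Affine.Point.add_of_X_ne (h₁ := hxy)
    (h₂ := (curveE_nonsingular h (0 : L) 0).2 (by ring)) hx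
  refine ⟨?_, ?_⟩
  · rw [← e1, ← e2]
    exact Affine.nonsingular_add hxy ((curveE_nonsingular h (0 : L) 0).2 (by ring)) fun hh => hx hh.1
  · rw [zeroPoint, key]
    simp only [e1, e2]

end CurvePoints

/-! ### H¹(ℚ, E[φ]) as ℚˣ modulo squares -/

section Galois

theorem mem_range_of_forall_apply_eq {K : Type} [Field K] [CharZero K] {x : AlgebraicClosure K}
    (hx : ∀ σ : AbsGal K, σ x = x) : x ∈ Set.range (algebraMap K (AlgebraicClosure K)) :=
  (InfiniteGalois.mem_range_algebraMap_iff_fixed x).2 hx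

theorem mem_range_ratCast_of_forall_apply_eq {x : AlgebraicClosure ℚ}
    (hx : ∀ σ : AbsGal ℚ, σ x = x) : ∃ r : ℚ, (r : AlgebraicClosure ℚ) = x := by
  obtain ⟨r, hr⟩ := mem_range_of_forall_apply_eq hx
  exact ⟨r, by rw [← hr, eq_ratCast]⟩

theorem isOpen_setOf_apply_eq {K : Type} [Field K] (β : AlgebraicClosure K) :
    IsOpen {σ : AbsGal K | σ β = β} :=
  stabilizer_isOpen_of_isIntegral β

/-- By the infinite Galois correspondence a closed subgroup is recovered from its fixed field, so an
element outside it must move something in that field. -/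
theorem fixingSubgroup_fixedField_of_isClosed {K : Type} [Field K] [CharZero K]
    {H : Subgroup (AbsGal K)} (hH : IsClosed (H : Set (AbsGal K))) {σ : AbsGal K} (hσ : σ ∉ H) :
    ∃ α : AlgebraicClosure K, (∀ τ ∈ H, τ α = α) ∧ σ α ≠ α := by
  have hfix := InfiniteGalois.fixingSubgroup_fixedField (k := K) (K := AlgebraicClosure K) ⟨H, hH⟩
  have e : (IntermediateField.fixedField H).fixingSubgroup = H := hfix
  rw [← e, IntermediateField.mem_fixingSubgroup_iff] at hσ
  push Not at hσ
  obtain ⟨α, hα, hα0⟩ := hσ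
  exact ⟨α, (IntermediateField.mem_fixedField_iff H α).1 hα, hα0⟩

variable {p q D : ℕ}

/-- The point `(0, 0)` of `E(K̄)`. -/
noncomputable def geomZeroPoint (h : CurveNonsingular p q D) (K : Type) [Field K] [Algebra ℚ K] :
    GeomPoint (curveE p q D) K :=
  zeroPoint h (AlgebraicClosure K)

theorem geomZeroPoint_ne_zero (h : CurveNonsingular p q D) (K : Type) [Field K] [Algebra ℚ K] :
    geomZeroPoint h K ≠ 0 :=
  zeroPoint_ne_zero h

theorem geomZeroPoint_add_self (h : CurveNonsingular p q D) (K : Type) [Field K] [Algebra ℚ K] :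
    geomZeroPoint h K + geomZeroPoint h K = 0 :=
  zeroPoint_add_self h

theorem mem_kerPhi (h : CurveNonsingular p q D) (P : GeomPoint (curveE p q D) ℚ) :
    P ∈ kerPhi p q D ↔ P = 0 ∨ P = geomZeroPoint h ℚ :=
  or_congr_right ⟨fun ⟨_, e⟩ => e, fun e => ⟨_, e⟩⟩

theorem galAct_zeroPoint (h : CurveNonsingular p q D) (K : Type) [Field K] [Algebra ℚ K]
    (σ : AbsGal K) : galAct (curveE p q D) K σ (geomZeroPoint h K) = geomZeroPoint h K := by
  simp only [galAct, geomZeroPoint, zeroPoint, Affine.Point.map_some, map_zero]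

theorem embPoint_zeroPoint (h : CurveNonsingular p q D) {K : Type} [Field K] [Algebra ℚ K]
    (ι : ClosureEmb ℚ K) : embPoint (curveE p q D) ι (geomZeroPoint h ℚ) = geomZeroPoint h K := by
  simp only [embPoint, geomZeroPoint, zeroPoint, Affine.Point.map_some, map_zero]

theorem galAct_of_mem_kerPhi (h : CurveNonsingular p q D) (σ : AbsGal ℚ)
    {P : GeomPoint (curveE p q D) ℚ} (hP : P ∈ kerPhi p q D) :
    galAct (curveE p q D) ℚ σ P = P := by
  rcases (mem_kerPhi h P).1 hP with rfl | rfl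
  · exact map_zero _
  · exact galAct_zeroPoint h ℚ σ

/-- The Galois action on E[φ] is trivial; hence H¹ is the group of cocycles itself, and these are
homomorphisms. -/
theorem coboundaries_kerPhi (h : CurveNonsingular p q D) :
    coboundaries (curveE p q D) (kerPhi p q D) = ⊥ := by
  rw [eq_bot_iff]
  rintro c ⟨P, hP, hc⟩
  exact funext fun σ => by rw [hc, galAct_of_mem_kerPhi h σ hP, sub_self]; rfl

theorem card_selmerGroup (h : CurveNonsingular p q D) :
    Nat.card (selmerGroup (curveE p q D) (kerPhi p q D)) =
      Nat.card (selmerCocycles (curveE p q D) (kerPhi p q D)) := by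
  have hle : selmerCocycles (curveE p q D) (kerPhi p q D) ≤
      cocycles (curveE p q D) (kerPhi p q D) :=
    inf_le_left.trans inf_le_left
  have hinj : Function.Injective (QuotientAddGroup.mk'
      ((coboundaries (curveE p q D) (kerPhi p q D)).addSubgroupOf
        (cocycles (curveE p q D) (kerPhi p q D)))) := by
    rw [← AddMonoidHom.ker_eq_bot_iff, QuotientAddGroup.ker_mk', coboundaries_kerPhi h]
    exact AddSubgroup.bot_addSubgroupOf _
  rw [selmerGroup]
  rw [← Nat.card_congr (AddSubgroup.equivMapOfInjective _ _ hinj).toEquiv]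
  exact Nat.card_congr (AddSubgroup.addSubgroupOfEquivOfLe hle).toEquiv

/-- The function on the Galois group attached to an element `β` whose square is rational. -/
noncomputable def kummerCocycle (h : CurveNonsingular p q D) (β : AlgebraicClosure ℚ)
    (σ : AbsGal ℚ) : GeomPoint (curveE p q D) ℚ :=
  if σ β = β then 0 else geomZeroPoint h ℚ

theorem apply_eq_or_eq_neg {K L : Type*} [Field K] [Field L] [Algebra K L] (σ : L ≃ₐ[K] L)
    {β : L} {d : K} (hβ : β ^ 2 = algebraMap K L d) : σ β = β ∨ σ β = -β := by
  apply sq_eq_sq_iff_eq_or_eq_neg.1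
  rw [← map_pow, hβ, AlgEquiv.commutes]

theorem apply_eq_or_eq_neg_of_sq_eq_ratCast (σ : AbsGal ℚ) {β : AlgebraicClosure ℚ} {d : ℚ}
    (hβ : β ^ 2 = (d : AlgebraicClosure ℚ)) : σ β = β ∨ σ β = -β :=
  apply_eq_or_eq_neg σ (d := d) (by rw [hβ, eq_ratCast])

theorem isLocallyConstant_apply (β : AlgebraicClosure ℚ) :
    IsLocallyConstant fun σ : AbsGal ℚ => σ β := by
  rw [IsLocallyConstant.iff_exists_open]
  intro σ
  refine ⟨(fun τ => σ⁻¹ * τ) ⁻¹' {τ | τ β = β},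
    (isOpen_setOf_apply_eq β).preimage (continuous_const_mul _), by simp, fun τ hτ => ?_⟩
  have h2 := congrArg σ (show (σ⁻¹ * τ) β = β from hτ)
  rwa [← AlgEquiv.mul_apply, mul_inv_cancel_left] at h2

theorem kummerCocycle_mem_cocycles (h : CurveNonsingular p q D) {β : AlgebraicClosure ℚ} {d : ℚ}
    (hd : d ≠ 0) (hβ : β ^ 2 = (d : AlgebraicClosure ℚ)) :
    kummerCocycle h β ∈ cocycles (curveE p q D) (kerPhi p q D) := by
  have hΦ : ∀ σ, kummerCocycle h β σ ∈ kerPhi p q D := fun σ => by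
    rw [mem_kerPhi h, kummerCocycle]; split_ifs <;> simp
  refine ⟨(isLocallyConstant_apply β).comp (fun x => if x = β then 0 else geomZeroPoint h ℚ), hΦ,
    fun σ τ => ?_⟩
  rw [galAct_of_mem_kerPhi h σ (hΦ τ)]
  have hβ0 : β ≠ 0 := by
    rintro rfl
    apply hd
    simpa using hβ.symm
  have hne : -β ≠ β := fun e => hβ0 (self_eq_neg.1 e.symm)
  simp only [kummerCocycle, AlgEquiv.mul_apply]
  rcases apply_eq_or_eq_neg_of_sq_eq_ratCast σ hβ with hs | hs <;> rcases apply_eq_or_eq_neg_of_sq_eq_ratCast τ hβ with ht | ht <;>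
    simp [hs, ht, hne, geomZeroPoint_add_self]

/-- Surjectivity of the Kummer map. The kernel H of a nontrivial c is closed of index 2. Take σ₀ ∉ H
and α fixed by H but not by σ₀: all of the complement sends α to σ₀α, so β = α - σ₀α is fixed by H
and negated off H, and β² is rational. -/
theorem exists_kummerCocycle (h : CurveNonsingular p q D)
    {c : AbsGal ℚ → GeomPoint (curveE p q D) ℚ}
    (hc : c ∈ cocycles (curveE p q D) (kerPhi p q D)) :
    ∃ (β : AlgebraicClosure ℚ) (d : ℚ), d ≠ 0 ∧ β ^ 2 = (d : AlgebraicClosure ℚ) ∧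
      c = kummerCocycle h β := by
  obtain ⟨hloc, hmem, hmul⟩ := hc
  replace hmul : ∀ σ τ, c (σ * τ) = c σ + c τ := fun σ τ => by
    rw [hmul, galAct_of_mem_kerPhi h σ (hmem τ)]
  have hmem' := fun σ => (mem_kerPhi h _).1 (hmem σ)
  by_cases htriv : ∀ σ, c σ = 0
  · exact ⟨1, 1, one_ne_zero, by simp, funext fun σ => by simp [kummerCocycle, htriv]⟩
  push Not at htriv
  obtain ⟨σ₀, hσ₀⟩ := htriv
  have c1 : c 1 = 0 := by simpa using hmul 1 1
  have hT : ∀ σ, c σ ≠ 0 → c σ = geomZeroPoint h ℚ := fun σ hσ => (hmem' σ).resolve_left hσ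
  have cinv : ∀ σ, c σ⁻¹ = - c σ := fun σ => by
    rw [eq_neg_iff_add_eq_zero, ← hmul, inv_mul_cancel, c1]
  let H : Subgroup (AbsGal ℚ) :=
    { carrier := {σ | c σ = 0}
      one_mem' := c1
      mul_mem' := fun {σ τ} (hs : c σ = 0) (ht : c τ = 0) => by
        simp [hmul, hs, ht]
      inv_mem' := fun {σ} (hs : c σ = 0) => by simp [cinv, hs] }
  have hclosed : IsClosed (H : Set (AbsGal ℚ)) := hloc.isClosed_fiber 0
  obtain ⟨α, hα', hα0⟩ := fixingSubgroup_fixedField_of_isClosed hclosed (show σ₀ ∉ H from hσ₀)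
  replace hα' : ∀ σ, c σ = 0 → σ α = α := hα'
  have hσ0 : ∀ σ, c σ ≠ 0 → c (σ₀⁻¹ * σ) = 0 := fun σ hσ => by
    rw [hmul, cinv, hT σ hσ, hT σ₀ hσ₀, neg_add_cancel]
  have hact : ∀ σ, c σ ≠ 0 → σ α = σ₀ α := fun σ hσ => by
    have := congrArg σ₀ (hα' _ (hσ0 σ hσ))
    rw [← AlgEquiv.mul_apply, mul_inv_cancel_left] at this
    exact this
  have hβ1 : ∀ σ, c σ = 0 → σ (α - σ₀ α) = α - σ₀ α := fun σ hσ => by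
    rw [map_sub, hα' σ hσ, ← AlgEquiv.mul_apply, hact (σ * σ₀) (by rw [hmul, hσ, zero_add]; exact hσ₀)]
  have hβ2 : ∀ σ, c σ ≠ 0 → σ (α - σ₀ α) = -(α - σ₀ α) := fun σ hσ => by
    rw [map_sub, hact σ hσ, ← AlgEquiv.mul_apply, hα' (σ * σ₀) (by
      rw [hmul, hT σ hσ, hT σ₀ hσ₀, geomZeroPoint_add_self]), neg_sub]
  have hne : α - σ₀ α ≠ 0 := sub_ne_zero.2 (Ne.symm hα0)
  have hneg : -(α - σ₀ α) ≠ α - σ₀ α := fun e => hne (self_eq_neg.1 e.symm)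
  have hsq : ∃ d : ℚ, (d : AlgebraicClosure ℚ) = (α - σ₀ α) ^ 2 := by
    refine mem_range_ratCast_of_forall_apply_eq fun σ => ?_
    rw [map_pow]
    by_cases hσ : c σ = 0
    · rw [hβ1 σ hσ]
    · rw [hβ2 σ hσ, neg_sq]
  obtain ⟨d, hd⟩ := hsq
  refine ⟨α - σ₀ α, d, ?_, hd.symm, funext fun σ => ?_⟩
  · rintro rfl
    rw [Rat.cast_zero] at hd
    exact hne (pow_eq_zero_iff two_ne_zero |>.1 hd.symm)
  · by_cases hσ : c σ = 0
    · simp [kummerCocycle, hβ1 σ hσ, hσ]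
    · simp only [kummerCocycle, hβ2 σ hσ, hneg, if_false]
      exact hT σ hσ

theorem kummerCocycle_mul (h : CurveNonsingular p q D) (β : AlgebraicClosure ℚ) {r : ℚ}
    (hr : r ≠ 0) : kummerCocycle h ((r : AlgebraicClosure ℚ) * β) = kummerCocycle h β := by
  funext σ
  have : (r : AlgebraicClosure ℚ) ≠ 0 := by exact_mod_cast hr
  simp only [kummerCocycle, map_mul, map_ratCast, mul_right_inj' this]

/-- Injectivity modulo squares: β and β' change sign under the same σ, so ββ' is rational. -/
theorem isSquare_mul_of_kummerCocycle_eq (h : CurveNonsingular p q D) {β β' : AlgebraicClosure ℚ}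
    {d d' : ℚ} (hβ : β ^ 2 = (d : AlgebraicClosure ℚ)) (hβ' : β' ^ 2 = (d' : AlgebraicClosure ℚ))
    (e : kummerCocycle h β = kummerCocycle h β') : IsSquare (d * d') := by
  have hfix : ∃ r : ℚ, (r : AlgebraicClosure ℚ) = β * β' := by
    refine mem_range_ratCast_of_forall_apply_eq fun σ => ?_
    have e' := congrFun e σ
    simp only [kummerCocycle] at e'
    rw [map_mul]
    have z := geomZeroPoint_ne_zero h ℚ
    rcases apply_eq_or_eq_neg_of_sq_eq_ratCast σ hβ with hs | hs <;>
      rcases apply_eq_or_eq_neg_of_sq_eq_ratCast σ hβ' with ht | ht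
    · rw [hs, ht]
    · by_cases h2 : σ β' = β'
      · rw [hs, h2]
      · exact absurd e' (by simpa [hs, h2] using z.symm)
    · by_cases h2 : σ β = β
      · rw [ht, h2]
      · exact absurd e' (by simpa [ht, h2] using z)
    · rw [hs, ht, neg_mul_neg]
  obtain ⟨r, hr⟩ := hfix
  refine ⟨r, Rat.cast_injective (α := AlgebraicClosure ℚ) ?_⟩
  rw [Rat.cast_mul, Rat.cast_mul, hr, ← hβ, ← hβ']
  ring

end Galois

/-! ### Local triviality as solubility of a quartic torsor -/

section LocalCondition

theorem exists_ringHom_algebraicClosure {F L : Type*} [Field F] [Field L] [IsAlgClosed L]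
    (f : F →+* L) : Nonempty (AlgebraicClosure F →+* L) := by
  let := f.toAlgebra
  exact ⟨(IsAlgClosed.lift : AlgebraicClosure F →ₐ[F] L).toRingHom⟩

theorem exists_closureEmb (K : Type) [Field K] [Algebra ℚ K] : Nonempty (ClosureEmb ℚ K) := by
  obtain ⟨f⟩ := exists_ringHom_algebraicClosure (algebraMap ℚ (AlgebraicClosure K))
  exact ⟨f.toRatAlgHom⟩

/-- An algebraic closure is normal over its base, so its image under ι is stable under every
endomorphism of L fixing F. -/
theorem exists_restriction_of_prime_field {F L : Type*} [Field F] [Field L]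
    (ι : AlgebraicClosure F →+* L) (σ : L →+* L)
    (hσ : ∀ x : F, σ (ι (algebraMap F _ x)) = ι (algebraMap F _ x)) :
    ∃ τ : AlgebraicClosure F ≃ₐ[F] AlgebraicClosure F, ∀ x, ι (τ x) = σ (ι x) := by
  let := ι.toAlgebra
  let : Algebra F L := (ι.comp (algebraMap F (AlgebraicClosure F))).toAlgebra
  have : IsScalarTower F (AlgebraicClosure F) L := IsScalarTower.of_algebraMap_eq fun _ => rfl
  let σ' : L →ₐ[F] L := { σ with commutes' := hσ }
  exact ⟨σ'.restrictNormal' (AlgebraicClosure F), fun x =>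
    σ'.restrictNormal_commutes (AlgebraicClosure F) x⟩

theorem exists_restriction {K : Type} [Field K] [Algebra ℚ K] (ι : ClosureEmb ℚ K) (σ : AbsGal K) :
    ∃ τ : AbsGal ℚ, ∀ x, ι (τ x) = σ (ι x) :=
  exists_restriction_of_prime_field (ι : AlgebraicClosure ℚ →+* AlgebraicClosure K)
    (σ : AlgebraicClosure K →+* AlgebraicClosure K) fun x => by simp

variable {p q D : ℕ}

/-- Each σ restricts to some τ, so τ can be eliminated; the value of the cocycle at τ depends only
on whether σ fixes ι β. -/
theorem kummerCocycle_mem_locallyTrivial_iff_exists_point (h : CurveNonsingular p q D)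
    (β : AlgebraicClosure ℚ) (K : Type) [Field K] [Algebra ℚ K] :
    kummerCocycle h β ∈ locallyTrivial (curveE p q D) K ↔
      ∀ ι : ClosureEmb ℚ K, ∃ P : GeomPoint (curveE p q D) K, ∀ σ : AbsGal K,
        galAct (curveE p q D) K σ P = P + if σ (ι β) = ι β then 0 else geomZeroPoint h K := by
  refine forall_congr' fun ι => exists_congr fun P => ?_
  have key : ∀ (σ : AbsGal K) (τ : AbsGal ℚ), (∀ x, ι (τ x) = σ (ι x)) →
      embPoint (curveE p q D) ι (kummerCocycle h β τ) =
        if σ (ι β) = ι β then 0 else geomZeroPoint h K := fun σ τ hτ => by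
    have hι : ι (τ β) = ι β ↔ τ β = β := (RingHom.injective ι.toRingHom).eq_iff
    simp only [kummerCocycle, ← hτ, hι]
    split_ifs
    · exact map_zero _
    · exact embPoint_zeroPoint h ι
  constructor
  · intro H σ
    obtain ⟨τ, hτ⟩ := exists_restriction ι σ
    rw [← key σ τ hτ, H σ τ hτ]
    abel
  · intro H σ τ hτ
    rw [key σ τ hτ, H σ]
    abel

theorem map_zeroPoint (h : CurveNonsingular p q D) {K L : Type} [Field K] [Field L]
    [Algebra ℚ K] [Algebra ℚ L] [Algebra K L] [IsScalarTower ℚ K L] (σ : L ≃ₐ[K] L) :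
    Affine.Point.map (W' := curveE p q D) (σ : L →ₐ[K] L) (zeroPoint h L) = zeroPoint h L := by
  simp only [zeroPoint, Affine.Point.map_some, map_zero]

/-- Descent from a twisted point. Translation by (0, 0) negates y/x and x - b/x, just as σ negates
δ, so r = y/(xδ) and s = (x - b/x)/δ lie in K. The curve equation gives d r² - a = x + b/x, and (x +
b/x)² - 4b = (x - b/x)². -/
theorem torsorSoluble_of_point (h : CurveNonsingular p q D) {K L : Type} [Field K] [Field L]
    [Algebra ℚ K] {_ : Algebra ℚ L} [Algebra K L] [IsScalarTower ℚ K L] [CharZero L]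
    (hgal : ∀ x : L, (∀ σ : L ≃ₐ[K] L, σ x = x) → x ∈ Set.range (algebraMap K L))
    {δ : L} {d : K} (hd : d ≠ 0) (hδ : δ ^ 2 = algebraMap K L d)
    {P : ((curveE p q D)⁄L).toAffine.Point}
    (hP : ∀ σ : L ≃ₐ[K] L, Affine.Point.map (W' := curveE p q D) (σ : L →ₐ[K] L) P =
      P + if σ δ = δ then 0 else zeroPoint h L) :
    TorsorSoluble ((p + q) * D : K) (p * q * D ^ 2) d := by
  have hδ0 : δ ≠ 0 := by
    rintro rfl
    apply hd
    simpa using hδ.symm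
  -- A Galois-fixed P, here O or (0, 0), leaves no room for the twist: every σ fixes δ, and d is a
  -- square in K.
  have hfixed : (∀ σ : L ≃ₐ[K] L, Affine.Point.map (W' := curveE p q D) (σ : L →ₐ[K] L) P = P) →
      TorsorSoluble ((p + q) * D : K) (p * q * D ^ 2) d := fun H => by
    left
    obtain ⟨c, hc⟩ := hgal δ fun σ => by
      by_contra hσ
      have := hP σ
      rw [H σ, if_neg hσ, left_eq_add] at this
      exact zeroPoint_ne_zero h this
    exact ⟨c, (algebraMap K (L)).injective (by rw [← hδ, ← hc, ← map_pow, sq])⟩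
  rcases P with _ | ⟨x, y, hxy⟩
  · exact hfixed fun σ => map_zero _
  have e := (curveE_nonsingular h x y).1 hxy
  by_cases hx : x = 0
  · subst hx
    have hy : y = 0 := by simpa using e
    subst hy
    exact hfixed fun σ => map_zeroPoint h σ
  right
  have hσ : ∀ σ : L ≃ₐ[K] L, (σ δ = δ ∧ σ x = x ∧ σ y = y) ∨
      (σ δ = -δ ∧ σ x = p * q * D ^ 2 / x ∧ σ y = -(p * q * D ^ 2) * y / x ^ 2) := fun σ => by
    have e1 := hP σ
    rw [Affine.Point.map_some] at e1
    by_cases hs : σ δ = δ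
    · rw [if_pos hs, add_zero] at e1
      exact Or.inl ⟨hs, by rw [Affine.Point.some.injEq] at e1; exact e1⟩
    · rw [if_neg hs] at e1
      obtain ⟨h', e2⟩ := some_add_zeroPoint h hxy hx
      rw [e2] at e1
      exact Or.inr ⟨(apply_eq_or_eq_neg σ hδ).resolve_left hs,
        by rw [Affine.Point.some.injEq] at e1; exact e1⟩
  have hp : (p : L) ≠ 0 := by exact_mod_cast h.p_ne
  have hq : (q : L) ≠ 0 := by exact_mod_cast h.q_ne
  have hD : (D : L) ≠ 0 := by exact_mod_cast h.D_ne
  obtain ⟨r, hr⟩ := hgal (y / x / δ) fun σ => by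
    rcases hσ σ with ⟨h1, h2, h3⟩ | ⟨h1, h2, h3⟩
    · simp only [map_div₀, h1, h2, h3]
    · simp only [map_div₀, h1, h2, h3]
      field_simp
  obtain ⟨s, hs⟩ := hgal ((x - p * q * D ^ 2 / x) / δ) fun σ => by
    rcases hσ σ with ⟨h1, h2, h3⟩ | ⟨h1, h2, h3⟩
    · simp only [map_div₀, map_sub, map_mul, map_pow, map_natCast, h1, h2]
    · simp only [map_div₀, map_sub, map_mul, map_pow, map_natCast, h1, h2]
      field_simp
      ring
  refine ⟨r, s, (algebraMap K (L)).injective ?_⟩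
  simp only [map_mul, map_sub, map_pow, map_add, map_natCast, map_ofNat, hr, hs, ← hδ]
  have e1 : δ ^ 2 * (y / x / δ) ^ 2 = x + p * q * D ^ 2 / x + (p + q) * D := by
    field_simp
    linear_combination e
  rw [e1]
  field_simp
  ring

/-- The inverse construction: with u = d r² - a, the numbers (u ± δs)/2 have product b and are
conjugate when δ is not in K. Take x to be one of them and y = xδr. When d is a square, O does. -/
theorem exists_point_of_torsorSoluble (h : CurveNonsingular p q D) {K L : Type} [Field K] [Field L]
    [Algebra ℚ K] {_ : Algebra ℚ L} [Algebra K L] [IsScalarTower ℚ K L] [CharZero L]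
    {δ : L} {d : K} (hδ : δ ^ 2 = algebraMap K L d)
    (H : TorsorSoluble ((p + q) * D : K) (p * q * D ^ 2) d) :
    ∃ P : ((curveE p q D)⁄L).toAffine.Point, ∀ σ : L ≃ₐ[K] L,
      Affine.Point.map (W' := curveE p q D) (σ : L →ₐ[K] L) P =
        P + if σ δ = δ then 0 else zeroPoint h L := by
  rcases H with ⟨c, rfl⟩ | ⟨r, s, H⟩
  · refine ⟨0, fun σ => ?_⟩
    have : δ = algebraMap K _ c ∨ δ = -algebraMap K _ c := by
      apply sq_eq_sq_iff_eq_or_eq_neg.1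
      rw [hδ, map_mul, sq]
    have hs : σ δ = δ := by rcases this with rfl | rfl <;> simp
    rw [if_pos hs, map_zero, add_zero]
  have H' := congrArg (algebraMap K (L)) H
  simp only [map_mul, map_sub, map_pow, map_add, map_natCast, map_ofNat, ← hδ] at H'
  set r' := algebraMap K (L) r with hr'
  set s' := algebraMap K (L) s with hs'
  have hp : (p : L) ≠ 0 := by exact_mod_cast h.p_ne
  have hq : (q : L) ≠ 0 := by exact_mod_cast h.q_ne
  have hD : (D : L) ≠ 0 := by exact_mod_cast h.D_ne
  have hb : (p * q * D ^ 2 : L) ≠ 0 := by simp [hp, hq, hD]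
  obtain ⟨u, hu⟩ : ∃ u, u = δ ^ 2 * r' ^ 2 - (p + q) * D := ⟨_, rfl⟩
  rw [← hu] at H'
  have hprod : (u + δ * s') / 2 * ((u - δ * s') / 2) = p * q * D ^ 2 := by
    linear_combination -H' / 4
  obtain ⟨x, hx⟩ : ∃ x, x = (u + δ * s') / 2 := ⟨_, rfl⟩
  have hx0 : x ≠ 0 := by
    intro h0
    rw [← hx, h0, zero_mul] at hprod
    exact hb hprod.symm
  have hx' : (u - δ * s') / 2 = p * q * D ^ 2 / x := by
    rw [eq_div_iff hx0, ← hprod, ← hx]; ring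
  have hxu : x + p * q * D ^ 2 / x = u := by rw [← hx', hx]; ring
  have hxy : ((curveE p q D)⁄(L)).toAffine.Nonsingular x (x * δ * r') := by
    rw [curveE_nonsingular h]
    have : (p * q * D ^ 2 : L) = x * (u - x) := by
      rw [← hxu]; field_simp; ring
    rw [this, hu]
    ring
  refine ⟨Affine.Point.some _ _ hxy, fun σ => ?_⟩
  have hu' : σ u = u := by
    simp only [hu, map_mul, map_sub, map_pow, map_add, map_natCast, hr', AlgEquiv.commutes]
    rw [← map_pow, hδ, AlgEquiv.commutes]
  rw [Affine.Point.map_some]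
  by_cases hs : σ δ = δ
  · rw [if_pos hs, add_zero]
    have e1 : σ x = x := by
      simp only [hx, map_div₀, map_add, map_mul, hu', hs, hs', AlgEquiv.commutes, map_ofNat]
    simp only [Affine.Point.some.injEq]
    refine ⟨e1, ?_⟩
    simp only [map_mul, AlgEquiv.coe_toAlgHom, e1, hs, hr', AlgEquiv.commutes]
  · rw [if_neg hs]
    have hs2 := (apply_eq_or_eq_neg σ hδ).resolve_left hs
    obtain ⟨h', e2⟩ := some_add_zeroPoint h hxy hx0
    rw [e2]
    have e1 : σ x = p * q * D ^ 2 / x := by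
      rw [← hx']
      simp only [hx, map_div₀, map_add, map_mul, hu', hs2, hs', AlgEquiv.commutes, map_ofNat]
      ring
    simp only [Affine.Point.some.injEq]
    refine ⟨e1, ?_⟩
    simp only [map_mul, AlgEquiv.coe_toAlgHom, e1, hs2, hr', AlgEquiv.commutes]
    field_simp

theorem kummerCocycle_mem_locallyTrivial_iff (h : CurveNonsingular p q D) {β : AlgebraicClosure ℚ}
    {d : ℚ} (hd : d ≠ 0) (hβ : β ^ 2 = (d : AlgebraicClosure ℚ)) (K : Type) [Field K] [Algebra ℚ K]
    [CharZero K] :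
    kummerCocycle h β ∈ locallyTrivial (curveE p q D) K ↔
      TorsorSoluble ((p + q) * D : K) (p * q * D ^ 2) (d : K) := by
  have hι : ∀ ι : ClosureEmb ℚ K, (ι β) ^ 2 = algebraMap K _ (d : K) := fun ι => by
    rw [← map_pow, hβ, map_ratCast, map_ratCast]
  rw [kummerCocycle_mem_locallyTrivial_iff_exists_point]
  constructor
  · intro H
    obtain ⟨ι⟩ := exists_closureEmb K
    obtain ⟨P, hP⟩ := H ι
    exact torsorSoluble_of_point h (fun x => mem_range_of_forall_apply_eq) (by exact_mod_cast hd) (hι ι) hP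
  · exact fun H ι => exists_point_of_torsorSoluble h (hι ι) H

end LocalCondition

/-! ### Selmer classes as positive squarefree integers -/

section SelmerCount

variable {p q D : ℕ}

theorem primeFactors_subset_of_isSquare_mul {d d' : ℕ} (hd : Squarefree d)
    (hsq : IsSquare (d * d')) : ∀ l, l.Prime → l ∣ d → l ∣ d' := by
  intro l hl hld
  obtain ⟨k, hk⟩ := hsq
  by_contra hld'
  have hlk : l ∣ k := by
    have : l ∣ k * k := hk ▸ hld.mul_right d'
    exact (hl.dvd_mul.1 this).elim id id
  have : l * l ∣ d * d' := hk ▸ mul_dvd_mul hlk hlk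
  have hc : Nat.Coprime (l * l) d' :=
    Nat.Coprime.mul_left ((Nat.Prime.coprime_iff_not_dvd hl).2 hld')
      ((Nat.Prime.coprime_iff_not_dvd hl).2 hld')
  exact hl.one_lt.ne' (Nat.isUnit_iff.1 (hd l (hc.dvd_of_dvd_mul_right this)))

theorem eq_of_squarefree_of_isSquare_mul {d d' : ℕ} (hd : Squarefree d) (hd' : Squarefree d')
    (hsq : IsSquare (d * d')) : d = d' := by
  rw [← Nat.prod_primeFactors_of_squarefree hd, ← Nat.prod_primeFactors_of_squarefree hd']
  congr 1
  ext l
  simp only [Nat.mem_primeFactors, hd.ne_zero, hd'.ne_zero, ne_eq, not_false_eq_true, and_true]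
  exact and_congr_right fun hl => ⟨primeFactors_subset_of_isSquare_mul hd hsq l hl,
    primeFactors_subset_of_isSquare_mul hd' (by rwa [mul_comm]) l hl⟩

/-- For d < 0 one has d r² ≤ 0 ≤ a, so the right side is at least a² - 4b = ((p-q)D)² > 0 while d s²
≤ 0. -/
theorem pos_of_torsorSoluble_real (h : CurveNonsingular p q D) {d : ℝ} (hd : d ≠ 0)
    (H : TorsorSoluble ((p + q) * D : ℝ) (p * q * D ^ 2) d) : 0 < d := by
  rcases H with hs | ⟨r, s, H⟩
  · exact lt_of_le_of_ne hs.nonneg hd.symm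
  by_contra hneg
  push Not at hneg
  have hD : (D : ℝ) ≠ 0 := by exact_mod_cast h.D_ne
  have hpq : (p - q : ℝ) ≠ 0 := sub_ne_zero.2 (by exact_mod_cast h.p_ne_q)
  have h1 : 0 < ((p - q) * D : ℝ) ^ 2 := by positivity
  have h2 : d * s ^ 2 ≤ 0 := mul_nonpos_of_nonpos_of_nonneg hneg (sq_nonneg s)
  have h3 : d * r ^ 2 ≤ 0 := mul_nonpos_of_nonpos_of_nonneg hneg (sq_nonneg r)
  have h4 : 0 ≤ ((p + q) * D : ℝ) := by positivity
  nlinarith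

/-- The fraction d and the integer num·den differ by the square den²; writing |num·den| = a²b then
removes a². -/
theorem exists_squarefree_int_representative {β : AlgebraicClosure ℚ} {d : ℚ} (hd : d ≠ 0)
    (hβ : β ^ 2 = (d : AlgebraicClosure ℚ)) :
    ∃ (r : ℚ) (b : ℕ) (ε : ℤ), r ≠ 0 ∧ Squarefree b ∧ (ε = 1 ∨ ε = -1) ∧
      ((r : AlgebraicClosure ℚ) * β) ^ 2 = ((ε * b : ℚ) : AlgebraicClosure ℚ) := by
  have hN : d.num * d.den ≠ 0 := mul_ne_zero (Rat.num_ne_zero.2 hd) (by exact_mod_cast d.den_nz)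
  obtain ⟨b, a, hab, hb⟩ := Nat.sq_mul_squarefree (d.num * d.den).natAbs
  have hNn : (d.num * d.den).natAbs ≠ 0 := Int.natAbs_ne_zero.2 hN
  have ha : a ≠ 0 := by rintro rfl; apply hNn; rw [← hab]; ring
  refine ⟨d.den / a, b, (d.num * d.den).sign, ?_, hb, ?_, ?_⟩
  · have : (d.den : ℚ) ≠ 0 := by exact_mod_cast d.den_nz
    positivity
  · rcases lt_or_gt_of_ne hN with h1 | h1
    · exact Or.inr (Int.sign_eq_neg_one_of_neg h1)
    · exact Or.inl (Int.sign_eq_one_of_pos h1)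
  · rw [mul_pow, hβ, ← Rat.cast_pow, ← Rat.cast_mul]
    congr 1
    have e := Int.sign_mul_natAbs (d.num * d.den)
    rw [← hab] at e
    have e' : ((d.num * d.den).sign : ℚ) * ((a : ℚ) ^ 2 * b) = d.num * d.den := by
      exact_mod_cast e
    have ha' : (a : ℚ) ≠ 0 := by exact_mod_cast ha
    have hd' : (d.den : ℚ) ≠ 0 := by exact_mod_cast d.den_nz
    have hq : d * d.den = d.num := Rat.mul_den_eq_num d
    field_simp
    rw [← hq] at e'
    linear_combination -e'

/-- The positive squarefree integers whose torsors are soluble at all finite places. -/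
def selmerIntegers (p q D : ℕ) : Set ℕ :=
  {d | Squarefree d ∧ ∀ (l : ℕ) (_ : Fact l.Prime),
    TorsorSoluble ((p + q) * D : ℚ_[l]) (p * q * D ^ 2) (d : ℚ_[l])}

theorem kummerCocycle_mem_selmerCocycles_iff (h : CurveNonsingular p q D) {β : AlgebraicClosure ℚ}
    {d : ℚ} (hd : d ≠ 0) (hβ : β ^ 2 = (d : AlgebraicClosure ℚ)) :
    kummerCocycle h β ∈ selmerCocycles (curveE p q D) (kerPhi p q D) ↔
      TorsorSoluble ((p + q) * D : ℝ) (p * q * D ^ 2) (d : ℝ) ∧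
      ∀ (l : ℕ) (_ : Fact l.Prime),
        TorsorSoluble ((p + q) * D : ℚ_[l]) (p * q * D ^ 2) (d : ℚ_[l]) := by
  simp only [selmerCocycles, AddSubgroup.mem_inf, AddSubgroup.mem_iInf,
    kummerCocycle_mem_cocycles h hd hβ, true_and,
    kummerCocycle_mem_locallyTrivial_iff h hd hβ ℝ]
  exact and_congr_right fun _ => forall_congr' fun l => forall_congr' fun hl =>
    kummerCocycle_mem_locallyTrivial_iff h hd hβ ℚ_[l]

theorem card_selmerGroup_eq_ncard (h : CurveNonsingular p q D) :
    Nat.card (selmerGroup (curveE p q D) (kerPhi p q D)) = (selmerIntegers p q D).ncard := by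
  rw [card_selmerGroup h, ← Nat.card_coe_set_eq]
  have hroot : ∀ d : ℕ, ∃ β : AlgebraicClosure ℚ, β ^ 2 = ((d : ℚ) : AlgebraicClosure ℚ) :=
    fun d => IsAlgClosed.exists_pow_nat_eq _ two_pos
  choose β hβ using hroot
  have hmem : ∀ d ∈ selmerIntegers p q D,
      kummerCocycle h (β d) ∈ selmerCocycles (curveE p q D) (kerPhi p q D) := fun d hd => by
    rw [kummerCocycle_mem_selmerCocycles_iff h (by exact_mod_cast hd.1.ne_zero) (hβ d)]
    refine ⟨Or.inl ?_, fun l hl => by simpa using hd.2 l hl⟩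
    exact ⟨√d, by simp⟩
  let f : selmerIntegers p q D → selmerCocycles (curveE p q D) (kerPhi p q D) :=
    fun d => ⟨kummerCocycle h (β d), hmem d d.2⟩
  refine (Nat.card_congr (Equiv.ofBijective f ⟨fun d d' e => ?_, fun c => ?_⟩)).symm
  · have := isSquare_mul_of_kummerCocycle_eq h (hβ d) (hβ d') (congrArg Subtype.val e)
    rw [← Nat.cast_mul, Rat.isSquare_natCast_iff] at this
    exact Subtype.ext (eq_of_squarefree_of_isSquare_mul d.2.1 d'.2.1 this)
  · obtain ⟨β₀, d₀, hd₀, hβ₀, hc⟩ := exists_kummerCocycle h c.2.1.1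
    obtain ⟨r, b, ε, hr, hb, hε, e⟩ := exists_squarefree_int_representative hd₀ hβ₀
    have hb0 : (b : ℚ) ≠ 0 := by exact_mod_cast hb.ne_zero
    have hne : (ε * b : ℚ) ≠ 0 := by
      rcases hε with rfl | rfl <;> simpa using hb.ne_zero
    have hsel := c.2
    rw [hc, ← kummerCocycle_mul h β₀ hr, kummerCocycle_mem_selmerCocycles_iff h hne e] at hsel
    have hpos := pos_of_torsorSoluble_real h (by exact_mod_cast hne) hsel.1
    obtain rfl : ε = 1 := by
      refine hε.resolve_right ?_
      rintro rfl
      have : (0 : ℝ) < b := by exact_mod_cast Nat.pos_of_ne_zero hb.ne_zero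
      push_cast at hpos
      linarith
    have hbs : b ∈ selmerIntegers p q D := ⟨hb, fun l hl => by simpa using hsel.2 l hl⟩
    refine ⟨⟨b, hbs⟩, Subtype.ext ?_⟩
    change kummerCocycle h (β b) = _
    rw [hc, ← kummerCocycle_mul h β₀ hr]
    have : (β b) ^ 2 = ((r : AlgebraicClosure ℚ) * β₀) ^ 2 := by rw [hβ, e]; simp
    rcases sq_eq_sq_iff_eq_or_eq_neg.1 this with h1 | h1
    · rw [h1]
    -- The other square root differs by the rational factor -1, which does not change the cocycle.
    · rw [h1, ← kummerCocycle_mul h ((r : AlgebraicClosure ℚ) * β₀) (r := -1) (by norm_num)]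
      simp
end SelmerCount

/-! ### Hensel's lemma, p-adic squares and primitive integral points -/

section PadicSquares

variable {l : ℕ} [hl : Fact l.Prime]

theorem PadicInt.exists_root_of_simple {F : Polynomial ℤ_[l]} {x : ℤ_[l]}
    (h0 : (l : ℤ_[l]) ∣ F.eval x) (h1 : IsUnit (F.derivative.eval x)) : ∃ z, F.eval z = 0 := by
  have h1' : ‖F.derivative.aeval x‖ = 1 := by
    rw [Polynomial.coe_aeval_eq_eval]; exact PadicInt.isUnit_iff.1 h1
  have h0' : ‖F.aeval x‖ < 1 := by
    rw [Polynomial.coe_aeval_eq_eval]; exact PadicInt.norm_lt_one_iff_dvd _ |>.2 h0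
  obtain ⟨z, hz, -⟩ := hensels_lemma (F := F) (a := x) (by rw [h1']; simpa using h0')
  exact ⟨z, by rwa [Polynomial.coe_aeval_eq_eval] at hz⟩

theorem PadicInt.toZMod_eq_zero_iff (x : ℤ_[l]) : PadicInt.toZMod x = 0 ↔ (l : ℤ_[l]) ∣ x := by
  rw [← RingHom.mem_ker, PadicInt.ker_toZMod, PadicInt.maximalIdeal_eq_span_p,
    Ideal.mem_span_singleton]

theorem PadicInt.isUnit_iff_toZMod_ne_zero (x : ℤ_[l]) : IsUnit x ↔ PadicInt.toZMod x ≠ 0 := by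
  rw [Ne, PadicInt.toZMod_eq_zero_iff, ← PadicInt.norm_lt_one_iff_dvd, PadicInt.isUnit_iff]
  have := PadicInt.norm_le_one x
  constructor
  · intro h; rw [h]; exact lt_irrefl _
  · intro h; exact le_antisymm this (not_lt.1 h)

theorem PadicInt.isSquare_of_isSquare_toZMod (hl2 : l ≠ 2) {u : ℤ_[l]}
    (h0 : PadicInt.toZMod u ≠ 0) (hs : IsSquare (PadicInt.toZMod u)) : IsSquare u := by
  obtain ⟨c, hc⟩ := hs
  obtain ⟨x, rfl⟩ := ZMod.ringHom_surjective (PadicInt.toZMod (p := l)) c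
  have hx : PadicInt.toZMod x ≠ 0 := by
    intro h; rw [h, mul_zero] at hc; exact h0 hc
  have h2 : (2 : ZMod l) ≠ 0 := by
    intro h
    have h' : ((2 : ℕ) : ZMod l) = 0 := by exact_mod_cast h
    rw [ZMod.natCast_eq_zero_iff] at h'
    exact hl2 ((Nat.prime_dvd_prime_iff_eq hl.out Nat.prime_two).1 h')
  obtain ⟨z, hz⟩ := PadicInt.exists_root_of_simple (F := Polynomial.X ^ 2 - Polynomial.C u) (x := x)
    (by
      rw [← PadicInt.toZMod_eq_zero_iff]
      simp [hc, sq])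
    (by
      rw [PadicInt.isUnit_iff_toZMod_ne_zero]
      have h2' : PadicInt.toZMod (2 : ℤ_[l]) ≠ 0 := by rwa [map_ofNat]
      simp [one_add_one_eq_two, h2', hx])
  refine ⟨z, ?_⟩
  simp only [Polynomial.eval_sub, Polynomial.eval_pow, Polynomial.eval_X, Polynomial.eval_C] at hz
  linear_combination -hz

theorem isSquare_padic_of_isSquare_zmod (hl2 : l ≠ 2) {k : ℤ} (h0 : (k : ZMod l) ≠ 0)
    (hs : IsSquare (k : ZMod l)) : IsSquare (k : ℚ_[l]) := by
  obtain ⟨c, hc⟩ := PadicInt.isSquare_of_isSquare_toZMod hl2 (u := (k : ℤ_[l]))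
    (by simpa using h0) (by simpa using hs)
  exact ⟨c, by exact_mod_cast congrArg ((↑) : ℤ_[l] → ℚ_[l]) hc⟩

/-- Since v(d) ≤ 1, the inequality v(d) + 2v(w) ≥ 0 leaves only v(w) ≥ 0. -/
theorem Padic.norm_le_one_of_int_mul_sq {d : ℤ} (hd : ¬ ((l : ℤ) ^ 2 ∣ d)) {w : ℚ_[l]}
    (h : ‖(d : ℚ_[l]) * w ^ 2‖ ≤ 1) : ‖w‖ ≤ 1 := by
  have hl1 : (1 : ℝ) < l := by exact_mod_cast hl.out.one_lt
  have h1 : ¬ ‖(d : ℚ_[l])‖ ≤ (l : ℝ) ^ (-(2 : ℕ) : ℤ) := by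
    rw [Padic.norm_int_le_pow_iff_dvd]
    exact_mod_cast hd
  have h2 : (l : ℝ) ^ (-1 : ℤ) ≤ ‖(d : ℚ_[l])‖ := by
    rw [Padic.norm_le_pow_iff_norm_lt_pow_add_one] at h1
    simpa using h1
  by_contra hw
  have h3 : (l : ℝ) ≤ ‖w‖ := by
    have := Padic.norm_le_pow_iff_norm_lt_pow_add_one w 0
    simp only [zpow_zero, zero_add, zpow_one] at this
    rw [this] at hw
    exact not_lt.1 hw
  rw [norm_mul, norm_pow] at h
  have h4 : (l : ℝ) ^ (-1 : ℤ) * l ^ 2 ≤ ‖(d : ℚ_[l])‖ * ‖w‖ ^ 2 := by gcongr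
  have h5 : (l : ℝ) ^ (-1 : ℤ) * l ^ 2 = l := by
    have : (l : ℝ) ≠ 0 := by positivity
    rw [zpow_neg_one]; field_simp
  linarith

/-- Homogenise with r = t/s and clear denominators. The points with s = 0 satisfy d w² = d² t⁴ and
correspond to the alternative that d is a square. -/
theorem torsorSoluble_iff_primitive {a b d : ℤ} (hd : ¬ ((l : ℤ) ^ 2 ∣ d)) :
    TorsorSoluble (a : ℚ_[l]) b d ↔ ∃ t s w : ℤ_[l], (IsUnit t ∨ IsUnit s) ∧
      (d : ℤ_[l]) * w ^ 2 = (d * t ^ 2 - a * s ^ 2) ^ 2 - 4 * b * s ^ 4 := by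
  have key : ∀ (t s : ℤ_[l]) (w : ℚ_[l]), (IsUnit t ∨ IsUnit s) →
      (d : ℚ_[l]) * w ^ 2 = (d * t ^ 2 - a * s ^ 2) ^ 2 - 4 * b * s ^ 4 →
      ∃ t s w : ℤ_[l], (IsUnit t ∨ IsUnit s) ∧
      (d : ℤ_[l]) * w ^ 2 = (d * t ^ 2 - a * s ^ 2) ^ 2 - 4 * b * s ^ 4 := by
    intro t s w hts e
    have hw : ‖w‖ ≤ 1 := by
      refine Padic.norm_le_one_of_int_mul_sq hd ?_
      rw [e]
      obtain ⟨z, hz⟩ : ∃ z : ℤ_[l], (z : ℚ_[l]) = (d * t ^ 2 - a * s ^ 2) ^ 2 - 4 * b * s ^ 4 :=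
        ⟨((d : ℤ_[l]) * t ^ 2 - (a : ℤ_[l]) * s ^ 2) ^ 2 - 4 * (b : ℤ_[l]) * s ^ 4, by push_cast; rfl⟩
      rw [← hz]
      exact PadicInt.norm_le_one z
    exact ⟨t, s, ⟨w, hw⟩, hts, PadicInt.ext (by push_cast; exact e)⟩
  constructor
  · rintro (⟨c, hc⟩ | ⟨r, s, e⟩)
    · exact key 1 0 c (Or.inl isUnit_one) (by rw [hc]; push_cast; ring)
    · by_cases hr : ‖r‖ ≤ 1
      · exact key ⟨r, hr⟩ 1 s (Or.inr isUnit_one) (by push_cast; linear_combination e)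
      · push Not at hr
        have hr0 : r ≠ 0 := by rintro rfl; norm_num at hr
        refine key 1 ⟨r⁻¹, by rw [norm_inv]; exact inv_le_one_of_one_le₀ hr.le⟩ (s / r ^ 2)
          (Or.inl isUnit_one) ?_
        push_cast
        field_simp
        linear_combination e
  · rintro ⟨t, s, w, hts, e⟩
    have e' : (d : ℚ_[l]) * w ^ 2 = (d * t ^ 2 - a * s ^ 2) ^ 2 - 4 * b * s ^ 4 := by
      exact_mod_cast congrArg ((↑) : ℤ_[l] → ℚ_[l]) e
    have hd0 : (d : ℚ_[l]) ≠ 0 := by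
      have : d ≠ 0 := by rintro rfl; exact hd (dvd_zero _)
      exact_mod_cast this
    by_cases hs : s = 0
    · subst hs
      have ht : (t : ℚ_[l]) ≠ 0 := by
        have := (hts.resolve_right (by simp)).ne_zero
        exact fun h => this (PadicInt.ext h)
      left
      refine ⟨w / t ^ 2, ?_⟩
      field_simp
      refine mul_left_cancel₀ hd0 ?_
      push_cast at e'
      linear_combination -e'
    · have hs' : (s : ℚ_[l]) ≠ 0 := fun h => hs (PadicInt.ext h)
      right
      refine ⟨t / s, w / s ^ 2, ?_⟩
      field_simp
      linear_combination e'

end PadicSquares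

/-! ### Solubility at the odd primes -/

section OddPlaces

variable {l : ℕ} [hl : Fact l.Prime]

theorem PadicInt.isUnit_iff_not_dvd (x : ℤ_[l]) : IsUnit x ↔ ¬ (l : ℤ_[l]) ∣ x := by
  rw [PadicInt.isUnit_iff_toZMod_ne_zero, Ne, PadicInt.toZMod_eq_zero_iff]

theorem PadicInt.dvd_intCast_iff (k : ℤ) : (l : ℤ_[l]) ∣ (k : ℤ_[l]) ↔ (l : ℤ) ∣ k := by
  rw [← PadicInt.toZMod_eq_zero_iff, map_intCast, ZMod.intCast_zmod_eq_zero_iff_dvd]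

theorem PadicInt.isSquare_zmod_of_mul_sq {k : ℤ} {w x : ℤ_[l]}
    (h : (l : ℤ_[l]) ∣ k * w ^ 2 - x ^ 2) (hx : ¬ (l : ℤ_[l]) ∣ x) : IsSquare (k : ZMod l) := by
  rw [← PadicInt.toZMod_eq_zero_iff] at h hx
  simp only [map_sub, map_mul, map_pow, map_intCast, sub_eq_zero] at h
  have hw : PadicInt.toZMod w ≠ 0 := by
    intro h0
    rw [h0] at h
    simp only [ne_eq, OfNat.ofNat_ne_zero, not_false_eq_true, zero_pow, mul_zero] at h
    exact hx (pow_eq_zero_iff two_ne_zero |>.1 h.symm)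
  refine ⟨PadicInt.toZMod x / PadicInt.toZMod w, ?_⟩
  field_simp
  exact h

variable {p q D d : ℤ}

theorem torsorSoluble_int_iff (hd : ¬ ((l : ℤ) ^ 2 ∣ d)) :
    TorsorSoluble ((p + q) * D : ℚ_[l]) (p * q * D ^ 2) d ↔
      ∃ t s w : ℤ_[l], (IsUnit t ∨ IsUnit s) ∧
      (d : ℤ_[l]) * w ^ 2 = (d * t ^ 2 - (p + q) * D * s ^ 2) ^ 2 - 4 * (p * q * D ^ 2) * s ^ 4 := by
  have := torsorSoluble_iff_primitive (a := (p + q) * D) (b := p * q * D ^ 2) hd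
  push_cast at this
  exact this

/-- Descent: modulo l the equation reads 0 ≡ ((q-p)D s²)², so l ∣ s and t is a unit; then l ∣ w, and
dividing by l² leaves l ∣ d₁² t⁴, where d = l d₁, a contradiction. -/
theorem not_torsorSoluble_of_dvd (hqp : ¬ (l : ℤ) ∣ q - p) (hD : ¬ (l : ℤ) ∣ D)
    (hd : (l : ℤ) ∣ d) (hd2 : ¬ ((l : ℤ) ^ 2 ∣ d)) :
    ¬ TorsorSoluble ((p + q) * D : ℚ_[l]) (p * q * D ^ 2) d := by
  rw [torsorSoluble_int_iff hd2]
  rintro ⟨t, s, w, hts, e⟩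
  have hπ : Prime (l : ℤ_[l]) := PadicInt.prime_p
  rw [← PadicInt.dvd_intCast_iff] at hqp hD
  obtain ⟨d₁, rfl⟩ := hd
  have hd₁ : ¬ (l : ℤ_[l]) ∣ d₁ := by
    rw [PadicInt.dvd_intCast_iff]
    rintro ⟨k, rfl⟩
    exact hd2 ⟨k, by ring⟩
  push_cast at e hqp
  have hs : (l : ℤ_[l]) ∣ s := by
    have h1 : (l : ℤ_[l]) ∣ ((q - p) * D * s ^ 2) ^ 2 :=
      ⟨d₁ * w ^ 2 - l * d₁ ^ 2 * t ^ 4 + 2 * d₁ * t ^ 2 * (p + q) * D * s ^ 2,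
        by linear_combination -e⟩
    have h2 := hπ.dvd_of_dvd_pow h1
    exact hπ.dvd_of_dvd_pow
      ((hπ.dvd_or_dvd h2).resolve_left fun h => (hπ.dvd_or_dvd h).elim hqp hD)
  have ht : ¬ (l : ℤ_[l]) ∣ t := by
    rw [PadicInt.isUnit_iff_not_dvd, PadicInt.isUnit_iff_not_dvd] at hts
    exact hts.resolve_right (not_not.2 hs)
  obtain ⟨s₁, rfl⟩ := hs
  have e1 : d₁ * w ^ 2 = l * (d₁ ^ 2 * t ^ 4 + l * (-2 * d₁ * t ^ 2 * (p + q) * D * s₁ ^ 2 +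
      l * ((q - p) * D * s₁ ^ 2) ^ 2)) :=
    mul_left_cancel₀ hπ.ne_zero (by linear_combination e)
  have hw : (l : ℤ_[l]) ∣ w :=
    hπ.dvd_of_dvd_pow ((hπ.dvd_or_dvd ⟨_, e1⟩).resolve_left hd₁)
  obtain ⟨w₁, rfl⟩ := hw
  have e2 : d₁ ^ 2 * t ^ 4 = l * (d₁ * w₁ ^ 2 + 2 * d₁ * t ^ 2 * (p + q) * D * s₁ ^ 2 -
      l * ((q - p) * D * s₁ ^ 2) ^ 2) :=
    mul_left_cancel₀ hπ.ne_zero (by linear_combination -e1)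
  exact (hπ.dvd_or_dvd ⟨_, e2⟩).elim (fun h => hd₁ (hπ.dvd_of_dvd_pow h))
    fun h => ht (hπ.dvd_of_dvd_pow h)

/-- If t is a unit, d w² ≡ (d t²)² mod l. Otherwise s is a unit, l² divides the whole equation, and
the quotient gives d w₁² ≡ ((q-p)D₁ s²)². -/
theorem isSquare_zmod_of_torsorSoluble_of_dvd_left (hqp : ¬ (l : ℤ) ∣ q - p) (hD : (l : ℤ) ∣ D)
    (hD2 : ¬ (l : ℤ) ^ 2 ∣ D) (hd : ¬ (l : ℤ) ∣ d)
    (H : TorsorSoluble ((p + q) * D : ℚ_[l]) (p * q * D ^ 2) d) : IsSquare (d : ZMod l) := by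
  rw [torsorSoluble_int_iff fun h => hd ((dvd_pow_self _ two_ne_zero).trans h)] at H
  obtain ⟨t, s, w, hts, e⟩ := H
  have hπ : Prime (l : ℤ_[l]) := PadicInt.prime_p
  obtain ⟨D₁, rfl⟩ := hD
  have hD₁ : ¬ (l : ℤ_[l]) ∣ D₁ := by
    rw [PadicInt.dvd_intCast_iff]
    rintro ⟨k, rfl⟩
    exact hD2 ⟨k, by ring⟩
  rw [← PadicInt.dvd_intCast_iff] at hqp hd
  push_cast at e hqp
  by_cases ht : (l : ℤ_[l]) ∣ t
  · have hs : ¬ (l : ℤ_[l]) ∣ s := by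
      rw [PadicInt.isUnit_iff_not_dvd, PadicInt.isUnit_iff_not_dvd] at hts
      exact hts.resolve_left (not_not.2 ht)
    obtain ⟨t₁, rfl⟩ := ht
    have hw : (l : ℤ_[l]) ∣ w := by
      have h1 : (l : ℤ_[l]) ∣ d * w ^ 2 :=
        ⟨l * ((d * l * t₁ ^ 2 - (p + q) * D₁ * s ^ 2) ^ 2 - 4 * (p * q * D₁ ^ 2) * s ^ 4),
          by linear_combination e⟩
      exact hπ.dvd_of_dvd_pow ((hπ.dvd_or_dvd h1).resolve_left hd)
    obtain ⟨w₁, rfl⟩ := hw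
    have e1 : d * w₁ ^ 2 = (d * l * t₁ ^ 2 - (p + q) * D₁ * s ^ 2) ^ 2
        - 4 * (p * q * D₁ ^ 2) * s ^ 4 :=
      mul_left_cancel₀ (pow_ne_zero 2 hπ.ne_zero) (by linear_combination e)
    refine PadicInt.isSquare_zmod_of_mul_sq (w := w₁) (x := (q - p) * D₁ * s ^ 2)
      ⟨d ^ 2 * l * t₁ ^ 4 - 2 * d * t₁ ^ 2 * (p + q) * D₁ * s ^ 2, by linear_combination e1⟩ ?_
    intro h
    rcases hπ.dvd_or_dvd h with h | h
    · exact (hπ.dvd_or_dvd h).elim hqp hD₁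
    · exact hs (hπ.dvd_of_dvd_pow h)
  · refine PadicInt.isSquare_zmod_of_mul_sq (w := w) (x := d * t ^ 2)
      ⟨-2 * d * t ^ 2 * (p + q) * D₁ * s ^ 2 + l * ((q - p) * D₁ * s ^ 2) ^ 2,
        by linear_combination e⟩ ?_
    exact fun h => (hπ.dvd_or_dvd h).elim hd fun h => ht (hπ.dvd_of_dvd_pow h)

/-- Modulo l the term 4b s⁴ disappears and d w² is the square of d t² - a s². If the latter vanished
mod l, then l² would divide 4b s⁴, forcing l ∣ s and then l ∣ t. -/
theorem isSquare_zmod_of_torsorSoluble_of_dvd_mul (hl2 : l ≠ 2) (hpq : (l : ℤ) ∣ p * q)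
    (hpq2 : ¬ (l : ℤ) ^ 2 ∣ p * q) (hD : ¬ (l : ℤ) ∣ D) (hd : ¬ (l : ℤ) ∣ d)
    (H : TorsorSoluble ((p + q) * D : ℚ_[l]) (p * q * D ^ 2) d) : IsSquare (d : ZMod l) := by
  rw [torsorSoluble_int_iff fun h => hd ((dvd_pow_self _ two_ne_zero).trans h)] at H
  obtain ⟨t, s, w, hts, e⟩ := H
  have hπ : Prime (l : ℤ_[l]) := PadicInt.prime_p
  obtain ⟨k, hk⟩ := hpq
  have hk' : ¬ (l : ℤ_[l]) ∣ k := by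
    rw [PadicInt.dvd_intCast_iff]
    rintro ⟨k, rfl⟩
    exact hpq2 ⟨k, by rw [hk]; ring⟩
  have h4 : ¬ (l : ℤ_[l]) ∣ ((4 : ℤ) : ℤ_[l]) := by
    rw [PadicInt.dvd_intCast_iff]
    intro h
    have h' : l ∣ 2 ^ 2 := by exact_mod_cast h
    exact hl2 ((Nat.prime_dvd_prime_iff_eq hl.out Nat.prime_two).1 (hl.out.dvd_of_dvd_pow h'))
  have hkc : (p : ℤ_[l]) * q = l * k := by exact_mod_cast congrArg (Int.cast : ℤ → ℤ_[l]) hk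
  rw [← PadicInt.dvd_intCast_iff] at hD hd
  push_cast at h4
  rw [hkc] at e
  by_cases hx : (l : ℤ_[l]) ∣ d * t ^ 2 - (p + q) * D * s ^ 2
  · exfalso
    obtain ⟨x, hx⟩ := hx
    rw [hx] at e
    have hw : (l : ℤ_[l]) ∣ w := by
      have h1 : (l : ℤ_[l]) ∣ d * w ^ 2 :=
        ⟨l * x ^ 2 - 4 * (k * D ^ 2) * s ^ 4, by linear_combination e⟩
      exact hπ.dvd_of_dvd_pow ((hπ.dvd_or_dvd h1).resolve_left hd)
    obtain ⟨w₁, rfl⟩ := hw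
    have e1 : 4 * k * D ^ 2 * s ^ 4 = l * (x ^ 2 - d * w₁ ^ 2) :=
      mul_left_cancel₀ hπ.ne_zero (by linear_combination e)
    have hs : (l : ℤ_[l]) ∣ s := by
      rcases hπ.dvd_or_dvd ⟨_, e1⟩ with h | h
      · rcases hπ.dvd_or_dvd h with h | h
        · exact ((hπ.dvd_or_dvd h).elim h4 hk').elim
        · exact (hD (hπ.dvd_of_dvd_pow h)).elim
      · exact hπ.dvd_of_dvd_pow h
    have ht : (l : ℤ_[l]) ∣ t := by
      obtain ⟨s₁, rfl⟩ := hs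
      have h1 : (l : ℤ_[l]) ∣ d * t ^ 2 :=
        ⟨x + (p + q) * D * l * s₁ ^ 2, by linear_combination hx⟩
      exact hπ.dvd_of_dvd_pow ((hπ.dvd_or_dvd h1).resolve_left hd)
    rw [PadicInt.isUnit_iff_not_dvd, PadicInt.isUnit_iff_not_dvd] at hts
    exact hts.elim (fun h => h ht) fun h => h hs
  · exact PadicInt.isSquare_zmod_of_mul_sq (w := w) (x := d * t ^ 2 - (p + q) * D * s ^ 2)
      ⟨-4 * (k * D ^ 2) * s ^ 4, by linear_combination e⟩ hx

theorem torsorSoluble_of_isSquare_zmod {a b : ℚ_[l]} (hl2 : l ≠ 2) (hd : ¬ (l : ℤ) ∣ d)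
    (H : IsSquare (d : ZMod l)) : TorsorSoluble a b (d : ℚ_[l]) :=
  Or.inl (isSquare_padic_of_isSquare_zmod hl2
    (by rwa [Ne, ZMod.intCast_zmod_eq_zero_iff_dvd]) H)

/-- After division by l² the reduction is (d₁t² - (p+q)D₁s²)² = 4pqD₁²s⁴. So pq = ρ² and d₁t² =
D₁s²(p + q + 2ρ); as p(p + q + 2ρ) = (p + ρ)², the second equation says that p d₁D₁ is a square.
Conversely both square roots lift. -/
theorem torsorSoluble_iff_of_dvd_of_dvd {D₁ d₁ : ℤ} (hl2 : l ≠ 2) (hqp : ¬ (l : ℤ) ∣ q - p)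
    (hp : ¬ (l : ℤ) ∣ p) (hq : ¬ (l : ℤ) ∣ q) (hD₁ : ¬ (l : ℤ) ∣ D₁) (hd₁ : ¬ (l : ℤ) ∣ d₁) :
    TorsorSoluble ((p + q) * (l * D₁ : ℤ) : ℚ_[l]) (p * q * (l * D₁ : ℤ) ^ 2) (l * d₁ : ℤ) ↔
      IsSquare ((p * q : ℤ) : ZMod l) ∧ IsSquare ((p * d₁ * D₁ : ℤ) : ZMod l) := by
  have hπ : Prime (l : ℤ_[l]) := PadicInt.prime_p
  have hl2' : (2 : ZMod l) ≠ 0 := by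
    intro h
    have h' : ((2 : ℕ) : ZMod l) = 0 := by exact_mod_cast h
    rw [ZMod.natCast_eq_zero_iff] at h'
    exact hl2 ((Nat.prime_dvd_prime_iff_eq hl.out Nat.prime_two).1 h')
  have hp' : (p : ZMod l) ≠ 0 := by rwa [Ne, ZMod.intCast_zmod_eq_zero_iff_dvd]
  have hq' : (q : ZMod l) ≠ 0 := by rwa [Ne, ZMod.intCast_zmod_eq_zero_iff_dvd]
  have hD₁' : (D₁ : ZMod l) ≠ 0 := by rwa [Ne, ZMod.intCast_zmod_eq_zero_iff_dvd]
  have hd₁' : (d₁ : ZMod l) ≠ 0 := by rwa [Ne, ZMod.intCast_zmod_eq_zero_iff_dvd]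
  have hqp' : (q - p : ZMod l) ≠ 0 := by
    have : ((q - p : ℤ) : ZMod l) ≠ 0 := by rwa [Ne, ZMod.intCast_zmod_eq_zero_iff_dvd]
    simpa using this
  constructor
  · have hd2 : ¬ ((l : ℤ) ^ 2 ∣ l * d₁) := by
      rw [sq]
      intro h
      exact hd₁ ((mul_dvd_mul_iff_left (by exact_mod_cast hl.out.ne_zero)).1 h)
    rw [torsorSoluble_int_iff hd2]
    rintro ⟨t, s, w, hts, e⟩
    push_cast at e
    have hw : (l : ℤ_[l]) ∣ w := by
      have h1 : (l : ℤ_[l]) * (d₁ * w ^ 2) =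
          l * (l * ((d₁ * t ^ 2 - (p + q) * D₁ * s ^ 2) ^ 2 - 4 * (p * q * D₁ ^ 2) * s ^ 4)) := by
        linear_combination e
      have h2 := mul_left_cancel₀ hπ.ne_zero h1
      refine hπ.dvd_of_dvd_pow ((hπ.dvd_or_dvd ⟨_, h2⟩).resolve_left ?_)
      rwa [PadicInt.dvd_intCast_iff]
    obtain ⟨w₁, rfl⟩ := hw
    have e1 : l * (d₁ * w₁ ^ 2) = (d₁ * t ^ 2 - (p + q) * D₁ * s ^ 2) ^ 2
        - 4 * (p * q * D₁ ^ 2) * s ^ 4 :=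
      mul_left_cancel₀ (pow_ne_zero 2 hπ.ne_zero) (by linear_combination e)
    have e2 := congrArg PadicInt.toZMod e1
    simp only [map_mul, map_sub, map_add, map_pow, map_intCast, map_natCast, CharP.cast_eq_zero,
      zero_mul, map_ofNat] at e2
    rw [PadicInt.isUnit_iff_toZMod_ne_zero, PadicInt.isUnit_iff_toZMod_ne_zero] at hts
    generalize PadicInt.toZMod t = t' at *
    generalize PadicInt.toZMod s = s' at *
    have hs : s' ≠ 0 := by
      rintro rfl
      have ht : t' ≠ 0 := hts.resolve_right (by simp)
      have : (d₁ * t' ^ 2 : ZMod l) ^ 2 = 0 := by linear_combination -e2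
      simp [hd₁', ht] at this
    obtain ⟨ρ, hρ⟩ : ∃ ρ : ZMod l, ρ = (d₁ * t' ^ 2 - (p + q) * D₁ * s' ^ 2) / (2 * D₁ * s' ^ 2) :=
      ⟨_, rfl⟩
    have hρ1 : d₁ * t' ^ 2 = D₁ * s' ^ 2 * (p + q + 2 * ρ) := by
      rw [hρ]; field_simp; ring
    have hρ2 : (p * q : ZMod l) = ρ ^ 2 := by
      rw [hρ]
      field_simp
      linear_combination e2
    -- Here (p + q + 2ρ)(p + q - 2ρ) = (q - p)² is nonzero, so neither factor can vanish.
    have ht : t' ≠ 0 := by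
      rintro rfl
      have h0 : (p + q + 2 * ρ : ZMod l) = 0 := by
        have : (D₁ * s' ^ 2 * (p + q + 2 * ρ) : ZMod l) = 0 := by rw [← hρ1]; ring
        simpa [hD₁', hs] using this
      have : (q - p : ZMod l) ^ 2 = 0 := by
        linear_combination (p + q - 2 * ρ) * h0 - 4 * hρ2
      exact hqp' (pow_eq_zero_iff two_ne_zero |>.1 this)
    refine ⟨⟨ρ, by push_cast; rw [hρ2, sq]⟩, D₁ * s' * (p + ρ) / t', ?_⟩
    push_cast
    field_simp
    linear_combination p * hρ1 + D₁ * s' ^ 2 * hρ2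
  · rintro ⟨h1, h2⟩
    obtain ⟨ρ, hρ⟩ := isSquare_padic_of_isSquare_zmod hl2 (by simp [hp', hq']) h1
    obtain ⟨κ, hκ⟩ := isSquare_padic_of_isSquare_zmod hl2 (by simp [hp', hD₁', hd₁']) h2
    push_cast at hρ hκ
    have hp0 : (p : ℚ_[l]) ≠ 0 := by
      have : p ≠ 0 := by rintro rfl; exact hp (dvd_zero _)
      exact_mod_cast this
    have hd0 : (d₁ : ℚ_[l]) ≠ 0 := by
      have : d₁ ≠ 0 := by rintro rfl; exact hd₁ (dvd_zero _)
      exact_mod_cast this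
    have hD0 : (D₁ : ℚ_[l]) ≠ 0 := by
      have : D₁ ≠ 0 := by rintro rfl; exact hD₁ (dvd_zero _)
      exact_mod_cast this
    right
    -- A ramification point: s = 0, and r is chosen so that d₁r² = D₁(p + q + 2ρ), using κ² = p
    -- d₁D₁.
    refine ⟨D₁ * (p + ρ) / κ, 0, ?_⟩
    have hd : (d₁ : ℚ_[l]) * (D₁ * (p + ρ) / κ) ^ 2 = D₁ * (p + q + 2 * ρ) := by
      rw [div_pow, sq κ, ← hκ]
      field_simp
      linear_combination -hρ
    push_cast
    linear_combination -l ^ 2 * (d₁ * (D₁ * (p + ρ) / κ) ^ 2 + D₁ * (p + q + 2 * ρ) -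
      2 * (p + q) * D₁) * hd + 4 * (l * D₁ : ℚ_[l]) ^ 2 * hρ

/-- A counting argument in place of the Hasse–Weil bound. Otherwise (dr² - a)² - c = w(r)² with w(r)
≠ 0 for all r, and the 2|F| elements (dr² - a) ∓ w(r), being factors of c, lie among |F| - 1 values.
Some value z is taken at least three times; but z determines r² through z + c/z, and then the sign
through c/z - z, so it is taken at most twice. -/
theorem FiniteField.exists_quartic_not_nonzero_square {F : Type*} [Field F] [Fintype F]
    (h2 : (2 : F) ≠ 0) {a c d : F} (hc : c ≠ 0) (hd : d ≠ 0) :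
    ∃ r : F, ¬ ∃ w, w ≠ 0 ∧ (d * r ^ 2 - a) ^ 2 - c = w ^ 2 := by
  by_contra hcon
  push Not at hcon
  choose w hw0 hw using hcon
  let sgn : Bool → F := fun ε => if ε then 1 else -1
  have hsgn : ∀ ε, sgn ε ^ 2 = 1 := by intro ε; cases ε <;> simp [sgn]
  let f : F × Bool → F := fun x => (d * x.1 ^ 2 - a) - sgn x.2 * w x.1
  have hf : ∀ x, f x * ((d * x.1 ^ 2 - a) + sgn x.2 * w x.1) = c := fun x => by
    simp only [f]
    linear_combination hw x.1 - (w x.1) ^ 2 * hsgn x.2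
  have hf0 : ∀ x, f x ≠ 0 := fun x h => hc (by rw [← hf x, h, zero_mul])
  obtain ⟨z, hz, hcard⟩ := Finset.exists_lt_card_fiber_of_mul_lt_card_of_maps_to
    (s := (Finset.univ : Finset (F × Bool))) (t := Finset.univ.erase (0 : F)) (f := f) (n := 2)
    (fun x _ => Finset.mem_erase.2 ⟨hf0 x, Finset.mem_univ _⟩) (by
      rw [Finset.card_erase_of_mem (Finset.mem_univ _), Finset.card_univ, Finset.card_univ,
        Fintype.card_prod, Fintype.card_bool]
      have := Fintype.card_pos (α := F)
      omega)
  have hz0 : z ≠ 0 := (Finset.mem_erase.1 hz).1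
  obtain ⟨x₀, hx₀⟩ := Finset.card_pos.1 (lt_of_le_of_lt (Nat.zero_le _) hcard)
  have hfz : ∀ x, f x = z → 2 * (d * x.1 ^ 2 - a) = z + c / z ∧ 2 * (sgn x.2 * w x.1) = c / z - z :=
    fun x hx => by
      have e := hf x
      rw [hx] at e
      have e1 : c / z = d * x.1 ^ 2 - a + sgn x.2 * w x.1 := by rw [← e]; field_simp
      rw [e1, ← hx]
      constructor <;> ring
  have hx₀' := hfz x₀ (Finset.mem_filter.1 hx₀).2
  have hle : (Finset.univ.filter fun x => f x = z).card ≤ ({x₀.1, -x₀.1} : Finset F).card := by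
    refine Finset.card_le_card_of_injOn Prod.fst (fun x hx => ?_) ?_
    · have h1 := hfz x (by simpa using hx)
      have h3 : x.1 ^ 2 = x₀.1 ^ 2 := by
        refine mul_left_cancel₀ (mul_ne_zero h2 hd) ?_
        linear_combination h1.1 - hx₀'.1
      simpa using sq_eq_sq_iff_eq_or_eq_neg.1 h3
    · rintro ⟨r, ε⟩ h1 ⟨r', ε'⟩ h2' (rfl : r = r')
      have e1 := (hfz _ (by simpa using h1)).2
      have e2 := (hfz _ (by simpa using h2')).2
      have h3 : sgn ε = sgn ε' := by
        refine mul_right_cancel₀ (mul_ne_zero h2 (hw0 r)) ?_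
        linear_combination e1 - e2
      have h11 : (1 : F) ≠ -1 := by
        intro h
        apply h2
        linear_combination h
      rcases ε with _ | _ <;> rcases ε' with _ | _
      · rfl
      · exact absurd h3.symm (by simpa [sgn] using h11)
      · exact absurd h3 (by simpa [sgn] using h11)
      · rfl
  have : ({x₀.1, -x₀.1} : Finset F).card ≤ 2 := Finset.card_le_two
  omega

/-- For d a nonsquare mod l, choose r where the quartic value v is not a nonzero square. If v is a
nonsquare, dv is a nonzero square and lifts. If v = 0, the ramification point lifts. -/
theorem torsorSoluble_of_good_place {p q D d : ℤ} (hl2 : l ≠ 2) (hqp : ¬ (l : ℤ) ∣ q - p)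
    (hp : ¬ (l : ℤ) ∣ p) (hq : ¬ (l : ℤ) ∣ q) (hD : ¬ (l : ℤ) ∣ D) (hd : ¬ (l : ℤ) ∣ d) :
    TorsorSoluble ((p + q) * D : ℚ_[l]) (p * q * D ^ 2) d := by
  by_cases hsq : IsSquare (d : ZMod l)
  · exact torsorSoluble_of_isSquare_zmod hl2 hd hsq
  have hl2' : (2 : ZMod l) ≠ 0 := by
    intro h
    have h' : ((2 : ℕ) : ZMod l) = 0 := by exact_mod_cast h
    rw [ZMod.natCast_eq_zero_iff] at h'
    exact hl2 ((Nat.prime_dvd_prime_iff_eq hl.out Nat.prime_two).1 h')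
  have hp' : (p : ZMod l) ≠ 0 := by rwa [Ne, ZMod.intCast_zmod_eq_zero_iff_dvd]
  have hq' : (q : ZMod l) ≠ 0 := by rwa [Ne, ZMod.intCast_zmod_eq_zero_iff_dvd]
  have hD' : (D : ZMod l) ≠ 0 := by rwa [Ne, ZMod.intCast_zmod_eq_zero_iff_dvd]
  have hd' : (d : ZMod l) ≠ 0 := by rwa [Ne, ZMod.intCast_zmod_eq_zero_iff_dvd]
  have hqp' : (q - p : ZMod l) ≠ 0 := by
    have : ((q - p : ℤ) : ZMod l) ≠ 0 := by rwa [Ne, ZMod.intCast_zmod_eq_zero_iff_dvd]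
    simpa using this
  have h4 : (4 : ZMod l) ≠ 0 := by
    have : (4 : ZMod l) = 2 * 2 := by norm_num
    rw [this]; exact mul_ne_zero hl2' hl2'
  obtain ⟨r, hr⟩ := FiniteField.exists_quartic_not_nonzero_square (F := ZMod l) hl2'
    (a := (p + q) * D) (c := 4 * (p * q * D ^ 2)) (d := d) (by simp [hp', hq', hD', h4]) hd'
  have hd0 : (d : ℚ_[l]) ≠ 0 := by
    have : d ≠ 0 := by rintro rfl; exact hd (dvd_zero _)
    exact_mod_cast this
  obtain ⟨r, rfl⟩ := ZMod.intCast_surjective r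
  obtain ⟨v, hv⟩ : ∃ v : ℤ, v = (d * r ^ 2 - (p + q) * D) ^ 2 - 4 * (p * q * D ^ 2) := ⟨_, rfl⟩
  have hv' : (v : ZMod l) = (d * r ^ 2 - (p + q) * D) ^ 2 - 4 * (p * q * D ^ 2) := by
    rw [hv]; push_cast; ring
  rw [← hv'] at hr
  by_cases hv0 : (v : ZMod l) = 0
  · have hρ0 : ((p * q : ℤ) : ZMod l) = ((d * r ^ 2 - (p + q) * D) / (2 * D)) ^ 2 := by
      push_cast
      field_simp
      linear_combination hv' - hv0
    obtain ⟨ρ, hρ⟩ := PadicInt.isSquare_of_isSquare_toZMod hl2 (u := ((p * q : ℤ) : ℤ_[l]))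
      (by rw [map_intCast]; simp [hp', hq'])
      (by rw [map_intCast, hρ0]; exact IsSquare.sq _)
    have hρ1 : ((d * r ^ 2 - (p + q) * D) / (2 * D) : ZMod l) = PadicInt.toZMod ρ ∨
        ((d * r ^ 2 - (p + q) * D) / (2 * D) : ZMod l) = -PadicInt.toZMod ρ := by
      apply sq_eq_sq_iff_eq_or_eq_neg.1
      rw [← hρ0, sq, ← map_mul, ← hρ, map_intCast]
    obtain ⟨ρ, hρ, hρ1⟩ : ∃ ρ : ℤ_[l], ((p * q : ℤ) : ℤ_[l]) = ρ * ρ ∧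
        ((d * r ^ 2 - (p + q) * D) / (2 * D) : ZMod l) = PadicInt.toZMod ρ := by
      rcases hρ1 with h | h
      · exact ⟨ρ, hρ, h⟩
      · exact ⟨-ρ, by rw [hρ]; ring, by rw [h, map_neg]⟩
    have hρ2 := congrArg (PadicInt.toZMod (p := l)) hρ
    rw [map_intCast, map_mul] at hρ2
    push_cast at hρ2
    have hdr : (d : ZMod l) * r ^ 2 = D * (p + q + 2 * PadicInt.toZMod ρ) := by
      rw [← hρ1]; field_simp; ring
    -- The product (p + q + 2ρ)(p + q - 2ρ) = (q - p)² is a unit, so r is a unit mod l and its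
    -- square can be lifted.
    have hne : (D * (p + q + 2 * PadicInt.toZMod ρ) : ZMod l) ≠ 0 := by
      intro h0
      have h1 : (p + q + 2 * PadicInt.toZMod ρ : ZMod l) = 0 := by simpa [hD'] using h0
      have : (q - p : ZMod l) ^ 2 = 0 := by
        linear_combination (p + q - 2 * PadicInt.toZMod ρ) * h1 - 4 * hρ2
      exact hqp' (pow_eq_zero_iff two_ne_zero |>.1 this)
    obtain ⟨κ, hκ⟩ := PadicInt.isSquare_of_isSquare_toZMod hl2
      (u := (d : ℤ_[l]) * (D * (p + q + 2 * ρ)))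
      (by simp only [map_mul, map_add, map_intCast, map_ofNat]; exact mul_ne_zero hd' hne)
      (by
        simp only [map_mul, map_add, map_intCast, map_ofNat]
        rw [← hdr]
        exact ⟨d * r, by ring⟩)
    have hκ' := congrArg ((↑) : ℤ_[l] → ℚ_[l]) hκ
    have hρ' := congrArg ((↑) : ℤ_[l] → ℚ_[l]) hρ
    have h2c : ((2 : ℤ_[l]) : ℚ_[l]) = 2 := by exact_mod_cast PadicInt.coe_natCast (p := l) 2
    push_cast at hκ' hρ'
    rw [h2c] at hκ'
    right
    refine ⟨κ / d, 0, ?_⟩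
    have : (d : ℚ_[l]) * (κ / d) ^ 2 = D * (p + q + 2 * ρ) := by
      field_simp
      linear_combination -hκ'
    rw [this]
    linear_combination 4 * (D : ℚ_[l]) ^ 2 * hρ'
  · have hvn : ¬ IsSquare (v : ZMod l) := by
      rintro ⟨w, hw⟩
      refine hr ⟨w, ?_, by rw [hw, sq]⟩
      rintro rfl
      exact hv0 (by rw [hw, mul_zero])
    have hdv : IsSquare ((d * v : ℤ) : ZMod l) := by
      have h1 : quadraticChar (ZMod l) (d * v) = 1 := by
        rw [map_mul, quadraticChar_neg_one_iff_not_isSquare.2 hsq,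
          quadraticChar_neg_one_iff_not_isSquare.2 hvn]
        norm_num
      push_cast
      exact (quadraticChar_one_iff_isSquare (mul_ne_zero hd' hv0)).1 h1
    obtain ⟨κ, hκ⟩ := isSquare_padic_of_isSquare_zmod hl2
      (by push_cast; exact mul_ne_zero hd' hv0) hdv
    push_cast at hκ
    have hv2 := congrArg (Int.cast : ℤ → ℚ_[l]) hv
    push_cast at hv2
    right
    refine ⟨r, κ / d, ?_⟩
    rw [← hv2]
    field_simp
    linear_combination -hκ

end OddPlaces

/-! ### 2-adic squares and the integral quartic at 2 -/

section TwoAdic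

/-- Reduction modulo `8` on the 2-adic integers. -/
noncomputable def red8 : ℤ_[2] →+* ZMod 8 := PadicInt.toZModPow 3

theorem red8_eq_zero_iff (x : ℤ_[2]) : red8 x = 0 ↔ 8 ∣ x := by
  have h := PadicInt.ker_toZModPow (p := 2) 3
  have : red8 x = 0 ↔ x ∈ RingHom.ker (PadicInt.toZModPow (p := 2) 3) := Iff.rfl
  rw [this, h, Ideal.mem_span_singleton]
  norm_num

theorem two_dvd_iff_red8 (x : ℤ_[2]) : 2 ∣ x ↔ 4 * red8 x = 0 := by
  have h1 : (4 : ZMod 8) * red8 x = red8 (4 * x) := by rw [map_mul, map_ofNat]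
  have h4 : (4 : ℤ_[2]) ≠ 0 := by norm_num
  rw [h1, red8_eq_zero_iff, show (8 : ℤ_[2]) = 4 * 2 by norm_num, mul_dvd_mul_iff_left h4]

theorem two_prime_padicInt : Prime (2 : ℤ_[2]) := by
  simpa using PadicInt.prime_p (p := 2)

/-- Put u = 1 + 8v and look for a root 1 + 4z: this is 2z² + z = v, whose derivative is odd, so
Hensel applies. -/
theorem isSquare_of_red8_eq_one {u : ℤ_[2]} (hu : red8 u = 1) : IsSquare u := by
  have h : red8 (u - 1) = 0 := by rw [map_sub, hu, map_one, sub_self]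
  obtain ⟨v, hv⟩ := (red8_eq_zero_iff _).1 h
  obtain ⟨z, hz⟩ := PadicInt.exists_root_of_simple (l := 2) (x := v)
    (F := 2 * Polynomial.X ^ 2 + Polynomial.X - Polynomial.C v)
    ⟨v ^ 2, by simp⟩ (by
      rw [PadicInt.isUnit_iff_not_dvd]
      rintro ⟨k, hk⟩
      have hk' : 2 * (2 * v) + 1 = 2 * k := by simpa [one_add_one_eq_two] using hk
      refine two_prime_padicInt.not_isUnit (isUnit_of_dvd_one ⟨k - 2 * v, ?_⟩)
      linear_combination hk')
  simp only [Polynomial.eval_sub, Polynomial.eval_add, Polynomial.eval_mul, Polynomial.eval_ofNat,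
    Polynomial.eval_pow, Polynomial.eval_X, Polynomial.eval_C] at hz
  exact ⟨1 + 4 * z, by linear_combination hv - 8 * hz⟩

theorem exists_four_mul_sq_add_mul_eq {c : ℤ_[2]} (hc : ¬ 2 ∣ c) (k : ℤ_[2]) :
    ∃ j, j * (c + 4 * j) = k := by
  have hcu : IsUnit c := by rw [PadicInt.isUnit_iff_not_dvd]; simpa using hc
  obtain ⟨c', hc'⟩ := hcu.exists_right_inv
  obtain ⟨z, hz⟩ := PadicInt.exists_root_of_simple (l := 2) (x := c' * k)
    (F := 4 * Polynomial.X ^ 2 + Polynomial.C c * Polynomial.X - Polynomial.C k)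
    ⟨2 * (c' * k) ^ 2, by
      simp only [Polynomial.eval_sub, Polynomial.eval_add, Polynomial.eval_mul,
        Polynomial.eval_ofNat, Polynomial.eval_pow, Polynomial.eval_X, Polynomial.eval_C]
      push_cast
      linear_combination k * hc'⟩ (by
      rw [PadicInt.isUnit_iff_not_dvd]
      rintro ⟨n, hn⟩
      have hn' : 4 * (2 * (c' * k)) + c = 2 * n := by simpa [one_add_one_eq_two] using hn
      exact hc ⟨n - 4 * (c' * k), by linear_combination hn'⟩)
  simp only [Polynomial.eval_sub, Polynomial.eval_add, Polynomial.eval_mul, Polynomial.eval_ofNat,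
    Polynomial.eval_pow, Polynomial.eval_X, Polynomial.eval_C] at hz
  exact ⟨z, by linear_combination hz⟩

/-- The odd residues modulo `8`. -/
def OddResidue (x : ZMod 8) : Prop := 4 * x = 4

instance : DecidablePred OddResidue := fun x => inferInstanceAs (Decidable (4 * x = 4))

theorem oddResidue_natCast {n : ℕ} (hn : n % 2 = 1) : OddResidue (n : ZMod 8) := by
  have : ((4 * n : ℕ) : ZMod 8) = (4 : ℕ) := by
    rw [ZMod.natCast_eq_natCast_iff, Nat.ModEq]; omega
  unfold OddResidue
  exact_mod_cast this

theorem red8_natCast (n : ℕ) : red8 (n : ℤ_[2]) = n := map_natCast _ _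

theorem four_mul_eq_zero_or_oddResidue : ∀ x : ZMod 8, 4 * x = 0 ∨ OddResidue x := by decide

theorem two_dvd_or_oddResidue (x : ℤ_[2]) : 2 ∣ x ∨ OddResidue (red8 x) := by
  rw [two_dvd_iff_red8]
  exact four_mul_eq_zero_or_oddResidue _

theorem not_two_dvd_of_oddResidue {x : ℤ_[2]} (hx : OddResidue (red8 x)) : ¬ 2 ∣ x := by
  rw [two_dvd_iff_red8, show 4 * red8 x = 4 from hx]
  decide

theorem oddResidue_sq : ∀ x : ZMod 8, OddResidue x → x ^ 2 = 1 := by decide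

theorem OddResidue.mul : ∀ x y : ZMod 8, OddResidue x → OddResidue y → OddResidue (x * y) := by
  decide

/-- Two odd 2-adic integers that agree modulo `8` differ by a square factor. -/
theorem exists_eq_mul_sq {d v : ℤ_[2]} (hd : OddResidue (red8 d)) (h : red8 v = red8 d) :
    ∃ w, d * w ^ 2 = v := by
  have hdu : IsUnit d := by
    rw [PadicInt.isUnit_iff_not_dvd]; simpa using not_two_dvd_of_oddResidue hd
  obtain ⟨d', hd'⟩ := hdu.exists_right_inv
  have h1 : red8 d * red8 d' = 1 := by rw [← map_mul, hd', map_one]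
  obtain ⟨w, hw⟩ := isSquare_of_red8_eq_one (u := v * d') (by rw [map_mul, h, h1])
  exact ⟨w, by rw [sq, ← hw]; linear_combination v * hd'⟩

variable {d α γ : ℕ}

/-- The integral form of solubility at `2`. -/
def TwoAdicSoluble (d α γ : ℕ) : Prop :=
  ∃ t w : ℤ_[2], (d : ℤ_[2]) * w ^ 2 = t ^ 4 - 2 * α * t ^ 2 + γ

theorem padicInt_two_natCast_int_mul_sq {d : ℕ} (hd : ¬ 4 ∣ d) {w : ℚ_[2]} {z : ℤ_[2]}
    (h : (d : ℚ_[2]) * w ^ 2 = z) : ∃ w' : ℤ_[2], (w' : ℚ_[2]) = w := by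
  refine ⟨⟨w, Padic.norm_le_one_of_int_mul_sq (d := d) ?_ ?_⟩, rfl⟩
  · norm_num; exact_mod_cast hd
  · push_cast
    rw [h]
    exact PadicInt.norm_le_one z

/-- As d divides the middle coefficient, s = dw removes a factor d². No denominators are needed in
t: for |r| > 1 the quartic is r⁴ times a number ≡ 1 mod 8, so d itself is a square. -/
theorem torsorSoluble_two_iff (hd : ¬ 4 ∣ d) {b : ℚ_[2]}
    (hb : 4 * b = (d : ℚ_[2]) ^ 2 * ((α : ℚ_[2]) ^ 2 - γ)) :
    TorsorSoluble ((d : ℚ_[2]) * α) b d ↔ IsSquare (d : ℚ_[2]) ∨ TwoAdicSoluble d α γ := by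
  have hd0 : (d : ℚ_[2]) ≠ 0 := by
    have : d ≠ 0 := by rintro rfl; exact hd (dvd_zero _)
    exact_mod_cast this
  have h2c : ((2 : ℤ_[2]) : ℚ_[2]) = 2 := by exact_mod_cast PadicInt.coe_natCast (p := 2) 2
  constructor
  · rintro (h | ⟨r, s, e⟩)
    · exact Or.inl h
    have e1 : (d : ℚ_[2]) * (s / d) ^ 2 = r ^ 4 - 2 * α * r ^ 2 + γ := by
      field_simp
      refine mul_left_cancel₀ hd0 ?_
      linear_combination e - hb
    by_cases hr : ‖r‖ ≤ 1
    · right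
      obtain ⟨t, rfl⟩ : ∃ t : ℤ_[2], (t : ℚ_[2]) = r := ⟨⟨r, hr⟩, rfl⟩
      obtain ⟨w, hw⟩ := padicInt_two_natCast_int_mul_sq hd
        (z := t ^ 4 - 2 * α * t ^ 2 + γ) (w := s / d) (by push_cast; rw [e1, h2c])
      refine ⟨t, w, PadicInt.ext ?_⟩
      push_cast
      rw [hw, e1, h2c]
    · left
      push Not at hr
      have hr0 : r ≠ 0 := by rintro rfl; norm_num at hr
      obtain ⟨t, ht⟩ : ∃ t : ℤ_[2], (t : ℚ_[2]) = r⁻¹ :=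
        ⟨⟨r⁻¹, by rw [norm_inv]; exact inv_le_one_of_one_le₀ hr.le⟩, rfl⟩
      have ht2 : (2 : ℤ_[2]) ∣ t := by
        have := PadicInt.norm_lt_one_iff_dvd (p := 2) t
        push_cast at this
        rw [← this, PadicInt.norm_def, ht, norm_inv]
        exact inv_lt_one_of_one_lt₀ hr
      obtain ⟨u, rfl⟩ := ht2
      obtain ⟨v, hv⟩ := isSquare_of_red8_eq_one
        (u := 1 - 2 * α * (2 * u) ^ 2 + γ * (2 * u) ^ 4) (by
          have : (1 - 2 * α * (2 * u) ^ 2 + γ * (2 * u) ^ 4 : ℤ_[2]) =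
            1 + 8 * (-α * u ^ 2 + 2 * γ * u ^ 4) := by ring
          rw [this, map_add, map_one, map_mul, map_ofNat, show (8 : ZMod 8) = 0 from rfl]
          ring)
      have hv' := congrArg ((↑) : ℤ_[2] → ℚ_[2]) hv
      have hv0 : (v : ℚ_[2]) ≠ 0 := by
        intro h0
        have h0' : v = 0 := PadicInt.ext h0
        rw [h0'] at hv
        refine two_prime_padicInt.not_isUnit (isUnit_of_dvd_one
          ⟨4 * α * u ^ 2 - 8 * γ * u ^ 4, ?_⟩)
        linear_combination hv
      push_cast at hv' ht
      rw [h2c] at ht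
      rw [h2c, ht] at hv'
      have e2 : (d : ℚ_[2]) * (s / d / r ^ 2) ^ 2 = v ^ 2 := by
        rw [sq (v : ℚ_[2]), ← hv', div_pow _ (r ^ 2), mul_div_assoc', e1]
        field_simp
      have hs0 : s / d / r ^ 2 ≠ 0 := by
        intro h0
        rw [h0] at e2
        exact hv0 (pow_eq_zero_iff two_ne_zero |>.1 (by rw [← e2]; ring))
      refine ⟨v / (s / d / r ^ 2), ?_⟩
      rw [div_mul_div_comm, eq_div_iff (mul_ne_zero hs0 hs0)]
      linear_combination e2
  · rintro (h | ⟨t, w, e⟩)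
    · exact Or.inl h
    right
    have e' := congrArg ((↑) : ℤ_[2] → ℚ_[2]) e
    push_cast at e'
    rw [h2c] at e'
    refine ⟨t, d * w, ?_⟩
    linear_combination (d : ℚ_[2]) ^ 2 * e' + hb

end TwoAdic

/-! ### Norms from quadratic extensions of ℚ₂ -/

section TwoAdicNorms

theorem PadicInt.dvd_or_dvd_of_pair (x y : ℤ_[2]) : x ∣ y ∨ y ∣ x := by
  rcases ValuationRing.dvd_total x y with h | h
  exacts [Or.inl h, Or.inr h]

/-- Divisibility in ℤ₂ is total, so a projective point can be scaled to have x = 1 or y = 1; w stays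
integral because 4 ∤ d. -/
theorem exists_norm_representation {d : ℕ} (hd : ¬ 4 ∣ d) {k : ℤ_[2]} {w x y : ℤ_[2]}
    (hxy : x ≠ 0 ∨ y ≠ 0) (h : d * w ^ 2 = x ^ 2 - k * y ^ 2) :
    ∃ w z : ℤ_[2], d * w ^ 2 = 1 - k * z ^ 2 ∨ d * w ^ 2 = z ^ 2 - k := by
  have h' := congrArg ((↑) : ℤ_[2] → ℚ_[2]) h
  push_cast at h'
  rcases PadicInt.dvd_or_dvd_of_pair x y with ⟨z, rfl⟩ | ⟨z, rfl⟩
  · have hx : (x : ℚ_[2]) ≠ 0 := by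
      intro h0
      have : x = 0 := PadicInt.ext h0
      subst this
      simp at hxy
    push_cast at h'
    have e : (d : ℚ_[2]) * (w / x) ^ 2 = (1 - k * z ^ 2 : ℤ_[2]) := by
      push_cast; field_simp; linear_combination h'
    obtain ⟨w', hw'⟩ := padicInt_two_natCast_int_mul_sq hd e
    exact ⟨w', z, Or.inl (PadicInt.ext (by rw [← e, ← hw']; push_cast; rfl))⟩
  · have hy : (y : ℚ_[2]) ≠ 0 := by
      intro h0
      have : y = 0 := PadicInt.ext h0
      subst this
      simp at hxy
    push_cast at h'
    have e : (d : ℚ_[2]) * (w / y) ^ 2 = (z ^ 2 - k : ℤ_[2]) := by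
      push_cast; field_simp; linear_combination h'
    obtain ⟨w', hw'⟩ := padicInt_two_natCast_int_mul_sq hd e
    exact ⟨w', z, Or.inr (PadicInt.ext (by rw [← e, ← hw']; push_cast; rfl))⟩

theorem residue_of_norm_three_mod_four : ∀ d w z k : ZMod 8, OddResidue d → (k = 3 ∨ k = 7) →
    (d * w ^ 2 = 1 - k * z ^ 2 ∨ d * w ^ 2 = z ^ 2 - k) → d = 1 ∨ d = 5 := by
  decide +kernel

/-- An odd `d` that is a norm from `ℚ₂(√k)`, `k ≡ 3 (mod 4)`, is `1` modulo `4`. -/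
theorem residue_of_odd_norm {d k : ℕ} (hd : OddResidue (d : ZMod 8))
    (hk : (k : ZMod 8) = 3 ∨ (k : ZMod 8) = 7) {w x y : ℤ_[2]} (hxy : x ≠ 0 ∨ y ≠ 0)
    (h : d * w ^ 2 = x ^ 2 - k * y ^ 2) : (d : ZMod 8) = 1 ∨ (d : ZMod 8) = 5 := by
  have hd4 : ¬ 4 ∣ d := by
    rintro ⟨n, rfl⟩
    unfold OddResidue at hd
    push_cast at hd
    rw [← mul_assoc, show (4 * 4 : ZMod 8) = 0 from rfl, zero_mul] at hd
    exact absurd hd (by decide)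
  obtain ⟨w, z, e⟩ := exists_norm_representation hd4 hxy h
  refine residue_of_norm_three_mod_four _ (red8 w) (red8 z) _ hd hk ?_
  refine e.imp (fun e => ?_) fun e => ?_
  · simpa [red8_natCast] using congrArg red8 e
  · simpa [red8_natCast] using congrArg red8 e

theorem residue_of_even_norm_aux : ∀ f w z k : ZMod 8, OddResidue f → OddResidue k →
    f * w ^ 2 = 2 * z ^ 2 - k → f + k = 0 ∨ f + k = 2 := by
  decide +kernel

/-- The odd parts of `2f` and `2k` when `2f` is a norm from `ℚ₂(√(2k))`. -/
theorem residue_of_even_norm {f k : ℕ} (hf : OddResidue (f : ZMod 8))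
    (hk : OddResidue (k : ZMod 8)) {w x y : ℤ_[2]} (hxy : x ≠ 0 ∨ y ≠ 0)
    (h : (2 * f : ℕ) * w ^ 2 = x ^ 2 - 2 * k * y ^ 2) :
    (f + k : ZMod 8) = 0 ∨ (f + k : ZMod 8) = 2 := by
  have hd4 : ¬ 4 ∣ 2 * f := by
    rintro ⟨n, hn⟩
    obtain rfl : f = 2 * n := by omega
    unfold OddResidue at hf
    push_cast at hf
    rw [← mul_assoc, show (4 * 2 : ZMod 8) = 0 from rfl, zero_mul] at hf
    exact absurd hf (by decide)
  have h2 : (2 : ℤ_[2]) ≠ 0 := two_prime_padicInt.ne_zero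
  obtain ⟨w, z, e | e⟩ := exists_norm_representation hd4 hxy h
  -- In the chart x = 1 the equation would make 1 even.
  · push_cast at e
    exact (two_prime_padicInt.not_isUnit (isUnit_of_dvd_one
      ⟨f * w ^ 2 + k * z ^ 2, by linear_combination -e⟩)).elim
  · push_cast at e
    obtain ⟨z, rfl⟩ : 2 ∣ z := two_prime_padicInt.dvd_of_dvd_pow (n := 2)
      ⟨f * w ^ 2 + k, by linear_combination -e⟩
    have e1 : f * w ^ 2 = 2 * z ^ 2 - k := mul_left_cancel₀ h2 (by linear_combination e)
    exact residue_of_even_norm_aux _ (red8 w) (red8 z) _ hf hk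
      (by simpa only [map_mul, map_sub, map_pow, map_ofNat, red8_natCast] using congrArg red8 e1)

end TwoAdicNorms

/-! ### The condition at 2 for odd d -/

section TwoAdicOdd

variable {d p e : ℕ}

theorem natCast_padicInt_ne_zero {n : ℕ} (hn : OddResidue (n : ZMod 8)) : (n : ℤ_[2]) ≠ 0 := by
  intro h
  have h' := congrArg red8 h
  rw [red8_natCast, map_zero] at h'
  rw [h'] at hn
  exact absurd hn (by decide)

/-- The quartic equals (t² - ge)² - pe(2t)² and also (t² + ge)² - (p+g)e(2t)². So d is a norm from
both ℚ₂(√(pe)) and ℚ₂(√((p+g)e)), and one radicand ≡ 3 mod 4 suffices. -/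
theorem residue_of_twoAdicSoluble_odd {g : ℕ} (hg : g ≠ 0) (hd : OddResidue (d : ZMod 8))
    (he : OddResidue (e : ZMod 8)) (H : TwoAdicSoluble d ((p + (p + g)) * e) ((g * e) ^ 2))
    (hk : (p * e : ZMod 8) = 3 ∨ (p * e : ZMod 8) = 7 ∨
      ((p + g) * e : ZMod 8) = 3 ∨ ((p + g) * e : ZMod 8) = 7) :
    (d : ZMod 8) = 1 ∨ (d : ZMod 8) = 5 := by
  obtain ⟨t, w, h⟩ := H
  have h0 : ((g : ℤ_[2]) * e) ≠ 0 :=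
    mul_ne_zero (by exact_mod_cast hg) (natCast_padicInt_ne_zero he)
  have h2 : (2 : ℤ_[2]) ≠ 0 := two_prime_padicInt.ne_zero
  push_cast at h
  by_cases hk1 : (p * e : ZMod 8) = 3 ∨ (p * e : ZMod 8) = 7
  · refine residue_of_odd_norm (k := p * e) hd (by push_cast; exact hk1)
      (w := w) (x := t ^ 2 - g * e) (y := 2 * t) ?_ (by push_cast; linear_combination h)
    by_contra hcon
    push Not at hcon
    have ht : t = 0 := (mul_eq_zero.1 hcon.2).resolve_left h2
    apply h0
    rw [ht] at hcon
    linear_combination -hcon.1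
  · refine residue_of_odd_norm (k := (p + g) * e) hd (by push_cast; tauto)
      (w := w) (x := t ^ 2 + g * e) (y := 2 * t) ?_ (by push_cast; linear_combination h)
    by_contra hcon
    push Not at hcon
    have ht : t = 0 := (mul_eq_zero.1 hcon.2).resolve_left h2
    apply h0
    rw [ht] at hcon
    linear_combination hcon.1

theorem residue_sq_of_odd_aux : ∀ t : ZMod 8, OddResidue t → t ^ 2 = 1 ∧ t ^ 4 = 1 := by decide +kernel

theorem residue_of_sq_mul_eq_five : ∀ d w : ZMod 8, OddResidue d → d * w ^ 2 = 5 → d = 5 := by decide +kernel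

theorem residue_four_case : ∀ d w u c : ZMod 8, OddResidue d → OddResidue c →
    d * w ^ 2 = u ^ 4 - c * u ^ 2 + 1 → d = 1 ∨ d = 5 ∨ d * c = 5 := by decide +kernel

/-- For t odd the quartic is ≡ 5 mod 8. For t = 2u a factor 16 comes out, leaving u⁴ - (p+2)e u² +
e² to be examined mod 8. -/
theorem residue_of_twoAdicSoluble_four (hd : OddResidue (d : ZMod 8)) (hp : OddResidue (p : ZMod 8))
    (he : OddResidue (e : ZMod 8)) (H : TwoAdicSoluble d ((p + (p + 4)) * e) ((4 * e) ^ 2)) :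
    (d : ZMod 8) = 1 ∨ (d : ZMod 8) = 5 ∨ (d * ((p + 2) * e) : ZMod 8) = 5 := by
  obtain ⟨t, w, h⟩ := H
  push_cast at h
  have hd' : ¬ 2 ∣ (d : ℤ_[2]) := not_two_dvd_of_oddResidue (by rwa [red8_natCast])
  have h2 : (2 : ℤ_[2]) ≠ 0 := two_prime_padicInt.ne_zero
  have hdw : ∀ w : ℤ_[2], 2 ∣ (d : ℤ_[2]) * w ^ 2 → 2 ∣ w := fun w h =>
    two_prime_padicInt.dvd_of_dvd_pow ((two_prime_padicInt.dvd_or_dvd h).resolve_left hd')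
  have hodd : ∀ P : ZMod 8, OddResidue P → OddResidue (P + 2) := by decide +kernel
  have hc := (hodd _ hp).mul _ _ he
  rcases two_dvd_or_oddResidue t with ⟨u, rfl⟩ | ht
  · obtain ⟨w, rfl⟩ := hdw w ⟨8 * (u ^ 4 - (p + 2) * e * u ^ 2 + e ^ 2), by linear_combination h⟩
    have h1 : (d : ℤ_[2]) * w ^ 2 = 4 * (u ^ 4 - (p + 2) * e * u ^ 2 + e ^ 2) :=
      mul_left_cancel₀ (pow_ne_zero 2 h2) (by linear_combination h)
    obtain ⟨w, rfl⟩ := hdw w ⟨2 * (u ^ 4 - (p + 2) * e * u ^ 2 + e ^ 2), by linear_combination h1⟩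
    have h3 : (d : ℤ_[2]) * w ^ 2 = u ^ 4 - (p + 2) * e * u ^ 2 + e ^ 2 :=
      mul_left_cancel₀ (pow_ne_zero 2 h2) (by linear_combination h1)
    refine residue_four_case _ (red8 w) (red8 u) _ hd hc ?_
    rw [← oddResidue_sq _ he]
    simpa only [map_mul, map_sub, map_add, map_pow, map_ofNat, red8_natCast] using congrArg red8 h3
  · right; left
    have h1 := congrArg red8 h
    simp only [map_mul, map_add, map_sub, map_pow, map_ofNat, red8_natCast,
      (residue_sq_of_odd_aux _ ht).1, (residue_sq_of_odd_aux _ ht).2] at h1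
    refine residue_of_sq_mul_eq_five _ (red8 w) hd ?_
    rw [h1]
    have hc4 : 4 * (((p : ZMod 8) + 2) * e) = 4 := hc
    have h4 : (4 : ZMod 8) ^ 2 = 0 := rfl
    have h8 : (8 : ZMod 8) = 0 := rfl
    linear_combination -hc4 + (e : ZMod 8) ^ 2 * h4 - h8

theorem residue_five_aux : ∀ P G E : ZMod 8, OddResidue P → OddResidue E → (G = 2 ∨ 2 * G = 0) →
    1 - 2 * ((P + (P + G)) * E) + (G * E) ^ 2 = 5 := by decide +kernel

/-- The point t = 1: the hypothesis on g makes the quartic there ≡ 5 mod 8. -/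
theorem twoAdicSoluble_five {g : ℕ} (hd : (d : ZMod 8) = 5) (hp : OddResidue (p : ZMod 8))
    (he : OddResidue (e : ZMod 8)) (hg : (g : ZMod 8) = 2 ∨ 2 * (g : ZMod 8) = 0) :
    TwoAdicSoluble d ((p + (p + g)) * e) ((g * e) ^ 2) := by
  obtain ⟨w, hw⟩ := exists_eq_mul_sq (d := (d : ℤ_[2]))
    (v := 1 - 2 * ((p + (p + g)) * e) + (g * e) ^ 2)
    (by rw [red8_natCast, hd]; decide)
    (by
      simp only [map_mul, map_add, map_sub, map_pow, map_one, map_ofNat, red8_natCast, hd]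
      exact residue_five_aux _ _ _ hp he hg)
  exact ⟨1, w, by rw [hw]; push_cast; ring⟩

/-- The point t = 2, where the quartic is 16(1 - (p+2)e + e²) and e² ≡ 1 mod 8. -/
theorem twoAdicSoluble_four (hd : OddResidue (d : ZMod 8))
    (he : OddResidue (e : ZMod 8)) (h : 2 - ((p + 2) * e : ZMod 8) = d) :
    TwoAdicSoluble d ((p + (p + 4)) * e) ((4 * e) ^ 2) := by
  obtain ⟨w, hw⟩ := exists_eq_mul_sq (d := (d : ℤ_[2]))
    (v := 1 - (p + 2) * e + e ^ 2) (by rwa [red8_natCast])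
    (by
      simp only [map_mul, map_add, map_sub, map_pow, map_one, map_ofNat, red8_natCast,
        oddResidue_sq _ he]
      rw [← h]; ring)
  exact ⟨2, 4 * w, by push_cast; linear_combination 16 * hw⟩

/-- Set u² = c + 4j, so that u⁴ - cu² = 4j(c + 4j), and solve j(c + 4j) = k by Hensel. Then j ≡ k
mod 2, and the two alternatives are exactly what makes c + 4j ≡ 1 mod 8, hence a square. -/
theorem exists_of_target {c k : ℤ_[2]} (hc : red8 c = 1 ∧ 2 ∣ k ∨ red8 c = 5 ∧ ¬ 2 ∣ k) :
    ∃ u : ℤ_[2], u ^ 4 - c * u ^ 2 = 4 * k := by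
  have hc2 : ¬ 2 ∣ c := by
    apply not_two_dvd_of_oddResidue
    rcases hc with h | h <;> rw [h.1] <;> decide
  obtain ⟨j, hj⟩ := exists_four_mul_sq_add_mul_eq hc2 k
  have hsq : red8 (c + 4 * j) = 1 := by
    rw [map_add, map_mul, map_ofNat]
    rcases hc with ⟨h1, h2⟩ | ⟨h1, h2⟩
    · rw [← hj] at h2
      have hj2 : 2 ∣ j := by
        refine (two_prime_padicInt.dvd_or_dvd h2).resolve_right fun h => hc2 ?_
        exact (dvd_add_left (Dvd.intro (2 * j) (by ring))).1 h
      rw [(two_dvd_iff_red8 j).1 hj2, h1, add_zero]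
    · have hj2 : OddResidue (red8 j) :=
        (two_dvd_or_oddResidue j).resolve_left fun h => h2 (hj ▸ h.mul_right _)
      rw [show 4 * red8 j = 4 from hj2, h1]
      rfl
  obtain ⟨u, hu⟩ := isSquare_of_red8_eq_one hsq
  refine ⟨u, ?_⟩
  linear_combination (-u ^ 2 + c - (c + 4 * j)) * hu + 4 * hj

/-- Here every odd d is allowed. With t = 2u and w = 8v the equation becomes u⁴ - cu² = 4(dv² - 4^k
e²), c = (p + 4·2^k)e; v is 1 or 2 according to the parity required by `exists_of_target`. -/
theorem twoAdicSoluble_eight_two_pow (k : ℕ) (hd : OddResidue (d : ZMod 8))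
    (he : OddResidue (e : ZMod 8)) (h : (p * e : ZMod 8) = 1 ∨ (p * e : ZMod 8) = 5) :
    TwoAdicSoluble d ((p + (p + 2 ^ (k + 3))) * e) ((2 ^ (k + 3) * e) ^ 2) := by
  have hd2 : ¬ 2 ∣ (d : ℤ_[2]) := not_two_dvd_of_oddResidue (by rwa [red8_natCast])
  have he2 : ¬ 2 ∣ (e : ℤ_[2]) := not_two_dvd_of_oddResidue (by rwa [red8_natCast])
  have hee : ¬ 2 ∣ (e : ℤ_[2]) ^ 2 := fun h => he2 (two_prime_padicInt.dvd_of_dvd_pow h)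
  have he4 : 4 * (e : ZMod 8) = 4 := he
  -- `T = d` or `T = 4d`, whichever has the right parity
  suffices key : ∃ T v : ℤ_[2], d * v ^ 2 = T ∧
      (red8 ((p + 4 * 2 ^ k) * e) = 1 ∧ 2 ∣ T - 4 ^ k * (e : ℤ_[2]) ^ 2 ∨
        red8 ((p + 4 * 2 ^ k) * e) = 5 ∧ ¬ 2 ∣ T - 4 ^ k * (e : ℤ_[2]) ^ 2) by
    obtain ⟨T, v, hT, hc⟩ := key
    obtain ⟨u, hu⟩ := exists_of_target hc
    refine ⟨2 * u, 8 * v, ?_⟩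
    have h4 : (4 : ℤ_[2]) ^ k = (2 ^ k) ^ 2 := by rw [← pow_mul, mul_comm, pow_mul]; norm_num
    rw [h4] at hu
    push_cast
    rw [pow_add]
    linear_combination 64 * hT - 16 * hu
  have h4T : (2 : ℤ_[2]) ∣ d * 2 ^ 2 := ⟨d * 2, by ring⟩
  rcases Nat.eq_zero_or_pos k with rfl | hk
  · have hr : red8 ((p + 4 * 2 ^ 0) * e) = p * e + 4 := by
      simp only [map_mul, map_add, map_pow, map_ofNat, red8_natCast]
      linear_combination he4
    rw [hr]
    rcases h with h | h
    · refine ⟨_, 2, rfl, Or.inr ⟨by rw [h]; rfl, fun h' => hee ?_⟩⟩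
      simpa using (dvd_sub_right h4T).1 h'
    · refine ⟨_, 1, rfl, Or.inl ⟨by rw [h]; rfl, ?_⟩⟩
      rw [two_dvd_iff_red8]
      simp only [map_mul, map_sub, map_pow, map_ofNat, map_one, red8_natCast, oddResidue_sq _ he]
      have hd4 : 4 * (d : ZMod 8) = 4 := hd
      linear_combination hd4
  · obtain ⟨k, rfl⟩ := Nat.exists_eq_add_of_le' hk
    have hr : red8 ((p + 4 * 2 ^ (k + 1)) * e) = p * e := by
      simp only [map_mul, map_add, map_pow, map_ofNat, red8_natCast, pow_succ]
      have h8 : (8 : ZMod 8) = 0 := rfl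
      linear_combination (2 ^ k * e : ZMod 8) * h8
    have h4e : (2 : ℤ_[2]) ∣ 4 ^ (k + 1) * (e : ℤ_[2]) ^ 2 := ⟨2 * 4 ^ k * e ^ 2, by ring⟩
    rw [hr]
    rcases h with h | h
    · exact ⟨_, 2, rfl, Or.inl ⟨h, dvd_sub h4T h4e⟩⟩
    · refine ⟨_, 1, rfl, Or.inr ⟨h, fun h' => hd2 ?_⟩⟩
      simpa using (dvd_sub_left h4e).1 h'

theorem natCast_eq_one_of_isSquare (hd : OddResidue (d : ZMod 8)) (h : IsSquare (d : ℚ_[2])) :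
    (d : ZMod 8) = 1 := by
  obtain ⟨c, hc⟩ := h
  obtain ⟨z, hz⟩ := padicInt_two_natCast_int_mul_sq (d := 1) (w := c) (z := d) (by norm_num)
    (by push_cast; rw [hc]; ring)
  have e1 : (d : ℤ_[2]) = z ^ 2 := PadicInt.ext (by push_cast; rw [hz, hc, sq])
  have e2 := congrArg red8 e1
  rw [red8_natCast, map_pow] at e2
  rw [e2] at hd ⊢
  exact (by decide : ∀ x : ZMod 8, OddResidue (x ^ 2) → x ^ 2 = 1) _ hd

theorem modEq_eight_iff (n k : ℕ) : n ≡ k [MOD 8] ↔ (n : ZMod 8) = (k : ℕ) :=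
  (ZMod.natCast_eq_natCast_iff n k 8).symm

theorem modEq_four_one_iff (n : ℕ) : n ≡ 1 [MOD 4] ↔ (n : ZMod 8) = 1 ∨ (n : ZMod 8) = 5 := by
  have h1 := modEq_eight_iff n 1
  have h5 := modEq_eight_iff n 5
  push_cast at h1 h5
  rw [← h1, ← h5]
  simp only [Nat.ModEq]
  omega

theorem modEq_four_three_iff (n : ℕ) : n ≡ 3 [MOD 4] ↔ (n : ZMod 8) = 3 ∨ (n : ZMod 8) = 7 := by
  have h1 := modEq_eight_iff n 3
  have h5 := modEq_eight_iff n 7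
  push_cast at h1 h5
  rw [← h1, ← h5]
  simp only [Nat.ModEq]
  omega

theorem usesGraphOne_iff (m p D : ℕ) : UsesGraphOne m p D ↔
    m = 1 ∨ (m = 2 ∧ ¬ ((p + 2) * D : ZMod 8) = 5) ∨
      (3 ≤ m ∧ ((p * D : ZMod 8) = 1 ∨ (p * D : ZMod 8) = 5)) := by
  rw [UsesGraphOne, modEq_four_one_iff, modEq_eight_iff]
  push_cast
  rfl

/-- The two products differ by 2 mod 4, so one of them is ≡ 3 mod 4: for m = 1 the norm obstruction
is always present. -/
theorem residue_m_one : ∀ P E : ZMod 8, OddResidue P → OddResidue E →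
    P * E = 3 ∨ P * E = 7 ∨ (P + 2) * E = 3 ∨ (P + 2) * E = 7 := by decide +kernel

set_option synthInstance.maxSize 1024 in
theorem residue_quotient : ∀ P E F : ZMod 8, OddResidue P → OddResidue E → OddResidue F →
    (P * (F * E) = 1 ∨ P * (F * E) = 5) → F = 1 ∨ F = 5 ∨ P * E = 3 ∨ P * E = 7 := by decide +kernel

theorem residue_quotient' : ∀ P E F : ZMod 8, OddResidue P → OddResidue E → OddResidue F →
    ¬ (P * (F * E) = 1 ∨ P * (F * E) = 5) → (F = 1 ∨ F = 5) ∨ P * E = 1 ∨ P * E = 5 := by decide +kernel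

theorem residue_four_quotient : ∀ P E F : ZMod 8, OddResidue P → OddResidue E → OddResidue F →
    (P + 2) * (F * E) = 5 → (F = 1 ∨ F = 5) ∨ 2 - (P + 2) * E = F := by decide +kernel

theorem twoAdicSoluble_of_torsorSoluble_odd {q : ℕ} {m : ℕ} (hq : q = p + 2 ^ m)
    (hd : d % 2 = 1) :
    TorsorSoluble ((p + q) * (d * e : ℕ) : ℚ_[2]) (p * q * (d * e : ℕ) ^ 2) d ↔
      IsSquare (d : ℚ_[2]) ∨ TwoAdicSoluble d ((p + (p + 2 ^ m)) * e) ((2 ^ m * e) ^ 2) := by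
  rw [← torsorSoluble_two_iff (by omega) (b := p * q * (d * e : ℕ) ^ 2) (by
    rw [hq]; push_cast; ring)]
  rw [hq]
  push_cast
  rw [← mul_assoc, mul_comm ((p : ℚ_[2]) + (p + 2 ^ m)) d, mul_assoc]

/-- The local results involve e = D/d. The residue tables translate them into D: for instance pD ≡ 1
mod 4 forces d ≡ 1 or pe ≡ 3 mod 4, and pD ≡ 3 mod 4 forces d ≡ 1 or pe ≡ 1 mod 4. -/
theorem torsorSoluble_two_odd_iff {m q : ℕ} (hm : 1 ≤ m) (hp : p % 2 = 1) (hq : q = p + 2 ^ m)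
    (hd : d % 2 = 1) (he : e % 2 = 1) :
    TorsorSoluble ((p + q) * (d * e : ℕ) : ℚ_[2]) (p * q * (d * e : ℕ) ^ 2) d ↔
      (UsesGraphOne m p (d * e) → d ≡ 1 [MOD 4]) := by
  rw [twoAdicSoluble_of_torsorSoluble_odd hq hd, usesGraphOne_iff, modEq_four_one_iff]
  push_cast
  replace hp := oddResidue_natCast hp
  replace hd := oddResidue_natCast hd
  replace he := oddResidue_natCast he
  constructor
  · rintro (H | H) hU
    · exact Or.inl (natCast_eq_one_of_isSquare hd H)
    · rcases hU with rfl | ⟨rfl, hU⟩ | ⟨hm3, hU⟩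
      · refine residue_of_twoAdicSoluble_odd (g := 2 ^ 1) (by norm_num) hd he H ?_
        simpa using residue_m_one _ _ hp he
      · rcases residue_of_twoAdicSoluble_four hd hp he H with h | h | h
        · exact Or.inl h
        · exact Or.inr h
        · exact absurd (by rw [← h]; ring) hU
      · rcases residue_quotient _ _ _ hp he hd hU with h | h | h
        · exact Or.inl h
        · exact Or.inr h
        · exact residue_of_twoAdicSoluble_odd (g := 2 ^ m) (by positivity) hd he H (by tauto)
  · intro H
    by_cases h1 : (d : ZMod 8) = 1
    · left
      obtain ⟨c, hc⟩ := isSquare_of_red8_eq_one (u := (d : ℤ_[2])) (by rwa [red8_natCast])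
      exact ⟨c, by exact_mod_cast congrArg ((↑) : ℤ_[2] → ℚ_[2]) hc⟩
    right
    by_cases h5 : (d : ZMod 8) = 5
    · refine twoAdicSoluble_five h5 hp he ?_
      rcases Nat.lt_or_ge 1 m with hm2 | hm2
      · right
        obtain ⟨k, rfl⟩ := Nat.exists_eq_add_of_le' hm2
        push_cast
        have h8 : (8 : ZMod 8) = 0 := rfl
        linear_combination (2 : ZMod 8) ^ k * h8
      · left
        obtain rfl : m = 1 := by omega
        rfl
    have hd15 : ¬ ((d : ZMod 8) = 1 ∨ (d : ZMod 8) = 5) := by tauto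
    have hU := mt H hd15
    push Not at hU
    obtain ⟨hU1, hU2, hU3⟩ := hU
    rcases Nat.lt_or_ge m 3 with hm3 | hm3
    · obtain rfl : m = 2 := by omega
      exact twoAdicSoluble_four hd he
        ((residue_four_quotient _ _ _ hp he hd (hU2 rfl)).resolve_left hd15)
    · obtain ⟨k, rfl⟩ := Nat.exists_eq_add_of_le' hm3
      refine twoAdicSoluble_eight_two_pow k hd he
        ((residue_quotient' _ _ _ hp he hd ?_).resolve_left hd15)
      have := hU3 (by omega)
      tauto

end TwoAdicOdd

/-! ### The condition at 2 for d = 2f -/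

section TwoAdicEven

variable {f p e : ℕ}

theorem onlyEven_iff (m p D : ℕ) : OnlyEven m p D ↔
    (m = 1 ∧ (p * D : ZMod 8) = 5 ∧ ((D : ZMod 8) = 3 ∨ (D : ZMod 8) = 7)) ∨
    (m = 1 ∧ (p * D : ZMod 8) = 1 ∧ ((D : ZMod 8) = 1 ∨ (D : ZMod 8) = 5)) ∨
    m = 2 ∨ (p * D : ZMod 8) = 3 ∨
    (m = 3 ∧ ((p * D : ZMod 8) = 1 ∨ (p * D : ZMod 8) = 5)) ∨
    (m = 4 ∧ (p * D : ZMod 8) = 7) := by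
  simp only [OnlyEven, modEq_four_one_iff, modEq_four_three_iff, modEq_eight_iff]
  push_cast
  rfl

theorem twoNegOnePos_iff (m p D : ℕ) : TwoNegOnePos m p D ↔
    (m = 1 ∧ (p * D : ZMod 8) = 7 ∧ ((D : ZMod 8) = 1 ∨ (D : ZMod 8) = 5)) ∨
    (m = 1 ∧ (p * D : ZMod 8) = 1 ∧ ((D : ZMod 8) = 3 ∨ (D : ZMod 8) = 7)) ∨
    (4 ≤ m ∧ (p * D : ZMod 8) = 1) := by
  simp only [TwoNegOnePos, modEq_four_one_iff, modEq_four_three_iff, modEq_eight_iff]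
  push_cast
  rfl

theorem twoNegOneNeg_iff (m p D : ℕ) : TwoNegOneNeg m p D ↔
    (m = 1 ∧ (p * D : ZMod 8) = 5 ∧ ((D : ZMod 8) = 1 ∨ (D : ZMod 8) = 5)) ∨
    (m = 1 ∧ (p * D : ZMod 8) = 7 ∧ ((D : ZMod 8) = 3 ∨ (D : ZMod 8) = 7)) ∨
    (4 ≤ m ∧ (p * D : ZMod 8) = 5) := by
  simp only [TwoNegOneNeg, modEq_four_one_iff, modEq_four_three_iff, modEq_eight_iff]
  push_cast
  rfl

/-- The condition at `2` for the class of `2f`. -/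
def EvenClassCondition (m p D f : ℕ) : Prop :=
  ¬ OnlyEven m p D ∧ (UsesGraphOne m p D →
    (TwoNegOnePos m p D → f ≡ 1 [MOD 4]) ∧ (TwoNegOneNeg m p D → f ≡ 3 [MOD 4]))

theorem not_isSquare_two_mul (hf : f % 2 = 1) : ¬ IsSquare ((2 * f : ℕ) : ℚ_[2]) := by
  rintro ⟨c, hc⟩
  obtain ⟨z, hz⟩ := padicInt_two_natCast_int_mul_sq (d := 1) (w := c) (z := (2 * f : ℕ))
    (by norm_num) (by rw [PadicInt.coe_natCast, hc]; push_cast; ring)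
  have e1 : ((2 * f : ℕ) : ℤ_[2]) = z ^ 2 := PadicInt.ext (by
    rw [PadicInt.coe_natCast, PadicInt.coe_pow, hz, hc, sq])
  push_cast at e1
  obtain ⟨u, rfl⟩ : 2 ∣ z := two_prime_padicInt.dvd_of_dvd_pow (n := 2) ⟨f, e1.symm⟩
  have e2 : (f : ℤ_[2]) = 2 * u ^ 2 :=
    mul_left_cancel₀ two_prime_padicInt.ne_zero (by linear_combination e1)
  refine not_two_dvd_of_oddResidue (x := (f : ℤ_[2])) ?_ ⟨_, e2⟩
  rw [red8_natCast]
  exact oddResidue_natCast hf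

/-- The quartic is (t² - ge)² - 2pe t² and also (t² + ge)² - 2(p+2g)e t², so 2f is a norm from two
ramified extensions. In the application g = 2^(m-1), hence p + 2g = q. -/
theorem residue_of_twoAdicSoluble_even {g : ℕ} (hg : g ≠ 0) (hf : OddResidue (f : ZMod 8))
    (hp : OddResidue (p : ZMod 8)) (he : OddResidue (e : ZMod 8))
    (H : TwoAdicSoluble (2 * f) ((p + g) * e) ((g * e) ^ 2)) :
    ((f + p * e : ZMod 8) = 0 ∨ (f + p * e : ZMod 8) = 2) ∧
    ((f + (p + 2 * g) * e : ZMod 8) = 0 ∨ (f + (p + 2 * g) * e : ZMod 8) = 2) := by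
  obtain ⟨t, w, h⟩ := H
  have h0 : ((g : ℤ_[2]) * e) ≠ 0 :=
    mul_ne_zero (by exact_mod_cast hg) (natCast_padicInt_ne_zero he)
  have hodd : ∀ P G : ZMod 8, OddResidue P → OddResidue (P + 2 * G) := by decide +kernel
  push_cast at h
  constructor
  · have := residue_of_even_norm (k := p * e) hf (by push_cast; exact hp.mul _ _ he)
      (w := w) (x := t ^ 2 - g * e) (y := t) (by
        by_contra hcon
        push Not at hcon
        apply h0
        rw [hcon.2] at hcon
        linear_combination -hcon.1) (by push_cast; linear_combination h)
    push_cast at this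
    exact this
  · have := residue_of_even_norm (k := (p + 2 * g) * e) hf
      (by push_cast; exact (hodd _ _ hp).mul _ _ he)
      (w := w) (x := t ^ 2 + g * e) (y := t) (by
        by_contra hcon
        push Not at hcon
        apply h0
        rw [hcon.2] at hcon
        linear_combination hcon.1) (by push_cast; linear_combination h)
    push_cast at this
    exact this

/-- Removing the powers of two forced by the shape of the quartic. -/
theorem exists_reduced_even {c n : ℤ_[2]} {t w : ℤ_[2]}
    (h : (2 * f : ℤ_[2]) * w ^ 2 = t ^ 4 - 2 * c * t ^ 2 + 4 * n) :
    ∃ u v : ℤ_[2], f * v ^ 2 = 8 * u ^ 4 - 4 * c * u ^ 2 + 2 * n ∧ t = 2 * u := by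
  have h2 : (2 : ℤ_[2]) ≠ 0 := two_prime_padicInt.ne_zero
  obtain ⟨u, rfl⟩ : 2 ∣ t := two_prime_padicInt.dvd_of_dvd_pow (n := 4)
    ⟨f * w ^ 2 + c * t ^ 2 - 2 * n, by linear_combination -h⟩
  exact ⟨u, w, mul_left_cancel₀ h2 (by linear_combination h), rfl⟩

theorem two_dvd_of_two_dvd_mul_sq (hf : OddResidue (f : ZMod 8)) {v : ℤ_[2]}
    (h : 2 ∣ (f : ℤ_[2]) * v ^ 2) : 2 ∣ v :=
  two_prime_padicInt.dvd_of_dvd_pow ((two_prime_padicInt.dvd_or_dvd h).resolve_left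
    (not_two_dvd_of_oddResidue (by rwa [red8_natCast])))

/-- The case m = 2: successive divisions by 2 leave e² as the only term not visibly even. -/
theorem not_twoAdicSoluble_even_two (hf : OddResidue (f : ZMod 8)) (he : OddResidue (e : ZMod 8)) :
    ¬ TwoAdicSoluble (2 * f) ((p + 2) * e) ((2 * e) ^ 2) := by
  rintro ⟨t, w, h⟩
  push_cast at h
  obtain ⟨u, v, h1, -⟩ := exists_reduced_even (f := f) (c := (p + 2) * e) (n := (e : ℤ_[2]) ^ 2)
    (t := t) (w := w) (by linear_combination h)
  obtain ⟨v, rfl⟩ := two_dvd_of_two_dvd_mul_sq (v := v) hf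
    ⟨4 * u ^ 4 - 2 * ((p + 2) * e) * u ^ 2 + e ^ 2, by linear_combination h1⟩
  have h2 : 2 * (f * v ^ 2) = 4 * u ^ 4 - 2 * ((p + 2) * e) * u ^ 2 + (e : ℤ_[2]) ^ 2 :=
    mul_left_cancel₀ two_prime_padicInt.ne_zero (by linear_combination h1)
  refine not_two_dvd_of_oddResidue (x := (e : ℤ_[2])) (by rwa [red8_natCast])
    (two_prime_padicInt.dvd_of_dvd_pow (n := 2) ⟨f * v ^ 2 - 2 * u ^ 4 + (p + 2) * e * u ^ 2, ?_⟩)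
  linear_combination -h2

theorem residue_even_four_aux : ∀ f v u c : ZMod 8, OddResidue f → OddResidue c →
    f * v ^ 2 = 2 * u ^ 4 - c * u ^ 2 + 2 → f = 4 - c := by decide +kernel

theorem oddResidue_add_four : ∀ P : ZMod 8, OddResidue P → OddResidue (P + 4) := by decide +kernel

/-- The case m = 3: halving t and w reduces to f v² = 2u⁴ - (p+4)e u² + 2e², which modulo 8 is
possible only for u odd. -/
theorem residue_of_twoAdicSoluble_even_four (hf : OddResidue (f : ZMod 8))
    (hp : OddResidue (p : ZMod 8)) (he : OddResidue (e : ZMod 8))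
    (H : TwoAdicSoluble (2 * f) ((p + 4) * e) ((4 * e) ^ 2)) :
    (f : ZMod 8) = 4 - (p + 4) * e := by
  obtain ⟨t, w, h⟩ := H
  push_cast at h
  obtain ⟨u, v, h1, -⟩ := exists_reduced_even (f := f) (c := (p + 4) * e) (n := 4 * (e : ℤ_[2]) ^ 2)
    (t := t) (w := w) (by linear_combination h)
  obtain ⟨v, rfl⟩ := two_dvd_of_two_dvd_mul_sq (v := v) hf
    ⟨4 * u ^ 4 - 2 * ((p + 4) * e) * u ^ 2 + 4 * e ^ 2, by linear_combination h1⟩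
  have h2 : f * v ^ 2 = 2 * u ^ 4 - ((p + 4) * e) * u ^ 2 + 2 * (e : ℤ_[2]) ^ 2 :=
    mul_left_cancel₀ (pow_ne_zero 2 two_prime_padicInt.ne_zero) (by linear_combination h1)
  have h3 := congrArg red8 h2
  simp only [map_mul, map_add, map_sub, map_pow, map_ofNat, red8_natCast,
    oddResidue_sq _ he] at h3
  exact residue_even_four_aux _ (red8 v) (red8 u) _ hf ((oddResidue_add_four _ hp).mul _ _ he)
    (by rw [h3, mul_one])

theorem residue_even_eight_aux : ∀ f v u c : ZMod 8, OddResidue f → OddResidue c →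
    f * v ^ 2 = 8 * u ^ 4 - c * u ^ 2 + 2 → f = 2 - c := by decide +kernel

theorem residue_even_eight_aux' : ∀ f v u c : ZMod 8, OddResidue f → OddResidue c → OddResidue u →
    f * v ^ 2 = 2 * u ^ 4 - c * u ^ 2 + 8 → f = 2 - c := by decide +kernel

/-- The case m = 4: the reduced equation is f v² = 2u⁴ - (p+8)e u² + 8e². An even u allows one more
division by 4, and both branches end in the same residue. -/
theorem residue_of_twoAdicSoluble_even_eight (hf : OddResidue (f : ZMod 8))
    (hp : OddResidue (p : ZMod 8)) (he : OddResidue (e : ZMod 8))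
    (H : TwoAdicSoluble (2 * f) ((p + 8) * e) ((8 * e) ^ 2)) :
    (f : ZMod 8) = 2 - p * e := by
  obtain ⟨t, w, h⟩ := H
  push_cast at h
  obtain ⟨u, v, h1, -⟩ := exists_reduced_even (f := f) (c := (p + 8) * e) (n := 16 * (e : ℤ_[2]) ^ 2)
    (t := t) (w := w) (by linear_combination h)
  obtain ⟨v, rfl⟩ := two_dvd_of_two_dvd_mul_sq (v := v) hf
    ⟨4 * u ^ 4 - 2 * ((p + 8) * e) * u ^ 2 + 16 * e ^ 2, by linear_combination h1⟩
  have h2 : f * v ^ 2 = 2 * u ^ 4 - ((p + 8) * e) * u ^ 2 + 8 * (e : ℤ_[2]) ^ 2 :=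
    mul_left_cancel₀ (pow_ne_zero 2 two_prime_padicInt.ne_zero) (by linear_combination h1)
  have h8 : (8 : ZMod 8) = 0 := rfl
  rcases two_dvd_or_oddResidue u with ⟨u, rfl⟩ | hu
  · obtain ⟨v, rfl⟩ := two_dvd_of_two_dvd_mul_sq (v := v) hf
      ⟨16 * u ^ 4 - 2 * ((p + 8) * e) * u ^ 2 + 4 * e ^ 2, by linear_combination h2⟩
    have h4 : f * v ^ 2 = 8 * u ^ 4 - ((p + 8) * e) * u ^ 2 + 2 * (e : ℤ_[2]) ^ 2 :=
      mul_left_cancel₀ (pow_ne_zero 2 two_prime_padicInt.ne_zero) (by linear_combination h2)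
    have h3 := congrArg red8 h4
    simp only [map_mul, map_add, map_sub, map_pow, map_ofNat, red8_natCast,
      oddResidue_sq _ he] at h3
    refine residue_even_eight_aux _ (red8 v) (red8 u) _ hf (hp.mul _ _ he) ?_
    linear_combination h3 - (e * red8 u ^ 2) * h8
  · have h3 := congrArg red8 h2
    simp only [map_mul, map_add, map_sub, map_pow, map_ofNat, red8_natCast,
      oddResidue_sq _ he] at h3
    refine residue_even_eight_aux' _ (red8 v) (red8 u) _ hf (hp.mul _ _ he) hu ?_
    linear_combination h3 - (e * red8 u ^ 2) * h8

/-- For m = 1 the quartic at t = 1 is 2((e²+1)/2 - (p+1)e). The half has to be known mod 8, hence e²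
mod 16, which is finer than e² ≡ 1 mod 8. -/
theorem exists_half_sq_add_one {e : ℕ} (he : e % 2 = 1) : ∃ n : ℕ, e ^ 2 + 1 = 2 * n ∧
    (((e : ZMod 8) = 1 ∨ (e : ZMod 8) = 7) ∧ (n : ZMod 8) = 1 ∨
      ((e : ZMod 8) = 3 ∨ (e : ZMod 8) = 5) ∧ (n : ZMod 8) = 5) := by
  have h8 : (8 : ZMod 8) = 0 := rfl
  obtain ⟨a, r, hr, rfl⟩ : ∃ a r, (r = 1 ∨ r = 3 ∨ r = 5 ∨ r = 7) ∧ e = 8 * a + r :=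
    ⟨e / 8, e % 8, by omega, by omega⟩
  have hcast : ((8 * a + r : ℕ) : ZMod 8) = r := by push_cast; rw [h8]; ring
  have hn : ∀ k : ℕ, ((8 * (4 * a ^ 2 + a * r) + k : ℕ) : ZMod 8) = k := fun k => by
    push_cast; rw [h8]; ring
  refine ⟨8 * (4 * a ^ 2 + a * r) + (r ^ 2 + 1) / 2, ?_, ?_⟩
  · rcases hr with rfl | rfl | rfl | rfl <;> norm_num <;> ring
  · rw [hcast, hn]
    rcases hr with rfl | rfl | rfl | rfl <;> decide +kernel

theorem twoAdicSoluble_even_one (hf : OddResidue (f : ZMod 8)) {n : ℕ} (hn : e ^ 2 + 1 = 2 * n)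
    (h : (n - (p + 1) * e : ZMod 8) = f) : TwoAdicSoluble (2 * f) ((p + 1) * e) ((1 * e) ^ 2) := by
  obtain ⟨w, hw⟩ := exists_eq_mul_sq (d := (f : ℤ_[2])) (v := n - (p + 1) * e)
    (by rwa [red8_natCast]) (by
      simp only [map_mul, map_add, map_sub, map_one, red8_natCast]
      exact h)
  have hn' : (e : ℤ_[2]) ^ 2 + 1 = 2 * n := by exact_mod_cast hn
  exact ⟨1, w, by push_cast; linear_combination 2 * hw - hn'⟩

theorem twoAdicSoluble_even_four (hf : OddResidue (f : ZMod 8)) (he : OddResidue (e : ZMod 8))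
    (h : (f : ZMod 8) = 4 - (p + 4) * e) :
    TwoAdicSoluble (2 * f) ((p + 4) * e) ((4 * e) ^ 2) := by
  obtain ⟨w, hw⟩ := exists_eq_mul_sq (d := (f : ℤ_[2])) (v := 2 - (p + 4) * e + 2 * e ^ 2)
    (by rwa [red8_natCast]) (by
      simp only [map_mul, map_add, map_sub, map_ofNat, map_pow, red8_natCast, oddResidue_sq _ he]
      rw [h]; ring)
  exact ⟨2, 2 * w, by push_cast; linear_combination 8 * hw⟩

theorem twoAdicSoluble_even_eight {n : ℕ} (hf : OddResidue (f : ZMod 8))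
    (h : (f : ZMod 8) = 2 - p * e) :
    TwoAdicSoluble (2 * f) ((p + 8 * n) * e) ((8 * n * e) ^ 2) := by
  have h8 : (8 : ZMod 8) = 0 := rfl
  obtain ⟨w, hw⟩ := exists_eq_mul_sq (d := (f : ℤ_[2]))
    (v := 2 - (p + 8 * n) * e + 8 * (n * e) ^ 2)
    (by rwa [red8_natCast]) (by
      simp only [map_mul, map_add, map_sub, map_ofNat, map_pow, red8_natCast, h8]
      rw [h]; ring)
  exact ⟨2, 2 * w, by push_cast; linear_combination 8 * hw⟩

/-- The point t = 4, giving f ≡ -pe; the point t = 2 in `twoAdicSoluble_even_eight` gives the other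
residue 2 - pe permitted by the norm condition. -/
theorem twoAdicSoluble_even_sixteen {n : ℕ} (hf : OddResidue (f : ZMod 8))
    (h : (f : ZMod 8) = -(p * e)) :
    TwoAdicSoluble (2 * f) ((p + 16 * n) * e) ((16 * n * e) ^ 2) := by
  have h8 : (8 : ZMod 8) = 0 := rfl
  obtain ⟨w, hw⟩ := exists_eq_mul_sq (d := (f : ℤ_[2]))
    (v := 8 - (p + 8 * (2 * n)) * e + 8 * (n * e) ^ 2)
    (by rwa [red8_natCast]) (by
      simp only [map_mul, map_add, map_sub, map_ofNat, map_pow, red8_natCast, h8]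
      rw [h]; ring)
  exact ⟨4, 4 * w, by push_cast; linear_combination 32 * hw⟩

theorem torsorSoluble_even_iff_twoAdicSoluble {g q : ℕ} (hq : q = p + 2 * g) (hf : f % 2 = 1) :
    TorsorSoluble ((p + q) * (f * e : ℕ) : ℚ_[2]) (p * q * (f * e : ℕ) ^ 2) (2 * f : ℕ) ↔
      TwoAdicSoluble (2 * f) ((p + g) * e) ((g * e) ^ 2) := by
  have h := torsorSoluble_two_iff (d := 2 * f) (α := (p + g) * e) (γ := (g * e) ^ 2) (by omega)
    (b := p * q * (f * e : ℕ) ^ 2) (by rw [hq]; push_cast; ring)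
  rw [or_iff_right (not_isSquare_two_mul hf)] at h
  rw [← h]
  have : ((p + q) * (f * e : ℕ) : ℚ_[2]) = (2 * f : ℕ) * ((p + g) * e : ℕ) := by
    rw [hq]; push_cast; ring
  rw [this]

set_option synthInstance.maxSize 4096 in
theorem evenClass_residue_one : ∀ P E F : ZMod 8, OddResidue P → OddResidue E → OddResidue F →
    (F + P * E = 0 ∨ F + P * E = 2) ∧ (F + (P + 2) * E = 0 ∨ F + (P + 2) * E = 2) →
    ((P * (F * E) = 5 → ¬ F * E = 3 ∧ ¬ F * E = 7) ∧
      (P * (F * E) = 1 → ¬ F * E = 1 ∧ ¬ F * E = 5) ∧ ¬ P * (F * E) = 3) ∧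
    (P * (F * E) = 7 ∧ (F * E = 1 ∨ F * E = 5) ∨ P * (F * E) = 1 ∧ (F * E = 3 ∨ F * E = 7) →
      F = 1 ∨ F = 5) ∧
    (P * (F * E) = 5 ∧ (F * E = 1 ∨ F * E = 5) ∨ P * (F * E) = 7 ∧ (F * E = 3 ∨ F * E = 7) →
      F = 3 ∨ F = 7) := by
  decide +kernel

-- Conversely, for m = 1 these conditions give f the residue attained at t = 1, the constant 1 or 5
-- being (e²+1)/2 mod 8.
set_option synthInstance.maxSize 4096 in
theorem evenClass_residue_one_conv : ∀ P E F : ZMod 8,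
    OddResidue P → OddResidue E → OddResidue F →
    ((P * (F * E) = 5 → ¬ F * E = 3 ∧ ¬ F * E = 7) ∧
      (P * (F * E) = 1 → ¬ F * E = 1 ∧ ¬ F * E = 5) ∧ ¬ P * (F * E) = 3) ∧
    (P * (F * E) = 7 ∧ (F * E = 1 ∨ F * E = 5) ∨ P * (F * E) = 1 ∧ (F * E = 3 ∨ F * E = 7) →
      F = 1 ∨ F = 5) ∧
    (P * (F * E) = 5 ∧ (F * E = 1 ∨ F * E = 5) ∨ P * (F * E) = 7 ∧ (F * E = 3 ∨ F * E = 7) →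
      F = 3 ∨ F = 7) →
    ((E = 1 ∨ E = 7) → 1 - (P + 1) * E = F) ∧ ((E = 3 ∨ E = 5) → 5 - (P + 1) * E = F) := by
  decide +kernel

theorem evenClass_residue_three : ∀ P E F : ZMod 8, OddResidue P → OddResidue E → OddResidue F →
    (F = 4 - (P + 4) * E ↔
      P * (F * E) ≠ 3 ∧ P * (F * E) ≠ 1 ∧ P * (F * E) ≠ 5) := by decide +kernel

/-- For m = 4 a single residue class of f is soluble; in terms of pD this excludes 3 and 7 mod 8 and
fixes f mod 4 in the two remaining classes. Compare `evenClass_residue_five`, for m ≥ 5, where 7 is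
no longer excluded. -/
theorem evenClass_residue_four : ∀ P E F : ZMod 8, OddResidue P → OddResidue E → OddResidue F →
    (F = 2 - P * E ↔ P * (F * E) ≠ 3 ∧ P * (F * E) ≠ 7 ∧ (P * (F * E) = 1 → F = 1 ∨ F = 5) ∧
      (P * (F * E) = 5 → F = 3 ∨ F = 7)) := by decide +kernel

theorem evenClass_residue_five : ∀ P E F : ZMod 8, OddResidue P → OddResidue E → OddResidue F →
    (F + P * E = 0 ∨ F + P * E = 2 ↔ P * (F * E) ≠ 3 ∧ (P * (F * E) = 1 → F = 1 ∨ F = 5) ∧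
      (P * (F * E) = 5 → F = 3 ∨ F = 7)) := by decide +kernel

theorem torsorSoluble_two_even_iff {m q : ℕ} (hm : 1 ≤ m) (hp : p % 2 = 1) (hq : q = p + 2 ^ m)
    (hf : f % 2 = 1) (he : e % 2 = 1) :
    TorsorSoluble ((p + q) * (f * e : ℕ) : ℚ_[2]) (p * q * (f * e : ℕ) ^ 2) (2 * f : ℕ) ↔
      EvenClassCondition m p (f * e) f := by
  obtain ⟨k, rfl⟩ := Nat.exists_eq_add_of_le' hm
  rw [torsorSoluble_even_iff_twoAdicSoluble (g := 2 ^ k) (by rw [hq, pow_succ]; ring) hf]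
  obtain ⟨n, hn, hn'⟩ := exists_half_sq_add_one he
  replace hp := oddResidue_natCast hp
  replace hf := oddResidue_natCast hf
  replace he := oddResidue_natCast he
  simp only [EvenClassCondition, onlyEven_iff, usesGraphOne_iff, twoNegOnePos_iff,
    twoNegOneNeg_iff, modEq_four_one_iff, modEq_four_three_iff]
  have hnorm := residue_of_twoAdicSoluble_even (g := 2 ^ k) (by positivity) hf hp he
  have h8 : (8 : ZMod 8) = 0 := rfl
  -- Here m = k + 1, so the branches are m = 1, 2, 3, 4 and m ≥ 5.
  rcases k with _ | _ | _ | _ | k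
  · norm_num only at hnorm ⊢
    push_cast at hnorm ⊢
    constructor
    · intro H
      norm_num
      exact evenClass_residue_one _ _ _ hp he hf (by simpa using hnorm H)
    · intro H
      norm_num at H
      have key := evenClass_residue_one_conv _ _ _ hp he hf H
      refine twoAdicSoluble_even_one hf hn ?_
      rcases hn' with ⟨h1, h2⟩ | ⟨h1, h2⟩
      · rw [h2]; exact key.1 h1
      · rw [h2]; exact key.2 h1
  · norm_num only
    simp only [true_or, or_true, not_true_eq_false, false_and, iff_false]
    exact not_twoAdicSoluble_even_two hf he
  · have key := evenClass_residue_three _ _ _ hp he hf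
    norm_num only
    push_cast
    have h1 : TwoAdicSoluble (2 * f) ((p + 4) * e) ((4 * e) ^ 2) ↔
        (f : ZMod 8) = 4 - (p + 4) * e :=
      ⟨residue_of_twoAdicSoluble_even_four hf hp he, twoAdicSoluble_even_four hf he⟩
    rw [h1, key]
    clear key h1 hnorm
    norm_num
  · have key := evenClass_residue_four _ _ _ hp he hf
    norm_num only
    push_cast
    have h1 : TwoAdicSoluble (2 * f) ((p + 8) * e) ((8 * e) ^ 2) ↔
        (f : ZMod 8) = 2 - p * e :=
      ⟨residue_of_twoAdicSoluble_even_eight hf hp he, fun h => by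
        simpa using twoAdicSoluble_even_eight (n := 1) hf h⟩
    rw [h1, key]
    clear key h1 hnorm
    norm_num
    constructor
    · rintro ⟨a, b, c, d⟩
      exact ⟨⟨a, b⟩, fun _ => ⟨c, d⟩⟩
    · rintro ⟨⟨a, b⟩, h⟩
      exact ⟨a, b, fun x => (h (Or.inl x)).1 x, fun x => (h (Or.inr x)).2 x⟩
  · have key := evenClass_residue_five _ _ _ hp he hf
    have h1 : TwoAdicSoluble (2 * f) ((p + 2 ^ (k + 4)) * e) ((2 ^ (k + 4) * e) ^ 2) ↔
        ((f + p * e : ZMod 8) = 0 ∨ (f + p * e : ZMod 8) = 2) := by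
      refine ⟨fun H => (hnorm H).1, ?_⟩
      rintro (h | h)
      · have e1 : 2 ^ (k + 4) = 16 * 2 ^ k := by ring
        rw [e1]
        exact twoAdicSoluble_even_sixteen hf (by linear_combination h)
      · have e1 : 2 ^ (k + 4) = 8 * 2 ^ (k + 1) := by ring
        rw [e1]
        exact twoAdicSoluble_even_eight hf (by linear_combination h)
    have hm1 : ¬ k + 1 + 1 + 1 + 1 + 1 = 1 := by omega
    have hm2 : ¬ k + 1 + 1 + 1 + 1 + 1 = 2 := by omega
    have hm3 : ¬ k + 1 + 1 + 1 + 1 + 1 = 3 := by omega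
    have hm4 : ¬ k + 1 + 1 + 1 + 1 + 1 = 4 := by omega
    have hm5 : 3 ≤ k + 1 + 1 + 1 + 1 + 1 := by omega
    have hm6 : 4 ≤ k + 1 + 1 + 1 + 1 + 1 := by omega
    simp only [hm1, hm2, hm3, hm4, hm5, hm6, false_and, true_and, false_or]
    push_cast
    change TwoAdicSoluble (2 * f) ((p + 2 ^ (k + 4)) * e) ((2 ^ (k + 4) * e) ^ 2) ↔ _
    rw [h1, key]
    clear key h1 hnorm
    norm_num
    intro _
    by_cases x1 : (p * (f * e) : ZMod 8) = 1
    · exact Or.inl (Or.inl x1)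
    by_cases x5 : (p * (f * e) : ZMod 8) = 5
    · exact Or.inl (Or.inr x5)
    exact Or.inr ⟨fun x => absurd x x1, fun x => absurd x x5⟩

end TwoAdicEven

/-! ### The shape of Selmer integers and their local conditions -/

section SelmerIntegers

/-- The standing hypotheses on `m`, `p`, `q`, `D`. -/
structure Admits (m p q D : ℕ) : Prop where
  one_le : 1 ≤ m
  p_prime : p.Prime
  q_prime : q.Prime
  p_odd : p % 2 = 1
  q_eq : q = p + 2 ^ m
  D_squarefree : Squarefree D
  D_odd : D % 2 = 1
  p_not_dvd : ¬ p ∣ D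
  q_not_dvd : ¬ q ∣ D

/-- The product of the primes in the first part. -/
def partProd (T : Finset ℕ) : ℕ := ∏ l ∈ T, l

/-- The product of the prime factors of `D` outside `T`. -/
def coProd (D : ℕ) (T : Finset ℕ) : ℕ := ∏ l ∈ D.primeFactors \ T, l

/-- The conditions at the odd places for the class of `ε ∏ T`. -/
def OddPlaceCondition (p q D ε : ℕ) (T : Finset ℕ) : Prop :=
  (∀ l ∈ T, jacobiSym (ε * (coProd D T * p) : ℕ) l = 1) ∧
    ∀ l, l ∈ D.primeFactors \ T ∨ l = p ∨ l = q → jacobiSym (ε * partProd T : ℕ) l = 1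

variable {m p q D : ℕ}

theorem jacobiSym_eq_one_iff {l : ℕ} [hl : Fact l.Prime] {a : ℤ} (ha : ¬ (l : ℤ) ∣ a) :
    jacobiSym a l = 1 ↔ IsSquare (a : ZMod l) := by
  rw [← jacobiSym.legendreSym.to_jacobiSym, legendreSym.eq_one_iff]
  rwa [Ne, ZMod.intCast_zmod_eq_zero_iff_dvd]

theorem Admits.curveNonsingular (h : Admits m p q D) : CurveNonsingular p q D where
  p_ne := h.p_prime.ne_zero
  q_ne := h.q_prime.ne_zero
  D_ne := h.D_squarefree.ne_zero
  p_ne_q := by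
    have := h.q_eq
    have : 0 < 2 ^ m := by positivity
    omega

theorem Admits.q_odd (h : Admits m p q D) : q % 2 = 1 := by
  obtain ⟨k, rfl⟩ := Nat.exists_eq_add_of_le' h.one_le
  have h1 := h.q_eq
  have h2 := h.p_odd
  rw [pow_succ] at h1
  omega

theorem Admits.not_dvd_sub (h : Admits m p q D) {l : ℕ} (hl : l.Prime) (hl2 : l ≠ 2) :
    ¬ (l : ℤ) ∣ (q : ℤ) - p := by
  rw [h.q_eq]
  push_cast
  rw [add_sub_cancel_left]
  intro hd
  have hd' : l ∣ 2 ^ m := by exact_mod_cast hd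
  exact hl2 ((Nat.prime_dvd_prime_iff_eq hl Nat.prime_two).1 (hl.dvd_of_dvd_pow hd'))

theorem partProd_mul_coProd (h : Squarefree D) {T : Finset ℕ} (hT : T ⊆ D.primeFactors) :
    partProd T * coProd D T = D := by
  rw [partProd, coProd, mul_comm, Finset.prod_sdiff hT, Nat.prod_primeFactors_of_squarefree h]

theorem primeFactors_partProd {T : Finset ℕ} (hT : T ⊆ D.primeFactors) :
    (partProd T).primeFactors = T :=
  Nat.primeFactors_prod fun _ hl => Nat.prime_of_mem_primeFactors (hT hl)

theorem primesPlus_subset : primesPlus p q D ⊆ D.primeFactors := Finset.filter_subset _ _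

theorem prime_dvd_partProd_iff {T : Finset ℕ} (hT : T ⊆ D.primeFactors) {l : ℕ} (hl : l.Prime) :
    l ∣ partProd T ↔ l ∈ T := by
  have h0 : partProd T ≠ 0 :=
    Finset.prod_ne_zero_iff.2 fun x hx => (Nat.prime_of_mem_primeFactors (hT hx)).ne_zero
  have h1 := primeFactors_partProd hT
  constructor
  · intro h
    rw [← h1]
    exact Nat.mem_primeFactors.2 ⟨hl, h, h0⟩
  · intro h
    rw [← h1] at h
    exact Nat.dvd_of_mem_primeFactors h

theorem squarefree_partProd (h : Squarefree D) {T : Finset ℕ} (hT : T ⊆ D.primeFactors) :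
    Squarefree (partProd T) :=
  Squarefree.squarefree_of_dvd ⟨_, (partProd_mul_coProd h hT).symm⟩ h

/-- A prime of d prime to 2D is excluded by `not_torsorSoluble_of_dvd`; for one dividing D,
solubility forces pq to be a square mod l. -/
theorem Admits.odd_mem_of_selmer (h : Admits m p q D) {d : ℕ} (hd : d ∈ selmerIntegers p q D)
    {l : ℕ} (hl : l.Prime) (hl2 : l ≠ 2) (hld : l ∣ d) : l ∈ primesPlus p q D := by
  have : Fact l.Prime := ⟨hl⟩
  obtain ⟨hsq, hloc⟩ := hd
  have hl2d : ¬ (l : ℤ) ^ 2 ∣ (d : ℤ) := by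
    intro h'
    have h'' : l * l ∣ d := by rw [← sq]; exact_mod_cast h'
    exact hl.one_lt.ne' (Nat.isUnit_iff.1 (hsq l h''))
  have hloc' := hloc l ⟨hl⟩
  have hlD : l ∣ D := by
    by_contra hlD
    refine not_torsorSoluble_of_dvd (p := p) (q := q) (D := D) (d := d) (h.not_dvd_sub hl hl2)
      (by exact_mod_cast hlD) (by exact_mod_cast hld) hl2d ?_
    simpa using hloc'
  have hlp : l ≠ p := by rintro rfl; exact h.p_not_dvd hlD
  have hlq : l ≠ q := by rintro rfl; exact h.q_not_dvd hlD
  have hlp' : ¬ (l : ℤ) ∣ p := fun h' => hlp ((Nat.prime_dvd_prime_iff_eq hl h.p_prime).1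
    (by exact_mod_cast h'))
  have hlq' : ¬ (l : ℤ) ∣ q := fun h' => hlq ((Nat.prime_dvd_prime_iff_eq hl h.q_prime).1
    (by exact_mod_cast h'))
  have hl2D : ¬ l * l ∣ D := fun h' =>
    hl.one_lt.ne' (Nat.isUnit_iff.1 (h.D_squarefree l h'))
  obtain ⟨D₁, hD₁⟩ := hlD
  obtain ⟨d₁, hd₁⟩ := hld
  have h1 := (torsorSoluble_iff_of_dvd_of_dvd (l := l) (p := p) (q := q) (D₁ := D₁) (d₁ := d₁) hl2
    (h.not_dvd_sub hl hl2) hlp' hlq'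
    (fun h' => hl2D (by rw [hD₁]; exact mul_dvd_mul_left l (by exact_mod_cast h')))
    (fun h' => hl2d (by
      rw [hd₁, sq]; push_cast; exact mul_dvd_mul_left (l : ℤ) h'))).1
    (by rw [hD₁, hd₁] at hloc'; push_cast at hloc' ⊢; exact hloc')
  have hpq : ¬ (l : ℤ) ∣ (p : ℤ) * q := fun h' =>
    ((Nat.prime_iff_prime_int.1 hl).dvd_or_dvd h').elim hlp' hlq'
  rw [primesPlus, Finset.mem_filter, Nat.mem_primeFactors]
  exact ⟨⟨hl, ⟨_, hD₁⟩, h.D_squarefree.ne_zero⟩, (jacobiSym_eq_one_iff hpq).2 h1.1⟩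

theorem Admits.exists_part_of_selmer (h : Admits m p q D) {d : ℕ}
    (hd : d ∈ selmerIntegers p q D) :
    ∃ T ⊆ primesPlus p q D, d = partProd T ∨ d = 2 * partProd T := by
  refine ⟨d.primeFactors.erase 2, fun l hl => ?_, ?_⟩
  · rw [Finset.mem_erase, Nat.mem_primeFactors] at hl
    exact h.odd_mem_of_selmer hd hl.2.1 hl.1 hl.2.2.1
  · have hprod := Nat.prod_primeFactors_of_squarefree hd.1
    by_cases h2 : 2 ∈ d.primeFactors
    · right
      exact hprod.symm.trans (Finset.mul_prod_erase d.primeFactors (fun l => l) h2).symm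
    · left
      rw [partProd, Finset.erase_eq_of_notMem h2, hprod]

theorem jacobiSym_mul_self_of_not_dvd {l a : ℕ} (hl : l.Prime) (ha : ¬ l ∣ a) :
    jacobiSym a l * jacobiSym a l = 1 := by
  rw [← sq]
  refine jacobiSym.sq_one ?_
  rw [Int.gcd_natCast_natCast]
  exact Nat.Coprime.symm ((Nat.Prime.coprime_iff_not_dvd hl).2 ha)

/-- The local conditions at the odd places for `ε ∏ T`, `ε ∈ {1, 2}`. -/
theorem Admits.oddPlaceCondition_iff (h : Admits m p q D) {ε : ℕ} (hε : ε = 1 ∨ ε = 2)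
    {T : Finset ℕ} (hT : T ⊆ primesPlus p q D) :
    (∀ (l : ℕ) (_ : Fact l.Prime), l ≠ 2 →
      TorsorSoluble ((p + q) * D : ℚ_[l]) (p * q * D ^ 2) ((ε * partProd T : ℕ) : ℚ_[l])) ↔
      OddPlaceCondition p q D ε T := by
  have hTD := hT.trans primesPlus_subset
  have hDe := partProd_mul_coProd h.D_squarefree hTD
  have hlε : ∀ {l : ℕ}, l.Prime → l ≠ 2 → ¬ l ∣ ε := by
    rintro l hl hl2 hd
    rcases hε with rfl | rfl
    · exact hl.one_lt.ne' (Nat.dvd_one.1 hd)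
    · exact hl2 ((Nat.prime_dvd_prime_iff_eq hl Nat.prime_two).1 hd)
  have hl2D : ∀ {l : ℕ}, l.Prime → ¬ l * l ∣ D := fun hl h' =>
    hl.one_lt.ne' (Nat.isUnit_iff.1 (h.D_squarefree _ h'))
  have odd_of_dvd : ∀ {l : ℕ}, l ∣ D → l ≠ 2 := by
    rintro l hlD rfl
    have := h.D_odd
    omega
  have hp2 : p ≠ 2 := by rintro rfl; exact absurd h.p_odd (by norm_num)
  have hq2 : q ≠ 2 := by rintro rfl; exact absurd h.q_odd (by norm_num)
  -- places in `T`
  have hA : ∀ (l : ℕ) (_ : Fact l.Prime), l ∈ T →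
      (TorsorSoluble ((p + q) * D : ℚ_[l]) (p * q * D ^ 2) ((ε * partProd T : ℕ) : ℚ_[l]) ↔
        jacobiSym (ε * (coProd D T * p) : ℕ) l = 1) := by
    intro l hlF hlT
    have hl := hlF.out
    have hlD : l ∣ D := Nat.dvd_of_mem_primeFactors (hTD hlT)
    have hl2 := odd_of_dvd hlD
    have hlp : ¬ l ∣ p := fun h' => h.p_not_dvd
      ((Nat.prime_dvd_prime_iff_eq hl h.p_prime).1 h' ▸ hlD)
    have hlq : ¬ l ∣ q := fun h' => h.q_not_dvd
      ((Nat.prime_dvd_prime_iff_eq hl h.q_prime).1 h' ▸ hlD)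
    obtain ⟨f₁, hf₁⟩ := (prime_dvd_partProd_iff hTD hl).2 hlT
    have hf₁l : ¬ l ∣ f₁ := fun h' => hl2D hl (by
      rw [← hDe, hf₁]; exact (mul_dvd_mul_left l h').mul_right _)
    have hel : ¬ l ∣ coProd D T := fun h' => hl2D hl (by
      rw [← hDe, hf₁]; exact mul_dvd_mul (Dvd.intro _ rfl) h')
    have hn1 : ¬ l ∣ f₁ * coProd D T := fun h' => (hl.dvd_mul.1 h').elim hf₁l hel
    have hn2 : ¬ l ∣ ε * f₁ := fun h' => (hl.dvd_mul.1 h').elim (hlε hl hl2) hf₁l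
    have hn3 : ¬ l ∣ p * (ε * f₁) * (f₁ * coProd D T) := fun h' => (hl.dvd_mul.1 h').elim
      (fun h' => (hl.dvd_mul.1 h').elim hlp hn2) hn1
    have key := torsorSoluble_iff_of_dvd_of_dvd (l := l) (p := p) (q := q)
      (D₁ := (f₁ * coProd D T : ℕ)) (d₁ := (ε * f₁ : ℕ)) hl2 (h.not_dvd_sub hl hl2)
      (by exact_mod_cast hlp) (by exact_mod_cast hlq) (by exact_mod_cast hn1)
      (by exact_mod_cast hn2)
    have e1 : ((l : ℤ) * (f₁ * coProd D T : ℕ) : ℤ) = D := by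
      have e := congrArg (Nat.cast : ℕ → ℤ) hDe
      rw [hf₁] at e
      push_cast at e ⊢
      linear_combination e
    have e2 : ((l : ℤ) * (ε * f₁ : ℕ) : ℤ) = (ε * partProd T : ℕ) := by
      rw [hf₁]; push_cast; ring
    rw [e1, e2] at key
    simp only [Int.cast_natCast] at key
    have hpq1 : jacobiSym ((p : ℤ) * q) l = 1 := (Finset.mem_filter.1 (hT hlT)).2
    have hpqd : ¬ (l : ℤ) ∣ (p : ℤ) * q := by
      intro h'
      have h'' : l ∣ p * q := by exact_mod_cast h'
      exact (hl.dvd_mul.1 h'').elim hlp hlq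
    rw [key, and_iff_right ((jacobiSym_eq_one_iff hpqd).1 hpq1),
      ← jacobiSym_eq_one_iff (by exact_mod_cast hn3)]
    -- The cofactor f₁ = f/l occurs in both d/l and D/l, so it enters squared and drops out of the
    -- symbol.
    have e3 : ((p : ℤ) * (ε * f₁ : ℕ) * (f₁ * coProd D T : ℕ) : ℤ) =
        (ε * (coProd D T * p) : ℕ) * ((f₁ : ℤ) * f₁) := by push_cast; ring
    rw [e3, jacobiSym.mul_left, jacobiSym.mul_left (f₁ : ℤ), jacobiSym_mul_self_of_not_dvd hl hf₁l,
      mul_one]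
  -- bad places outside `T`
  have hB : ∀ (l : ℕ) (_ : Fact l.Prime), l ∈ D.primeFactors \ T ∨ l = p ∨ l = q →
      (TorsorSoluble ((p + q) * D : ℚ_[l]) (p * q * D ^ 2) ((ε * partProd T : ℕ) : ℚ_[l]) ↔
        jacobiSym (ε * partProd T : ℕ) l = 1) := by
    intro l hlF hlB
    have hl := hlF.out
    have hl2 : l ≠ 2 := by
      rcases hlB with hlB | rfl | rfl
      · exact odd_of_dvd (Nat.dvd_of_mem_primeFactors (Finset.mem_sdiff.1 hlB).1)
      · exact hp2
      · exact hq2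
    have hlT : l ∉ T := by
      rcases hlB with hlB | rfl | rfl
      · exact (Finset.mem_sdiff.1 hlB).2
      · exact fun h' => h.p_not_dvd (Nat.dvd_of_mem_primeFactors (hTD h'))
      · exact fun h' => h.q_not_dvd (Nat.dvd_of_mem_primeFactors (hTD h'))
    have hld : ¬ l ∣ ε * partProd T := fun h' => (hl.dvd_mul.1 h').elim (hlε hl hl2)
      fun h' => hlT ((prime_dvd_partProd_iff hTD hl).1 h')
    have hld' : ¬ (l : ℤ) ∣ ((ε * partProd T : ℕ) : ℤ) := by exact_mod_cast hld
    rw [jacobiSym_eq_one_iff hld']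
    constructor
    · intro H
      have H' : TorsorSoluble (((p : ℤ) + (q : ℤ)) * (D : ℤ) : ℚ_[l])
          ((p : ℤ) * (q : ℤ) * (D : ℤ) ^ 2) (((ε * partProd T : ℕ) : ℤ) : ℚ_[l]) := by
        simpa only [Int.cast_natCast] using H
      by_cases hlD : l ∣ D
      · exact isSquare_zmod_of_torsorSoluble_of_dvd_left (h.not_dvd_sub hl hl2)
          (by exact_mod_cast hlD) (by rw [sq]; exact_mod_cast hl2D hl) hld' H'
      · have hlpq : l = p ∨ l = q := hlB.resolve_left fun h' =>
          hlD (Nat.dvd_of_mem_primeFactors (Finset.mem_sdiff.1 h').1)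
        have hne := h.curveNonsingular.p_ne_q
        refine isSquare_zmod_of_torsorSoluble_of_dvd_mul hl2 ?_ ?_ (by exact_mod_cast hlD) hld' H'
        · rcases hlpq with rfl | rfl
          · exact dvd_mul_right _ _
          · exact dvd_mul_left _ _
        · intro h'
          have h'' : l * l ∣ p * q := by rw [← sq]; exact_mod_cast h'
          rcases hlpq with rfl | rfl
          · have := (Nat.mul_dvd_mul_iff_left hl.pos).1 h''
            exact hne ((Nat.prime_dvd_prime_iff_eq hl h.q_prime).1 this)
          · have := (Nat.mul_dvd_mul_iff_right hl.pos).1 h''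
            exact hne ((Nat.prime_dvd_prime_iff_eq hl h.p_prime).1 this).symm
    · intro H
      simpa only [Int.cast_natCast] using
        torsorSoluble_of_isSquare_zmod (a := (p + q) * D) (b := p * q * D ^ 2) hl2 hld' H
  constructor
  · intro H
    refine ⟨fun l hl => ?_, fun l hl => ?_⟩
    · have hlF : Fact l.Prime := ⟨Nat.prime_of_mem_primeFactors (hTD hl)⟩
      exact (hA l hlF hl).1
        (H l hlF (odd_of_dvd (Nat.dvd_of_mem_primeFactors (hTD hl))))
    · have hlF : Fact l.Prime := ⟨by
        rcases hl with hl | rfl | rfl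
        · exact Nat.prime_of_mem_primeFactors (Finset.mem_sdiff.1 hl).1
        · exact h.p_prime
        · exact h.q_prime⟩
      refine (hB l hlF hl).1 (H l hlF ?_)
      rcases hl with hl | rfl | rfl
      · exact odd_of_dvd (Nat.dvd_of_mem_primeFactors (Finset.mem_sdiff.1 hl).1)
      · exact hp2
      · exact hq2
  · rintro ⟨H1, H2⟩ l hlF hl2
    have hl := hlF.out
    by_cases hlT : l ∈ T
    · exact (hA l hlF hlT).2 (H1 l hlT)
    by_cases hlB : l ∈ D.primeFactors \ T ∨ l = p ∨ l = q
    · exact (hB l hlF hlB).2 (H2 l hlB)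
    push Not at hlB
    obtain ⟨hlB, hlp, hlq⟩ := hlB
    have hlD : ¬ l ∣ D := fun h' => hlB (Finset.mem_sdiff.2
      ⟨Nat.mem_primeFactors.2 ⟨hl, h', h.D_squarefree.ne_zero⟩, hlT⟩)
    have hlp' : ¬ l ∣ p := fun h' => hlp ((Nat.prime_dvd_prime_iff_eq hl h.p_prime).1 h')
    have hlq' : ¬ l ∣ q := fun h' => hlq ((Nat.prime_dvd_prime_iff_eq hl h.q_prime).1 h')
    have hld : ¬ l ∣ ε * partProd T := fun h' => (hl.dvd_mul.1 h').elim (hlε hl hl2)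
      fun h' => hlT ((prime_dvd_partProd_iff hTD hl).1 h')
    simpa only [Int.cast_natCast] using
      torsorSoluble_of_good_place (l := l) (p := p) (q := q) (D := D) (d := (ε * partProd T : ℕ))
        hl2 (h.not_dvd_sub hl hl2) (by exact_mod_cast hlp') (by exact_mod_cast hlq')
        (by exact_mod_cast hlD) (by exact_mod_cast hld)

theorem Admits.parity (h : Admits m p q D) {T : Finset ℕ} (hT : T ⊆ primesPlus p q D) :
    partProd T % 2 = 1 ∧ coProd D T % 2 = 1 := by
  have hDe := partProd_mul_coProd h.D_squarefree (hT.trans primesPlus_subset)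
  have := h.D_odd
  rw [← hDe, Nat.mul_mod] at this
  have h1 := Nat.mod_two_eq_zero_or_one (partProd T)
  have h2 := Nat.mod_two_eq_zero_or_one (coProd D T)
  rcases h1 with h1 | h1 <;> rcases h2 with h2 | h2 <;> simp_all

theorem Admits.partProd_mem_iff (h : Admits m p q D) {T : Finset ℕ} (hT : T ⊆ primesPlus p q D) :
    partProd T ∈ selmerIntegers p q D ↔ OddPlaceCondition p q D 1 T ∧
      (UsesGraphOne m p D → partProd T ≡ 1 [MOD 4]) := by
  have hDe := partProd_mul_coProd h.D_squarefree (hT.trans primesPlus_subset)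
  obtain ⟨hf, he⟩ := h.parity hT
  have h2 := torsorSoluble_two_odd_iff h.one_le h.p_odd h.q_eq hf he
  rw [hDe] at h2
  rw [← h2, ← h.oddPlaceCondition_iff (Or.inl rfl) hT]
  simp only [one_mul, selmerIntegers, Set.mem_ofPred_eq,
    squarefree_partProd h.D_squarefree (hT.trans primesPlus_subset), true_and]
  constructor
  · exact fun H => ⟨fun l hl _ => H l hl, H 2 ⟨Nat.prime_two⟩⟩
  · rintro ⟨H1, H2⟩ l hl
    by_cases hl2 : l = 2
    · subst hl2; exact H2
    · exact H1 l hl hl2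

theorem Admits.two_mul_partProd_mem_iff (h : Admits m p q D) {T : Finset ℕ}
    (hT : T ⊆ primesPlus p q D) :
    2 * partProd T ∈ selmerIntegers p q D ↔ OddPlaceCondition p q D 2 T ∧
      EvenClassCondition m p D (partProd T) := by
  have hDe := partProd_mul_coProd h.D_squarefree (hT.trans primesPlus_subset)
  obtain ⟨hf, he⟩ := h.parity hT
  have h2 := torsorSoluble_two_even_iff h.one_le h.p_odd h.q_eq hf he
  rw [hDe] at h2
  have hsq : Squarefree (2 * partProd T) := by
    rw [Nat.squarefree_mul_iff]
    exact ⟨Nat.coprime_two_left.2 (Nat.odd_iff.2 hf), Nat.prime_two.squarefree,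
      squarefree_partProd h.D_squarefree (hT.trans primesPlus_subset)⟩
  rw [← h2, ← h.oddPlaceCondition_iff (Or.inr rfl) hT]
  simp only [selmerIntegers, Set.mem_ofPred_eq, hsq, true_and]
  constructor
  · exact fun H => ⟨fun l hl _ => H l hl, H 2 ⟨Nat.prime_two⟩⟩
  · rintro ⟨H1, H2⟩ l hl
    by_cases hl2 : l = 2
    · subst hl2; exact H2
    · exact H1 l hl hl2

end SelmerIntegers

/-! ### Products of symbols and parities -/

section Parity

theorem prod_eq_neg_one_pow_card {ι : Type*} {S : Finset ι} {χ : ι → ℤ}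
    (h : ∀ x ∈ S, χ x = 1 ∨ χ x = -1) :
    ∏ x ∈ S, χ x = (-1) ^ (S.filter fun x => χ x = -1).card := by
  rw [← Finset.prod_const, Finset.prod_filter]
  refine Finset.prod_congr rfl fun x hx => ?_
  rcases h x hx with h1 | h1 <;> simp [h1]

theorem jacobiSym_prod_left (S : Finset ℕ) (n : ℕ) :
    jacobiSym (∏ x ∈ S, x : ℕ) n = ∏ x ∈ S, jacobiSym x n := by
  induction S using Finset.induction_on with
  | empty => simp
  | insert a S ha ih =>
    rw [Finset.prod_insert ha, Finset.prod_insert ha, ← ih, Nat.cast_mul, jacobiSym.mul_left]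

theorem neg_one_pow_eq_iff_modEq_two (k : ℕ) :
    ((-1 : ℤ) ^ k = 1 ↔ k ≡ 0 [MOD 2]) ∧ ((-1 : ℤ) ^ k = -1 ↔ k ≡ 1 [MOD 2]) := by
  rw [← Nat.mod_add_div k 2, pow_add, pow_mul]
  rcases Nat.mod_two_eq_zero_or_one k with h | h <;> simp [h, Nat.ModEq]

/-- Bridge between graph and arithmetic: k is a number of edges, J the matching product of Legendre
symbols and χ the symbol of ε, so a parity condition says that a single symbol equals 1. -/
theorem parity_iff_mul_eq_one {χ J : ℤ} {k : ℕ} (hχ : χ = 1 ∨ χ = -1) (hJ : J = (-1) ^ k) :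
    ((χ = 1 → k ≡ 0 [MOD 2]) ∧ (χ = -1 → k ≡ 1 [MOD 2])) ↔ χ * J = 1 := by
  obtain ⟨h0, h1⟩ := neg_one_pow_eq_iff_modEq_two k
  rw [← h0, ← h1, ← hJ]
  rcases hχ with rfl | rfl
  · simp
  · simp [neg_eq_iff_eq_neg]

theorem jacobiSym_eq_one_or {l a : ℕ} (hl : l.Prime) (ha : ¬ l ∣ a) :
    jacobiSym a l = 1 ∨ jacobiSym a l = -1 := by
  refine jacobiSym.eq_one_or_neg_one ?_
  rw [Int.gcd_natCast_natCast]
  exact Nat.Coprime.symm ((Nat.Prime.coprime_iff_not_dvd hl).2 ha)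

theorem chi_four_partProd {T : Finset ℕ} (hodd : ∀ x ∈ T, x % 2 = 1) :
    ∏ x ∈ T, jacobiSym (-1) x = ZMod.χ₄ (partProd T : ℕ) := by
  rw [partProd, Nat.cast_prod, map_prod]
  exact Finset.prod_congr rfl fun x hx => jacobiSym.at_neg_one (Nat.odd_iff.2 (hodd x hx))

end Parity

/-! ### Partitions of the graph and Selmer integers -/

section Graph

variable {m p q D : ℕ}

/-- The set of vertices attached to a set of primes. -/
def primeVertices (T : Finset ℕ) : Finset ℤ := T.image fun l : ℕ => (l : ℤ)

theorem natCast_mem_primeVertices {T : Finset ℕ} {l : ℕ} : (l : ℤ) ∈ primeVertices T ↔ l ∈ T := by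
  simp [primeVertices]

theorem primeVertices_injective : Function.Injective primeVertices :=
  Finset.image_injective Nat.cast_injective

theorem mem_verts_graphPlus {x : ℤ} : x ∈ (graphPlus m p q D).verts ↔
    (UsesGraphOne m p D ∧ x = -1) ∨
      ∃ l : ℕ, (l = p ∨ l = q ∨ l ∈ D.primeFactors) ∧ x = l := by
  have key : (∃ l : ℕ, (l = p ∨ l = q ∨ l ∈ D.primeFactors) ∧ x = l) ↔
      x = p ∨ x = q ∨ ∃ l ∈ D.primeFactors, (l : ℤ) = x := by
    constructor
    · rintro ⟨l, rfl | rfl | h, rfl⟩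
      · exact Or.inl rfl
      · exact Or.inr (Or.inl rfl)
      · exact Or.inr (Or.inr ⟨l, h, rfl⟩)
    · rintro (rfl | rfl | ⟨l, h, rfl⟩)
      · exact ⟨_, Or.inl rfl, rfl⟩
      · exact ⟨_, Or.inr (Or.inl rfl), rfl⟩
      · exact ⟨_, Or.inr (Or.inr h), rfl⟩
  rw [key]
  unfold graphPlus
  split_ifs with hU
  · simp only [graphOne, Finset.mem_union, Finset.mem_insert, Finset.mem_singleton,
      Finset.mem_image, hU, true_and]
    tauto
  · simp only [graphTwo, Finset.mem_union, Finset.mem_insert, Finset.mem_singleton,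
      Finset.mem_image, hU, false_and, false_or]
    tauto

theorem graphPlus_adj_natCast {l : ℕ} {x : ℤ} :
    (graphPlus m p q D).Adj l x ↔ CommonEdge p q D l x := by
  unfold graphPlus
  split_ifs
  · simp only [graphOne]
    have : (l : ℤ) ≠ -1 := by omega
    simp [this]
  · rfl

theorem commonEdge_iff {a b : ℤ} : CommonEdge p q D a b ↔ ∃ P R : ℕ, a = P ∧ b = R ∧
    jacobiSym R P = -1 ∧ ((P ∈ primesPlus p q D ∧ (R ∈ D.primeFactors ∨ R = p)) ∨
      ((P ∈ primesMinus p q D ∨ P = p ∨ P = q) ∧ R ∈ primesPlus p q D)) := by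
  constructor
  · rintro (⟨hP, hR, h⟩ | ⟨hP, hR, h⟩ | ⟨hl, hR, h⟩ | ⟨hP, h⟩)
    · exact ⟨_, _, rfl, rfl, h, Or.inl ⟨hP, Or.inl hR⟩⟩
    · exact ⟨_, _, rfl, rfl, h, Or.inr ⟨Or.inl hP, hR⟩⟩
    · exact ⟨_, _, rfl, rfl, h, Or.inr ⟨Or.inr hl, hR⟩⟩
    · exact ⟨_, _, rfl, rfl, h, Or.inl ⟨hP, Or.inr rfl⟩⟩
  · rintro ⟨P, R, rfl, rfl, h, ⟨hP, hR | rfl⟩ | ⟨hP | hP, hR⟩⟩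
    · exact .plus_to_any hP hR h
    · exact .plus_to_p hP h
    · exact .minus_to_plus hP hR h
    · exact .pq_to_plus hP hR h

theorem commonEdge_natCast_iff {P R : ℕ} : CommonEdge p q D P R ↔ jacobiSym R P = -1 ∧
    ((P ∈ primesPlus p q D ∧ (R ∈ D.primeFactors ∨ R = p)) ∨
      ((P ∈ primesMinus p q D ∨ P = p ∨ P = q) ∧ R ∈ primesPlus p q D)) := by
  rw [commonEdge_iff]
  constructor
  · rintro ⟨P', R', h1, h2, h⟩
    rw [Nat.cast_inj] at h1 h2
    subst h1 h2
    exact h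
  · exact fun h => ⟨P, R, rfl, rfl, h⟩

theorem edgesTo_primeVertices (G : IntDigraph) (P : ℤ) (S : Finset ℕ) :
    G.edgesTo P (primeVertices S) = (S.filter fun y : ℕ => G.Adj P y).card := by
  rw [IntDigraph.edgesTo, primeVertices, Finset.filter_image,
    Finset.card_image_of_injective _ Nat.cast_injective]

theorem Admits.mem_primesPlus_or_primesMinus (h : Admits m p q D) {l : ℕ}
    (hl : l ∈ D.primeFactors) : l ∈ primesPlus p q D ∨ l ∈ primesMinus p q D := by
  have hlp := Nat.prime_of_mem_primeFactors hl
  have hlD := Nat.dvd_of_mem_primeFactors hl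
  have hpq : ¬ l ∣ p * q := fun h' => (hlp.dvd_mul.1 h').elim
    (fun h' => h.p_not_dvd ((Nat.prime_dvd_prime_iff_eq hlp h.p_prime).1 h' ▸ hlD))
    (fun h' => h.q_not_dvd ((Nat.prime_dvd_prime_iff_eq hlp h.q_prime).1 h' ▸ hlD))
  have := jacobiSym_eq_one_or hlp hpq
  push_cast at this
  exact this.imp (fun h' => Finset.mem_filter.2 ⟨hl, h'⟩) fun h' => Finset.mem_filter.2 ⟨hl, h'⟩

theorem disjoint_primesPlus_primesMinus : Disjoint (primesPlus p q D) (primesMinus p q D) := by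
  rw [primesPlus, primesMinus, Finset.disjoint_filter]
  intro l _ h1 h2
  rw [h1] at h2
  exact absurd h2 (by norm_num)

/-- The admissible partitions correspond to the sets of primes `D_i`, `i ≤ s`. -/
theorem Admits.isPartition_and_admissible_iff (h : Admits m p q D) {V : Finset ℤ × Finset ℤ} :
    (graphPlus m p q D).IsPartition V.1 V.2 ∧ Admissible p q D V.1 ↔
      ∃ T ⊆ primesPlus p q D,
        (primeVertices T, (graphPlus m p q D).verts \ primeVertices T) = V := by
  constructor
  · rintro ⟨⟨hU, hdis⟩, h1, hp, hq, hminus⟩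
    have hsub : V.1 ⊆ (graphPlus m p q D).verts := hU ▸ Finset.subset_union_left
    have hV1 : primeVertices ((primesPlus p q D).filter fun l => (l : ℤ) ∈ V.1) = V.1 := by
      ext x
      constructor
      · intro hx
        obtain ⟨l, hl, rfl⟩ := Finset.mem_image.1 hx
        exact (Finset.mem_filter.1 hl).2
      · intro hx
        rcases mem_verts_graphPlus.1 (hsub hx) with ⟨_, rfl⟩ | ⟨l, rfl | rfl | hl, rfl⟩
        · exact absurd hx h1
        · exact absurd hx hp
        · exact absurd hx hq
        · rw [natCast_mem_primeVertices, Finset.mem_filter]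
          refine ⟨(h.mem_primesPlus_or_primesMinus hl).resolve_right fun h' => ?_, hx⟩
          exact hminus l h' hx
    refine ⟨_, Finset.filter_subset _ _, Prod.ext hV1 ?_⟩
    simp only
    rw [hV1, ← hU, Finset.union_sdiff_cancel_left hdis]
  · rintro ⟨T, hT, rfl⟩
    have hTD := hT.trans primesPlus_subset
    refine ⟨⟨Finset.union_sdiff_of_subset fun x hx => ?_, Finset.disjoint_sdiff⟩, ?_, ?_, ?_, ?_⟩
    · obtain ⟨l, hl, rfl⟩ := Finset.mem_image.1 hx
      exact mem_verts_graphPlus.2 (Or.inr ⟨l, Or.inr (Or.inr (hTD hl)), rfl⟩)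
    · intro hx
      obtain ⟨l, hl, h'⟩ := Finset.mem_image.1 hx
      omega
    · rw [natCast_mem_primeVertices]
      exact fun h' => h.p_not_dvd (Nat.dvd_of_mem_primeFactors (hTD h'))
    · rw [natCast_mem_primeVertices]
      exact fun h' => h.q_not_dvd (Nat.dvd_of_mem_primeFactors (hTD h'))
    · intro l hl
      rw [natCast_mem_primeVertices]
      exact fun h' => Finset.disjoint_left.1 disjoint_primesPlus_primesMinus (hT h') hl

/-- The number of edges from a prime in the first part to the second part. -/
theorem Admits.edgesTo_compl (h : Admits m p q D) {T : Finset ℕ} (hT : T ⊆ primesPlus p q D)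
    {P : ℕ} (hP : P ∈ T) :
    (graphPlus m p q D).edgesTo P ((graphPlus m p q D).verts \ primeVertices T) =
      ((insert p (D.primeFactors \ T)).filter fun y : ℕ => jacobiSym y P = -1).card := by
  have hTD := hT.trans primesPlus_subset
  have hpT : p ∉ T := fun h' => h.p_not_dvd (Nat.dvd_of_mem_primeFactors (hTD h'))
  have hPD := Nat.dvd_of_mem_primeFactors (hTD hP)
  have hPm : P ∉ primesMinus p q D :=
    Finset.disjoint_left.1 disjoint_primesPlus_primesMinus (hT hP)
  have hPp : P ≠ p := by rintro rfl; exact h.p_not_dvd hPD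
  have hPq : P ≠ q := by rintro rfl; exact h.q_not_dvd hPD
  rw [IntDigraph.edgesTo, ← Finset.card_image_of_injective _ (Nat.cast_injective (R := ℤ))]
  congr 1
  ext x
  rw [Finset.mem_filter, Finset.mem_sdiff, mem_verts_graphPlus, graphPlus_adj_natCast,
    Finset.mem_image]
  constructor
  · rintro ⟨⟨_, hxT⟩, hadj⟩
    obtain ⟨P', R, h1, rfl, -⟩ := commonEdge_iff.1 hadj
    obtain ⟨h2, h3⟩ := commonEdge_natCast_iff.1 hadj
    rw [natCast_mem_primeVertices] at hxT
    refine ⟨R, ?_, rfl⟩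
    simp only [Finset.mem_filter, Finset.mem_insert, Finset.mem_sdiff]
    tauto
  · rintro ⟨R, hR, rfl⟩
    simp only [Finset.mem_filter, Finset.mem_insert, Finset.mem_sdiff] at hR
    refine ⟨⟨Or.inr ⟨R, by tauto, rfl⟩, ?_⟩, commonEdge_natCast_iff.2 ⟨hR.2, Or.inl ⟨hT hP, ?_⟩⟩⟩
    · rw [natCast_mem_primeVertices]
      rcases hR.1 with rfl | h'
      · exact hpT
      · exact h'.2
    · tauto

/-- The number of edges from a prime in the second part to the first part. -/
theorem Admits.edgesTo_primeVertices_of_prime (h : Admits m p q D) {T : Finset ℕ}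
    (hT : T ⊆ primesPlus p q D) {l : ℕ} (hl : l = p ∨ l = q ∨ l ∈ D.primeFactors) :
    (graphPlus m p q D).edgesTo l (primeVertices T) =
      (T.filter fun y : ℕ => jacobiSym y l = -1).card := by
  rw [edgesTo_primeVertices]
  congr 1
  refine Finset.filter_congr fun y hy => ?_
  rw [graphPlus_adj_natCast, commonEdge_natCast_iff, and_iff_left_iff_imp]
  intro _
  rcases hl with hl | hl | hl
  · exact Or.inr ⟨Or.inr (Or.inl hl), hT hy⟩
  · exact Or.inr ⟨Or.inr (Or.inr hl), hT hy⟩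
  · rcases h.mem_primesPlus_or_primesMinus hl with h' | h'
    · exact Or.inl ⟨h', Or.inl (primesPlus_subset (hT hy))⟩
    · exact Or.inr ⟨Or.inl h', hT hy⟩

/-- The number of edges from `-1` to the first part. -/
theorem edgesTo_primeVertices_neg_one (hU : UsesGraphOne m p D) {T : Finset ℕ}
    (hT : T ⊆ primesPlus p q D) :
    (graphPlus m p q D).edgesTo (-1) (primeVertices T) =
      (T.filter fun y : ℕ => jacobiSym (-1) y = -1).card := by
  rw [edgesTo_primeVertices]
  congr 1
  refine Finset.filter_congr fun y hy => ?_
  rw [graphPlus, if_pos hU]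
  simp only [graphOne, true_and, Nat.cast_inj]
  constructor
  · rintro (h' | ⟨l, _, rfl, h'⟩)
    · obtain ⟨P', R, h1, -⟩ := commonEdge_iff.1 h'
      omega
    · exact h'
  · exact fun h' => Or.inr ⟨y, hT hy, rfl, h'⟩

/-- Every vertex contributes one local condition: vertices in T and the other primes those at the
odd places, and -1 a congruence mod 4. A vertex of T has an edge towards p only, never q, which
loses nothing since (p/l) = (q/l) there. Keeping χ general treats even (ε = 1) and quasi-even (ε =
2) partitions together. -/
theorem Admits.isQuasiEven_iff (h : Admits m p q D) {ε : ℕ} (hε : ε = 1 ∨ ε = 2) {χ : ℤ → ℤ}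
    (hχ : ∀ l : ℕ, χ l = jacobiSym ε l) {T : Finset ℕ} (hT : T ⊆ primesPlus p q D) :
    (graphPlus m p q D).IsQuasiEven χ (primeVertices T)
      ((graphPlus m p q D).verts \ primeVertices T) ↔
      OddPlaceCondition p q D ε T ∧ (UsesGraphOne m p D →
        (χ (-1) = 1 → partProd T ≡ 1 [MOD 4]) ∧ (χ (-1) = -1 → partProd T ≡ 3 [MOD 4])) := by
  have hTD := hT.trans primesPlus_subset
  have hpart := (h.isPartition_and_admissible_iff.2 ⟨T, hT, rfl⟩).1
  have odd_of_dvd : ∀ {l : ℕ}, l ∣ D → l ≠ 2 := by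
    rintro l hlD rfl
    have := h.D_odd
    omega
  have hχ' : ∀ l : ℕ, l.Prime → l ≠ 2 → χ l = 1 ∨ χ l = -1 := fun l hl hl2 => by
    rw [hχ]
    refine jacobiSym_eq_one_or hl fun hd => ?_
    rcases hε with rfl | rfl
    · exact hl.one_lt.ne' (Nat.dvd_one.1 hd)
    · exact hl2 ((Nat.prime_dvd_prime_iff_eq hl Nat.prime_two).1 hd)
  have hp2 : p ≠ 2 := by rintro rfl; exact absurd h.p_odd (by norm_num)
  have hq2 : q ≠ 2 := by rintro rfl; exact absurd h.q_odd (by norm_num)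
  have hpD : p ∉ D.primeFactors \ T := fun h' =>
    h.p_not_dvd (Nat.dvd_of_mem_primeFactors (Finset.mem_sdiff.1 h').1)
  -- rows of the first part
  have rowA : ∀ l ∈ T,
      (((χ l = 1 → (graphPlus m p q D).edgesTo l
          ((graphPlus m p q D).verts \ primeVertices T) ≡ 0 [MOD 2]) ∧
        (χ l = -1 → (graphPlus m p q D).edgesTo l
          ((graphPlus m p q D).verts \ primeVertices T) ≡ 1 [MOD 2])) ↔
        jacobiSym (ε * (coProd D T * p) : ℕ) l = 1) := by
    intro l hl
    have hlp := Nat.prime_of_mem_primeFactors (hTD hl)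
    have hlD := Nat.dvd_of_mem_primeFactors (hTD hl)
    rw [h.edgesTo_compl hT hl, parity_iff_mul_eq_one (hχ' l hlp (odd_of_dvd hlD))
      (prod_eq_neg_one_pow_card (χ := fun y : ℕ => jacobiSym y l) fun y hy =>
        jacobiSym_eq_one_or hlp fun hd => ?_), ← jacobiSym_prod_left,
        Finset.prod_insert hpD, hχ, ← jacobiSym.mul_left, ← Nat.cast_mul, mul_comm p]
    · rfl
    · rcases Finset.mem_insert.1 hy with rfl | hy
      · exact h.p_not_dvd ((Nat.prime_dvd_prime_iff_eq hlp h.p_prime).1 hd ▸ hlD)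
      · rw [Finset.mem_sdiff] at hy
        exact hy.2 ((Nat.prime_dvd_prime_iff_eq hlp
          (Nat.prime_of_mem_primeFactors hy.1)).1 hd ▸ hl)
  -- rows of the second part
  have rowB : ∀ l, l ∈ D.primeFactors \ T ∨ l = p ∨ l = q →
      (((χ l = 1 → (graphPlus m p q D).edgesTo l (primeVertices T) ≡ 0 [MOD 2]) ∧
        (χ l = -1 → (graphPlus m p q D).edgesTo l (primeVertices T) ≡ 1 [MOD 2])) ↔
        jacobiSym (ε * partProd T : ℕ) l = 1) := by
    intro l hl
    have hlp : l.Prime := by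
      rcases hl with hl | rfl | rfl
      · exact Nat.prime_of_mem_primeFactors (Finset.mem_sdiff.1 hl).1
      · exact h.p_prime
      · exact h.q_prime
    have hl2 : l ≠ 2 := by
      rcases hl with hl | rfl | rfl
      · exact odd_of_dvd (Nat.dvd_of_mem_primeFactors (Finset.mem_sdiff.1 hl).1)
      · exact hp2
      · exact hq2
    have hlT : l ∉ T := by
      rcases hl with hl | rfl | rfl
      · exact (Finset.mem_sdiff.1 hl).2
      · exact fun h' => h.p_not_dvd (Nat.dvd_of_mem_primeFactors (hTD h'))
      · exact fun h' => h.q_not_dvd (Nat.dvd_of_mem_primeFactors (hTD h'))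
    have hl' : l = p ∨ l = q ∨ l ∈ D.primeFactors := by
      rcases hl with hl | hl | hl
      · exact Or.inr (Or.inr (Finset.mem_sdiff.1 hl).1)
      · exact Or.inl hl
      · exact Or.inr (Or.inl hl)
    rw [h.edgesTo_primeVertices_of_prime hT hl', parity_iff_mul_eq_one (hχ' l hlp hl2)
      (prod_eq_neg_one_pow_card (χ := fun y : ℕ => jacobiSym y l) fun y hy =>
        jacobiSym_eq_one_or hlp fun hd => hlT ((Nat.prime_dvd_prime_iff_eq hlp
          (Nat.prime_of_mem_primeFactors (hTD hy))).1 hd ▸ hy)), ← jacobiSym_prod_left, hχ,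
      ← jacobiSym.mul_left, ← Nat.cast_mul]
    rfl
  -- the row of `-1`
  have rowC : UsesGraphOne m p D →
      (((χ (-1) = 1 → (graphPlus m p q D).edgesTo (-1) (primeVertices T) ≡ 0 [MOD 2]) ∧
        (χ (-1) = -1 → (graphPlus m p q D).edgesTo (-1) (primeVertices T) ≡ 1 [MOD 2])) ↔
        (χ (-1) = 1 → partProd T ≡ 1 [MOD 4]) ∧ (χ (-1) = -1 → partProd T ≡ 3 [MOD 4])) := by
    intro hU
    have hodd : ∀ x ∈ T, x % 2 = 1 := fun x hx =>
      ((Nat.prime_of_mem_primeFactors (hTD hx)).eq_two_or_odd).resolve_left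
        (odd_of_dvd (Nat.dvd_of_mem_primeFactors (hTD hx)))
    have hprod := prod_eq_neg_one_pow_card (S := T) (χ := fun y : ℕ => jacobiSym (-1) y)
      fun y hy => jacobiSym.eq_one_or_neg_one (by simp)
    -- Multiplicativity of the character mod 4 turns the number of primes ≡ 3 mod 4 in T into the
    -- residue of their product.
    rw [chi_four_partProd hodd] at hprod
    obtain ⟨h0, h1⟩ := neg_one_pow_eq_iff_modEq_two (T.filter fun y : ℕ => jacobiSym (-1) y = -1).card
    rw [edgesTo_primeVertices_neg_one hU hT, ← h0, ← h1, ← hprod]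
    have hpar := (h.parity hT).1
    have h4 : partProd T % 4 = 1 ∨ partProd T % 4 = 3 := by omega
    rcases h4 with h4 | h4
    · simp [ZMod.χ₄_nat_one_mod_four h4, Nat.ModEq, h4]
    · simp [ZMod.χ₄_nat_three_mod_four h4, Nat.ModEq, h4]
  rw [IntDigraph.IsQuasiEven, and_iff_right hpart]
  constructor
  · rintro ⟨H1, H2⟩
    refine ⟨⟨fun l hl => (rowA l hl).1 (H1 l (natCast_mem_primeVertices.2 hl)),
      fun l hl => (rowB l hl).1 (H2 l ?_)⟩, fun hU => (rowC hU).1 (H2 (-1) ?_)⟩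
    · rw [Finset.mem_sdiff, natCast_mem_primeVertices, mem_verts_graphPlus]
      rcases hl with hl | rfl | rfl
      · exact ⟨Or.inr ⟨l, Or.inr (Or.inr (Finset.mem_sdiff.1 hl).1), rfl⟩,
          (Finset.mem_sdiff.1 hl).2⟩
      · exact ⟨Or.inr ⟨_, Or.inl rfl, rfl⟩,
          fun h' => h.p_not_dvd (Nat.dvd_of_mem_primeFactors (hTD h'))⟩
      · exact ⟨Or.inr ⟨_, Or.inr (Or.inl rfl), rfl⟩,
          fun h' => h.q_not_dvd (Nat.dvd_of_mem_primeFactors (hTD h'))⟩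
    · refine Finset.mem_sdiff.2 ⟨mem_verts_graphPlus.2 (Or.inl ⟨hU, rfl⟩), fun hx => ?_⟩
      obtain ⟨l, -, h'⟩ := Finset.mem_image.1 hx
      omega
  · rintro ⟨⟨H1, H2⟩, H3⟩
    refine ⟨fun x hx => ?_, fun x hx => ?_⟩
    · obtain ⟨l, hl, rfl⟩ := Finset.mem_image.1 hx
      exact (rowA l hl).2 (H1 l hl)
    · rw [Finset.mem_sdiff, mem_verts_graphPlus] at hx
      obtain ⟨⟨hU, rfl⟩ | ⟨l, hl, rfl⟩, hxT⟩ := hx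
      · exact (rowC hU).2 (H3 hU)
      · rw [natCast_mem_primeVertices] at hxT
        have hl' : l ∈ D.primeFactors \ T ∨ l = p ∨ l = q := by
          rw [Finset.mem_sdiff]
          tauto
        exact (rowB l hl').2 (H2 l hl')

theorem Admits.ncard_quasiEven (h : Admits m p q D) {ε : ℕ} (hε : ε = 1 ∨ ε = 2) {χ : ℤ → ℤ}
    (hχ : ∀ l : ℕ, χ l = jacobiSym ε l) :
    Set.ncard {V : Finset ℤ × Finset ℤ |
      (graphPlus m p q D).IsQuasiEven χ V.1 V.2 ∧ Admissible p q D V.1} =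
    Set.ncard {T : Finset ℕ | T ⊆ primesPlus p q D ∧ OddPlaceCondition p q D ε T ∧
      (UsesGraphOne m p D → (χ (-1) = 1 → partProd T ≡ 1 [MOD 4]) ∧
        (χ (-1) = -1 → partProd T ≡ 3 [MOD 4]))} := by
  have hinj : Function.Injective fun T : Finset ℕ =>
      (primeVertices T, (graphPlus m p q D).verts \ primeVertices T) :=
    fun T T' hTT => primeVertices_injective (congrArg Prod.fst hTT)
  rw [← Set.ncard_image_of_injective _ hinj]
  congr 1
  ext V
  constructor
  · rintro ⟨hV, hadm⟩
    obtain ⟨T, hT, rfl⟩ := h.isPartition_and_admissible_iff.1 ⟨hV.1, hadm⟩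
    exact ⟨T, ⟨hT, (h.isQuasiEven_iff hε hχ hT).1 hV⟩, rfl⟩
  · rintro ⟨T, ⟨hT, hV⟩, rfl⟩
    exact ⟨(h.isQuasiEven_iff hε hχ hT).2 hV,
      (h.isPartition_and_admissible_iff.2 ⟨T, hT, rfl⟩).2⟩

/-- Even partitions are the quasi-even ones for the constant symbol 1; at -1 this symbol yields
precisely the congruence f ≡ 1 mod 4 found at 2. -/
theorem Admits.numEven_eq (h : Admits m p q D) : numEven m p q D =
    Set.ncard {T : Finset ℕ | T ⊆ primesPlus p q D ∧ partProd T ∈ selmerIntegers p q D} := by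
  have h1 := h.ncard_quasiEven (Or.inl rfl) (χ := fun _ => 1) (fun l => by simp)
  rw [numEven]
  have e1 : ∀ V₁ V₂, (graphPlus m p q D).IsEven V₁ V₂ ↔
      (graphPlus m p q D).IsQuasiEven (fun _ => 1) V₁ V₂ := by
    intro V₁ V₂
    simp [IntDigraph.IsEven, IntDigraph.IsQuasiEven]
  simp only [e1]
  rw [h1]
  congr 1
  ext T
  simp only [Set.mem_ofPred_eq]
  refine and_congr_right fun hT => ?_
  rw [h.partProd_mem_iff hT]
  simp

/-- The defining conditions exclude each other, so the order of the tests is immaterial. The dummy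
value 0 imposes nothing at -1. -/
theorem twoSymbol_neg_one_iff :
    (twoSymbol m p D (-1) = 1 ↔ TwoNegOnePos m p D) ∧
      (twoSymbol m p D (-1) = -1 ↔ TwoNegOneNeg m p D) := by
  have hex : TwoNegOnePos m p D → ¬ TwoNegOneNeg m p D := by
    simp only [TwoNegOnePos, TwoNegOneNeg, Nat.ModEq]
    omega
  rw [twoSymbol, if_pos rfl]
  by_cases hP : TwoNegOnePos m p D
  · simp [hP, hex hP]
  · by_cases hN : TwoNegOneNeg m p D <;> simp [hP, hN]

theorem Admits.numQuasiEven_eq (h : Admits m p q D) (hO : ¬ OnlyEven m p D) :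
    numQuasiEven m p q D = Set.ncard {T : Finset ℕ | T ⊆ primesPlus p q D ∧
      2 * partProd T ∈ selmerIntegers p q D} := by
  rw [numQuasiEven, h.ncard_quasiEven (Or.inr rfl) (fun l => ?_)]
  · congr 1
    ext T
    simp only [Set.mem_ofPred_eq]
    refine and_congr_right fun hT => ?_
    rw [h.two_mul_partProd_mem_iff hT, EvenClassCondition, twoSymbol_neg_one_iff.1,
      twoSymbol_neg_one_iff.2, and_iff_right hO]
  · rw [twoSymbol, if_neg (by omega)]
    simp

theorem partProd_injOn : Set.InjOn partProd {T : Finset ℕ | T ⊆ D.primeFactors} := by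
  intro T hT T' hT' e
  rw [← primeFactors_partProd hT, ← primeFactors_partProd hT', e]

/-- Selmer integers split by parity into f and 2f, and f determines T by unique factorisation. -/
theorem Admits.ncard_selmerIntegers (h : Admits m p q D) :
    (selmerIntegers p q D).ncard =
      Set.ncard {T : Finset ℕ | T ⊆ primesPlus p q D ∧ partProd T ∈ selmerIntegers p q D} +
      Set.ncard {T : Finset ℕ | T ⊆ primesPlus p q D ∧
        2 * partProd T ∈ selmerIntegers p q D} := by
  have hfin : ∀ P : Finset ℕ → Prop, {T : Finset ℕ | T ⊆ primesPlus p q D ∧ P T}.Finite :=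
    fun P => (primesPlus p q D).powerset.finite_toSet.subset fun T hT =>
      Finset.mem_coe.2 (Finset.mem_powerset.2 hT.1)
  have hinj : ∀ P : Finset ℕ → Prop,
      Set.InjOn partProd {T : Finset ℕ | T ⊆ primesPlus p q D ∧ P T} := fun P =>
    partProd_injOn.mono fun T hT => hT.1.trans (primesPlus_subset (D := D))
  have hinj2 : ∀ P : Finset ℕ → Prop,
      Set.InjOn (fun T => 2 * partProd T) {T : Finset ℕ | T ⊆ primesPlus p q D ∧ P T} :=
    fun P T hT T' hT' e => hinj P hT hT' (Nat.eq_of_mul_eq_mul_left two_pos e)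
  rw [← (hinj _).ncard_image, ← (hinj2 _).ncard_image, ← Set.ncard_union_eq _
    ((hfin _).image _) ((hfin _).image _)]
  · congr 1
    ext d
    constructor
    · intro hd
      obtain ⟨T, hT, rfl | rfl⟩ := h.exists_part_of_selmer hd
      · exact Or.inl ⟨T, ⟨hT, hd⟩, rfl⟩
      · exact Or.inr ⟨T, ⟨hT, hd⟩, rfl⟩
    · rintro (⟨T, ⟨-, hT⟩, rfl⟩ | ⟨T, ⟨-, hT⟩, rfl⟩)
      · exact hT
      · exact hT
  · rw [Set.disjoint_left]
    rintro d ⟨T, ⟨hT, -⟩, rfl⟩ ⟨T', -, e⟩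
    have := (h.parity hT).1
    simp only at e
    omega

end Graph

/-! ### The count of the Selmer group -/

theorem theorem1p1 (m p q D : ℕ) (hm : 1 ≤ m) (hp : p.Prime) (hq : q.Prime)
    (hp2 : p ≠ 2) (hq2 : q ≠ 2) (hpq : q = p + 2 ^ m) (hD : Squarefree D)
    (h2D : ¬ 2 ∣ D) (hpD : ¬ p ∣ D) (hqD : ¬ q ∣ D) :
    (OnlyEven m p D →
      Nat.card (selmerGroup (curveE p q D) (kerPhi p q D)) = numEven m p q D) ∧
    (¬ OnlyEven m p D →
      Nat.card (selmerGroup (curveE p q D) (kerPhi p q D)) =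
        numEven m p q D + numQuasiEven m p q D) := by
  have h : Admits m p q D := ⟨hm, hp, hq, hp.eq_two_or_odd.resolve_left hp2, hpq, hD, by omega,
    hpD, hqD⟩
  rw [card_selmerGroup_eq_ncard h.curveNonsingular, h.ncard_selmerIntegers, ← h.numEven_eq]
  refine ⟨fun hO => ?_, fun hO => by rw [h.numQuasiEven_eq hO]⟩
  -- In the cases (a) the condition at 2 for 2f fails, so no even Selmer integer exists.
  have hempty : {T : Finset ℕ | T ⊆ primesPlus p q D ∧
      2 * partProd T ∈ selmerIntegers p q D} = ∅ := by
    refine Set.eq_empty_of_forall_notMem fun T hT => ?_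
    exact ((h.two_mul_partProd_mem_iff hT.1).1 hT.2).2.1 hO
  rw [hempty, Set.ncard_empty, add_zero]
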